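/- Let $(K,d)$ be a non-empty metric space in which sets of finite diameter are relatively compact, and let $(V,E,i,t)$ be a finite directed multigraph ($i(e)$, $t(e)$ are the initial and terminal vertex of the edge $e$). A \emph{Markov system} $(K_{i(e)},w_e,p_e)_{e\in E}$ consists of a partition $(K_v)_{v\in V}$ of $K$ into non-empty Borel sets, Borel maps $w_e:K\to K$ with $w_e(K_{i(e)})\subset K_{t(e)}$, and Borel functions $p_e\ge 0$ on $K$ with $\sum_{e\in E}p_e=1$ and $p_e=0$ off $K_{i(e)}$. It is \emph{irreducible} if its graph is, and \emph{contractive} (a CMS) if for some $0<a<1$ we have $\sum_{e\in E}p_e(x)\,d(w_ex,w_ey)\le a\,d(x,y)$ for all $x,y\in K_v$, $v\in V$. A Borel probability measure $\mu$ on $K$ is \emph{invariant} if $\int\sum_{e}p_e\cdot f\circ w_e\,d\mu=\int f\,d\mu$ for all bounded Borel $f:K\to\mathbb R$. Let $\Sigma=E^{\mathbb Z}$ with the product topology and left shift $S$. The \emph{generalized Markov measure} $M$ of an invariant $\mu$ is the Borel measure on $\Sigma$ with \[M(\{\sigma:\sigma_m=e_1,\dots,\sigma_{m+k-1}=e_k\})=\int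 p_{e_1}(x)\,p_{e_2}(w_{e_1}x)\cdots p_{e_k}(w_{e_{k-1}}\circ\dots\circ w_{e_1}x)\,d\mu(x)\] for all $m\in\mathbb Z$ and all words $e_1\dots e_k$. Fix $x_v\in K_v$ for each $v\in V$. Put $\Sigma_G=\{\sigma\in\Sigma: t(\sigma_j)=i(\sigma_{j+1})\ \forall j\in\mathbb Z\}$ and $F(\sigma)=\lim_{m\to-\infty}w_{\sigma_0}\circ w_{\sigma_{-1}}\circ\dots\circ w_{\sigma_m}x_{i(\sigma_m)}$ where the limit exists; let $D$ be the set of $\sigma\in\Sigma_G$ for which it exists, and $Y=\bigcap_{k\in\mathbb Z}S^k(D)$. Let $u(\sigma)=\log p_{\sigma_1}(F(\sigma))$ for $\sigma\in Y$ and $u(\sigma)=-\infty$ for $\sigma\in\Sigma\setminus Y$. For a Borel function $f:\Sigma\to[-\infty,0]$ (an \emph{energy function}) the \emph{pressure} is $P(f)=\sup_\Theta\left(h_\Theta(S)+\int f\,d\Theta\right)$, the supremum over all $S$-invariant Borel probability measures $\Theta$ on $\Sigma$, where $h_\Theta(S)$ is the Kolmogorov--Sinai entropy; an \emph{equilibrium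 state} for $f$ is an $S$-invariant Borel probability measure at which the supremum is attained. A function $h$ on a metric space is \emph{Dini-continuous} if $\int_0^c\phi(t)/t\,dt<\infty$ for some $c>0$, where $\phi(t)=\sup\{|h(x)-h(y)|:d(x,y)\le t\}$. \textbf{Corollary 1.} Suppose that $(K_{i(e)},w_e,p_e)_{e\in E}$ is an irreducible CMS, that every $K_v$ is open, and that every $p_e|_{K_{i(e)}}$ is Dini-continuous and bounded away from zero. Then $u$ is an energy function, there is exactly one invariant Borel probability measure $\mu$, its generalized Markov measure $M$ exists and is unique, and: (i) $M$ is the unique equilibrium state for $u$; (ii) $P(u)=0$; (iii) $M(Y)=1$ (so that $F$ is defined $M$-almost everywhere), and $F(M)=\mu$; (iv) $h_M(S)=-\sum_{e\in E}\int_{K_{i(e)}}p_e\log p_e\,d\mu$. -/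

import Mathlib

open MeasureTheory Filter Topology
open scoped ENNReal

/-! ### Entropy, pressure and equilibrium states -/

section Thermodynamics

variable {X : Type*} [MeasurableSpace X]

/-- Shannon entropy of the finite partition of `X` into the level sets of `ξ`. -/
noncomputable def partitionEntropy {ι : Type*} [Fintype ι] (μ : Measure X) (ξ : X → ι) : ℝ :=
  ∑ j, Real.negMulLog (μ.real (ξ ⁻¹' {j}))

/-- The level sets of `itinerary T ξ n` form the joined partition
`ξ ∨ T⁻¹ξ ∨ ⋯ ∨ T⁻⁽ⁿ⁻¹⁾ξ`. -/
def itinerary {ι : Type*} (T : X → X) (ξ : X → ι) (n : ℕ) : X → Fin n → ι :=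
  fun x k => ξ (T^[k] x)

/-- Kolmogorov–Sinai entropy of `T` with respect to the invariant probability measure `μ`: the
supremum over all finite measurable partitions of the entropy rate of the partition (for invariant
`μ` the upper limit below is a limit). -/
noncomputable def ksEntropy (T : X → X) (μ : Measure X) : EReal :=
  ⨆ (k : ℕ) (ξ : X → Fin k) (_ : Measurable ξ),
    limsup (fun n : ℕ => ((partitionEntropy μ (itinerary T ξ n) / n : ℝ) : EReal)) atTop

/-- A Borel measurable function with values in `[-∞, 0]`. -/
def IsEnergyFunction (f : X → EReal) : Prop :=
  Measurable f ∧ ∀ x, f x ≤ 0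

/-- The integral, with values in `[-∞, 0]`, of a measurable function with values in `[-∞, 0]`. -/
noncomputable def energyIntegral (μ : Measure X) (f : X → EReal) : EReal :=
  -((∫⁻ x, (-f x).toENNReal ∂μ : ℝ≥0∞) : EReal)

/-- `Θ` is a `T`-invariant probability measure. -/
def IsInvariantProb (T : X → X) (Θ : Measure X) : Prop :=
  IsProbabilityMeasure Θ ∧ MeasurePreserving T Θ Θ

/-- The pressure of an energy function `f` (for a transformation of finite topological entropy). -/
noncomputable def pressure (T : X → X) (f : X → EReal) : EReal :=
  ⨆ (Θ : Measure X) (_ : IsInvariantProb T Θ), (ksEntropy T Θ + energyIntegral Θ f)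

/-- `Λ` is an equilibrium state for the energy function `f`. -/
def IsEquilibriumState (T : X → X) (f : X → EReal) (Λ : Measure X) : Prop :=
  IsInvariantProb T Λ ∧ ksEntropy T Λ + energyIntegral Λ f = pressure T f

end Thermodynamics

/-! ### Dini continuity -/

section Dini

variable {X : Type*} [PseudoMetricSpace X]

/-- The modulus of uniform continuity of the restriction of `h` to `s`, with values in `[0, ∞]`. -/
noncomputable def modulusOn (h : X → ℝ) (s : Set X) (t : ℝ) : ℝ≥0∞ :=
  ⨆ (x ∈ s) (y ∈ s) (_ : dist x y ≤ t), ENNReal.ofReal |h x - h y|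

/-- The restriction of `h` to `s` is Dini-continuous. -/
def DiniContinuousOn (h : X → ℝ) (s : Set X) : Prop :=
  ∃ c : ℝ, 0 < c ∧ ∫⁻ t in Set.Ioc 0 c, modulusOn h s t / ENNReal.ofReal t < ⊤

end Dini

/-! ### The code space -/

section CodeSpace

variable {E : Type*}

/-- The `k`-th power of the left shift on the two-sided code space. -/
def shiftBy (k : ℤ) (σ : ℤ → E) : ℤ → E := fun n => σ (n + k)

/-- The left shift `S`. -/
def leftShift : (ℤ → E) → (ℤ → E) := shiftBy 1

/-- The cylinder of all `σ` in which the word `l` occurs at the places `m, m + 1, …`. -/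
def cylinderAt (m : ℤ) (l : List E) : Set (ℤ → E) :=
  {σ | ∀ (j : ℕ) (hj : j < l.length), σ (m + j) = l[j]}

end CodeSpace

/-! ### Markov systems -/

/-- A Markov system on `K` over a finite directed multigraph with vertices `V` and edges `E`. -/
structure MarkovSystem (K V E : Type*) [MeasurableSpace K] [Fintype E] where
  /-- initial vertex of an edge -/
  init : E → V
  /-- terminal vertex of an edge -/
  term : E → V
  /-- the vertex sets, a partition of `K` into non-empty Borel sets -/
  cell : V → Set K
  cell_nonempty : ∀ v, (cell v).Nonempty
  cell_measurable : ∀ v, MeasurableSet (cell v)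
  cell_disjoint : Pairwise fun v v' => Disjoint (cell v) (cell v')
  cell_cover : ⋃ v, cell v = Set.univ
  /-- the maps -/
  w : E → K → K
  w_measurable : ∀ e, Measurable (w e)
  w_mapsTo : ∀ e, Set.MapsTo (w e) (cell (init e)) (cell (term e))
  /-- the probability functions -/
  p : E → K → ℝ
  p_measurable : ∀ e, Measurable (p e)
  p_nonneg : ∀ e x, 0 ≤ p e x
  p_sum : ∀ x, ∑ e, p e x = 1
  p_eq_zero : ∀ e x, x ∉ cell (init e) → p e x = 0

namespace MarkovSystem

variable {K V E : Type*} [MeasurableSpace K] [Fintype E] (𝓜 : MarkovSystem K V E)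

/-- The directed graph is irreducible: every vertex is reached from every vertex by a path. -/
def IsIrreducible : Prop :=
  ∀ v v' : V, Relation.ReflTransGen (fun a b => ∃ e, 𝓜.init e = a ∧ 𝓜.term e = b) v v'

/-- Contractiveness on average, with some rate `0 < a < 1`. -/
def IsContractive [PseudoMetricSpace K] : Prop :=
  ∃ a : ℝ, 0 < a ∧ a < 1 ∧ ∀ v, ∀ x ∈ 𝓜.cell v, ∀ y ∈ 𝓜.cell v,
    ∑ e, 𝓜.p e x * dist (𝓜.w e x) (𝓜.w e y) ≤ a * dist x y

/-- The Markov operator `U`. -/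
noncomputable def markovOp (f : K → ℝ) (x : K) : ℝ := ∑ e, 𝓜.p e x * f (𝓜.w e x)

/-- `μ` is an invariant Borel probability measure: `U*μ = μ`, where `U*μ(f) = ∫ U f dμ` for all
bounded Borel functions `f`. -/
def IsInvariantMeasure (μ : Measure K) : Prop :=
  IsProbabilityMeasure μ ∧ ∀ f : K → ℝ, Measurable f → (∃ C, ∀ x, |f x| ≤ C) →
    ∫ x, 𝓜.markovOp f x ∂μ = ∫ x, f x ∂μ

/-- `p_{e₁}(x) p_{e₂}(w_{e₁} x) ⋯ p_{eₖ}(w_{eₖ₋₁} ⋯ w_{e₁} x)` for the word `[e₁, …, eₖ]`. -/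
noncomputable def wordProb : List E → K → ℝ
  | [], _ => 1
  | e :: l, x => 𝓜.p e x * wordProb l (𝓜.w e x)

/-- `M` is the generalized Markov measure on the code space given by `μ`. -/
def IsGeneralizedMarkovMeasure [MeasurableSpace E] (μ : Measure K) (M : Measure (ℤ → E)) : Prop :=
  ∀ (m : ℤ) (l : List E), M (cylinderAt m l) = ∫⁻ x, ENNReal.ofReal (𝓜.wordProb l x) ∂μ

/-- The paths of the graph, `Σ_G`. -/
def pathSpace : Set (ℤ → E) := {σ | ∀ j, 𝓜.term (σ j) = 𝓜.init (σ (j + 1))}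

/-- `w_{σ₀} ∘ w_{σ₋₁} ∘ ⋯ ∘ w_{σ₋ₙ}`. -/
def pastMap (σ : ℤ → E) : ℕ → K → K
  | 0 => 𝓜.w (σ 0)
  | n + 1 => pastMap σ n ∘ 𝓜.w (σ (-((n : ℤ) + 1)))

/-- `w_{σ₀} ∘ w_{σ₋₁} ∘ ⋯ ∘ w_{σ₋ₙ} (x_{i(σ₋ₙ)})`. -/
def codingSeq (x : V → K) (σ : ℤ → E) (n : ℕ) : K :=
  𝓜.pastMap σ n (x (𝓜.init (σ (-(n : ℤ)))))

/-- The coding map `F`; its value is meaningful where the limit exists. -/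
noncomputable def codingMap [TopologicalSpace K] [Nonempty K] (x : V → K) (σ : ℤ → E) : K :=
  limUnder atTop (𝓜.codingSeq x σ)

/-- The set `D` of the paths along which the limit defining the coding map exists. -/
def convergenceSet [TopologicalSpace K] (x : V → K) : Set (ℤ → E) :=
  {σ | σ ∈ 𝓜.pathSpace ∧ ∃ y, Tendsto (𝓜.codingSeq x σ) atTop (𝓝 y)}

/-- `Y = ⋂_{k ∈ ℤ} S^k(D)`. -/
def codingDomain [TopologicalSpace K] (x : V → K) : Set (ℤ → E) :=
  ⋂ k : ℤ, shiftBy k '' 𝓜.convergenceSet x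

open Classical in
/-- The energy function `u`. -/
noncomputable def energy [TopologicalSpace K] [Nonempty K] (x : V → K) (σ : ℤ → E) : EReal :=
  if σ ∈ 𝓜.codingDomain x then ((Real.log (𝓜.p (σ 1) (𝓜.codingMap x σ)) : ℝ) : EReal) else ⊥

end MarkovSystem

/-! ### Sums over words -/

section Words

variable {E : Type*} [Fintype E] {A : Type*} [AddCommMonoid A]

/-! The energy u is the logarithm of a transition probability: under M, given the letters up to
place 0, the letter at place 1 is e with probability p_e(F(σ)), and F has law μ.

Let Λ be shift-invariant. If Λ(Y) < 1, its energy integral is -∞. Otherwise compare the true law of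
the next letter, given k + 1 past letters, with the law predicted by p at the point coded by those
letters. The mean of minus the log of the prediction, less the conditional entropy, is a relative
entropy, hence nonnegative; as k grows the first term tends to -∫ u dΛ, so h_Λ + ∫ u dΛ ≤ 0. If this
sum is 0, the relative entropies come arbitrarily close to 0. They dominate squared Hellinger
distances, hence squared total variation, so the true law is the predicted one
(`measureReal_inter_eq_of_le_ksEntropy`). Then F(Λ) is invariant and Λ is its generalized Markov
measure (`NextLetterLaw.isGeneralizedMarkovMeasure`), so uniqueness of μ gives Λ = M.

Uniqueness of μ (`push_eq_unique`): two different invariant measures yield two mutually singular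
ones, each charging every cell by irreducibility and the lower bounds on p. Dini continuity and
contraction on average make the laws of the words issued from two points of a cell at bounded
distance overlap by some η independent of the length (`exists_overlap`), while trajectories along a
common word approach each other on average. Hence, for Lipschitz f and large n, the n-th iterate of
f under the Markov operator cannot be close to 1 at one such point and close to 0 at another,
against singularity.

Existence of μ (`exists_push_eq`): the distance to the base point of the cell satisfies a drift
inequality, so averages of the laws of the chain are tight; the Markov operator preserves continuity
because the cells are open, so a limit point is invariant. That distance has finite μ-mean, which
makes the successive terms of the coding sequence summably close in M-mean; hence M(Y) = 1, and the
joint law of the letter at place 1 and F is as expected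
(`IsGeneralizedMarkovMeasure.map_restrict_codingMap`).

Finally M attains the value 0: Jensen's inequality bounds h_M from below by the μ-mean of the
entropy of the next edge, which equals -∫ u dM, and the general inequality is the matching upper
bound. -/

theorem sum_ofFn_succ (n : ℕ) (f : List E → A) :
    ∑ g : Fin (n + 1) → E, f (List.ofFn g) = ∑ e, ∑ g : Fin n → E, f (e :: List.ofFn g) := by
  rw [← (Fin.consEquiv fun _ => E).sum_comp, Fintype.sum_prod_type]
  simp [Fin.consEquiv, List.ofFn_succ]

theorem sum_ofFn_succ_last (n : ℕ) (f : List E → A) :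
    ∑ g : Fin (n + 1) → E, f (List.ofFn g) = ∑ g : Fin n → E, ∑ e, f (List.ofFn g ++ [e]) := by
  induction n generalizing f with
  | zero => rw [sum_ofFn_succ]; simp
  | succ n ih =>
    rw [sum_ofFn_succ, sum_ofFn_succ n fun l => ∑ e, f (l ++ [e])]
    refine Finset.sum_congr rfl fun e _ => ?_
    rw [ih fun l => f (e :: l)]
    simp

end Words

namespace MarkovSystem

variable {K V E : Type*} [MeasurableSpace K] [Fintype E] (𝓜 : MarkovSystem K V E)

/-- `w_{eₖ} ∘ ⋯ ∘ w_{e₁}` for the word `[e₁, …, eₖ]`. -/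
def wordMap : List E → K → K
  | [], x => x
  | e :: l, x => wordMap l (𝓜.w e x)

@[simp] theorem wordProb_nil (x : K) : 𝓜.wordProb [] x = 1 := rfl

@[simp] theorem wordProb_cons (e : E) (l : List E) (x : K) :
    𝓜.wordProb (e :: l) x = 𝓜.p e x * 𝓜.wordProb l (𝓜.w e x) := rfl

@[simp] theorem wordMap_nil (x : K) : 𝓜.wordMap [] x = x := rfl

@[simp] theorem wordMap_cons (e : E) (l : List E) (x : K) :
    𝓜.wordMap (e :: l) x = 𝓜.wordMap l (𝓜.w e x) := rfl

theorem wordMap_append (l l' : List E) (x : K) :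
    𝓜.wordMap (l ++ l') x = 𝓜.wordMap l' (𝓜.wordMap l x) := by
  induction l generalizing x with
  | nil => rfl
  | cons e l ih => simp [ih]

theorem wordProb_append (l l' : List E) (x : K) :
    𝓜.wordProb (l ++ l') x = 𝓜.wordProb l x * 𝓜.wordProb l' (𝓜.wordMap l x) := by
  induction l generalizing x with
  | nil => simp
  | cons e l ih => simp [ih, mul_assoc]

theorem wordProb_nonneg (l : List E) (x : K) : 0 ≤ 𝓜.wordProb l x := by
  induction l generalizing x with
  | nil => simp
  | cons e l ih => exact mul_nonneg (𝓜.p_nonneg _ _) (ih _)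

theorem p_le_one (e : E) (x : K) : 𝓜.p e x ≤ 1 := by
  rw [← 𝓜.p_sum x]
  exact Finset.single_le_sum (f := fun e => 𝓜.p e x) (fun e _ => 𝓜.p_nonneg e x) (Finset.mem_univ e)

theorem wordProb_le_one (l : List E) (x : K) : 𝓜.wordProb l x ≤ 1 := by
  induction l generalizing x with
  | nil => simp
  | cons e l ih => exact mul_le_one₀ (𝓜.p_le_one _ _) (𝓜.wordProb_nonneg _ _) (ih _)

@[fun_prop]
theorem measurable_wordMap (l : List E) : Measurable (𝓜.wordMap l) := by
  induction l with
  | nil => exact measurable_id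
  | cons e l ih => exact ih.comp (𝓜.w_measurable e)

@[fun_prop]
theorem measurable_wordProb (l : List E) : Measurable (𝓜.wordProb l) := by
  induction l with
  | nil => exact measurable_const
  | cons e l ih => exact (𝓜.p_measurable e).mul (ih.comp (𝓜.w_measurable e))

theorem sum_wordProb (n : ℕ) (x : K) : ∑ g : Fin n → E, 𝓜.wordProb (List.ofFn g) x = 1 := by
  induction n generalizing x with
  | zero => simp
  | succ n ih =>
    rw [sum_ofFn_succ n fun l => 𝓜.wordProb l x]
    simp [← Finset.mul_sum, ih, 𝓜.p_sum]

theorem mem_cell_init_of_p_ne_zero {e : E} {x : K} (h : 𝓜.p e x ≠ 0) : x ∈ 𝓜.cell (𝓜.init e) := by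
  by_contra hx
  exact h (𝓜.p_eq_zero e x hx)

theorem exists_mem_cell (x : K) : ∃ v, x ∈ 𝓜.cell v := by
  have h : x ∈ ⋃ v, 𝓜.cell v := by rw [𝓜.cell_cover]; trivial
  simpa using h

theorem cell_unique {v v' : V} {x : K} (h : x ∈ 𝓜.cell v) (h' : x ∈ 𝓜.cell v') : v = v' := by
  by_contra hv
  exact Set.disjoint_left.1 (𝓜.cell_disjoint hv) h h'

/-- An edge of positive probability at one point of a cell starts at that cell, so it carries every
other point of the cell along. This keeps two trajectories in common cells, where the contraction
hypothesis applies, along any word of positive probability. -/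
theorem mem_cell_of_p_ne_zero {e : E} {x y : K} {v : V} (h : 𝓜.p e x ≠ 0) (hx : x ∈ 𝓜.cell v)
    (hy : y ∈ 𝓜.cell v) : 𝓜.w e x ∈ 𝓜.cell (𝓜.term e) ∧ 𝓜.w e y ∈ 𝓜.cell (𝓜.term e) := by
  obtain rfl := 𝓜.cell_unique hx (𝓜.mem_cell_init_of_p_ne_zero h)
  exact ⟨𝓜.w_mapsTo e hx, 𝓜.w_mapsTo e hy⟩

/-- The action of the Markov system on measures. -/
noncomputable def push (ν : Measure K) : Measure K :=
  ∑ e, (ν.withDensity fun x => ENNReal.ofReal (𝓜.p e x)).map (𝓜.w e)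

@[fun_prop]
theorem measurable_ofReal_p (e : E) : Measurable fun x => ENNReal.ofReal (𝓜.p e x) :=
  (𝓜.p_measurable e).ennreal_ofReal

theorem lintegral_push (ν : Measure K) {f : K → ℝ≥0∞} (hf : Measurable f) :
    ∫⁻ x, f x ∂(𝓜.push ν) = ∫⁻ x, ∑ e, ENNReal.ofReal (𝓜.p e x) * f (𝓜.w e x) ∂ν := by
  have hw : ∀ e, Measurable fun x => f (𝓜.w e x) := fun e => hf.comp (𝓜.w_measurable e)
  have hpw : ∀ e, Measurable fun x => ENNReal.ofReal (𝓜.p e x) * f (𝓜.w e x) := fun e =>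
    (𝓜.measurable_ofReal_p e).mul (hw e)
  rw [push, lintegral_finsetSum_measure, lintegral_finsetSum _ fun e _ => hpw e]
  refine Finset.sum_congr rfl fun e _ => ?_
  rw [lintegral_map hf (𝓜.w_measurable e),
    lintegral_withDensity_eq_lintegral_mul _ (𝓜.measurable_ofReal_p e) (hw e)]
  rfl

theorem sum_ofReal_p (x : K) : ∑ e, ENNReal.ofReal (𝓜.p e x) = 1 := by
  rw [← ENNReal.ofReal_sum_of_nonneg fun e _ => 𝓜.p_nonneg _ _, 𝓜.p_sum, ENNReal.ofReal_one]

theorem push_univ (ν : Measure K) : 𝓜.push ν Set.univ = ν Set.univ := by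
  have := 𝓜.lintegral_push ν (f := fun _ => 1) measurable_const
  simpa [𝓜.sum_ofReal_p] using this

theorem push_add (ν ν' : Measure K) : 𝓜.push (ν + ν') = 𝓜.push ν + 𝓜.push ν' := by
  simp only [push, withDensity_add_measure, ← Finset.sum_add_distrib]
  exact Finset.sum_congr rfl fun e _ => Measure.map_add _ _ (𝓜.w_measurable e)

instance (ν : Measure K) [IsProbabilityMeasure ν] : IsProbabilityMeasure (𝓜.push ν) :=
  ⟨by rw [push_univ, measure_univ]⟩

instance (ν : Measure K) [IsFiniteMeasure ν] : IsFiniteMeasure (𝓜.push ν) :=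
  ⟨by rw [push_univ]; exact measure_lt_top _ _⟩

theorem integral_push (ν : Measure K) [IsFiniteMeasure ν] {f : K → ℝ} (hf : Measurable f) {C : ℝ}
    (hC : ∀ x, |f x| ≤ C) : ∫ x, f x ∂(𝓜.push ν) = ∫ x, 𝓜.markovOp f x ∂ν := by
  have hi : ∀ (ν' : Measure K) [IsFiniteMeasure ν'], Integrable f ν' := fun ν' _ =>
    Integrable.of_bound hf.aestronglyMeasurable C (ae_of_all _ fun x => by simpa using hC x)
  have hfin : ∀ e, IsFiniteMeasure (ν.withDensity fun x => ENNReal.ofReal (𝓜.p e x)) := fun e =>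
    isFiniteMeasure_withDensity_ofReal <|
      (Integrable.of_bound (𝓜.p_measurable e).aestronglyMeasurable 1
        (ae_of_all _ fun x => by
          simpa [abs_of_nonneg (𝓜.p_nonneg e x)] using 𝓜.p_le_one e x)).hasFiniteIntegral
  have hpf : ∀ e, Integrable (fun x => 𝓜.p e x * f (𝓜.w e x)) ν := fun e =>
    Integrable.of_bound ((𝓜.p_measurable e).mul
      (hf.comp (𝓜.w_measurable e))).aestronglyMeasurable C (ae_of_all _ fun x => by
        rw [Real.norm_eq_abs, abs_mul, abs_of_nonneg (𝓜.p_nonneg e x)]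
        calc _ ≤ 1 * |f (𝓜.w e x)| := by gcongr; exact 𝓜.p_le_one e x
          _ ≤ C := by simpa using hC _)
  rw [push, integral_finsetSum_measure fun e _ => hi _]
  simp only [markovOp]
  rw [integral_finsetSum _ fun e _ => hpf e]
  refine Finset.sum_congr rfl fun e _ => ?_
  rw [integral_map (𝓜.w_measurable e).aemeasurable hf.aestronglyMeasurable,
    integral_withDensity_eq_integral_toReal_smul (𝓜.measurable_ofReal_p e)
      (ae_of_all _ fun x => ENNReal.ofReal_lt_top)]
  simp [ENNReal.toReal_ofReal (𝓜.p_nonneg e _)]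

theorem isInvariantMeasure_iff (μ : Measure K) :
    𝓜.IsInvariantMeasure μ ↔ IsProbabilityMeasure μ ∧ 𝓜.push μ = μ := by
  refine and_congr_right fun hμ => ⟨fun h => ?_, fun h f hf ⟨C, hC⟩ => ?_⟩
  · ext s hs
    have h1 := h (s.indicator 1) (measurable_one.indicator hs)
      ⟨1, fun x => by by_cases hx : x ∈ s <;> simp [hx]⟩
    rw [← 𝓜.integral_push μ (C := 1) (measurable_one.indicator hs)
      (fun x => by by_cases hx : x ∈ s <;> simp [hx]), integral_indicator_one hs,
      integral_indicator_one hs] at h1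
    exact (measureReal_eq_measureReal_iff).1 h1
  · rw [← 𝓜.integral_push μ hf hC, h]

theorem lintegral_wordMap_of_push_eq {ν : Measure K} (hν : 𝓜.push ν = ν) (n : ℕ) {f : K → ℝ≥0∞}
    (hf : Measurable f) :
    ∫⁻ x, ∑ g : Fin n → E, ENNReal.ofReal (𝓜.wordProb (List.ofFn g) x) *
      f (𝓜.wordMap (List.ofFn g) x) ∂ν = ∫⁻ x, f x ∂ν := by
  induction n with
  | zero => simp
  | succ n ih =>
    rw [← ih]
    conv_rhs => rw [← hν]
    rw [lintegral_push]
    · refine lintegral_congr fun x => ?_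
      rw [sum_ofFn_succ n fun l => ENNReal.ofReal (𝓜.wordProb l x) * f (𝓜.wordMap l x)]
      refine Finset.sum_congr rfl fun e _ => ?_
      rw [Finset.mul_sum]
      refine Finset.sum_congr rfl fun g _ => ?_
      simp [ENNReal.ofReal_mul (𝓜.p_nonneg e x), mul_assoc]
    · refine Finset.measurable_sum _ fun g _ => ?_
      have := hf.comp (𝓜.measurable_wordMap (List.ofFn g))
      exact (𝓜.measurable_wordProb _).ennreal_ofReal.mul this

/-- The `n`-th power of the Markov operator. -/
noncomputable def wordOp (n : ℕ) (f : K → ℝ) (x : K) : ℝ :=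
  ∑ g : Fin n → E, 𝓜.wordProb (List.ofFn g) x * f (𝓜.wordMap (List.ofFn g) x)

theorem lintegral_wordOp_of_push_eq {ν : Measure K} (hν : 𝓜.push ν = ν) (n : ℕ) {f : K → ℝ}
    (hf : Measurable f) (hf0 : ∀ x, 0 ≤ f x) :
    ∫⁻ x, ENNReal.ofReal (𝓜.wordOp n f x) ∂ν = ∫⁻ x, ENNReal.ofReal (f x) ∂ν := by
  rw [← 𝓜.lintegral_wordMap_of_push_eq hν n hf.ennreal_ofReal]
  refine lintegral_congr fun x => ?_
  rw [wordOp, ENNReal.ofReal_sum_of_nonneg fun g _ => mul_nonneg (𝓜.wordProb_nonneg _ _) (hf0 _)]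
  exact Finset.sum_congr rfl fun g _ => ENNReal.ofReal_mul (𝓜.wordProb_nonneg _ _)

theorem wordOp_succ (n : ℕ) (f : K → ℝ) (x : K) :
    𝓜.wordOp (n + 1) f x = ∑ e, 𝓜.p e x * 𝓜.wordOp n f (𝓜.w e x) := by
  rw [wordOp, sum_ofFn_succ n fun l => 𝓜.wordProb l x * f (𝓜.wordMap l x)]
  simp [wordOp, Finset.mul_sum, mul_assoc]

end MarkovSystem

/-! ### Dini continuity -/

section Dini

variable {X : Type*} [PseudoMetricSpace X]

theorem modulusOn_mono (h : X → ℝ) (s : Set X) : Monotone (modulusOn h s) := by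
  intro t t' htt
  refine iSup₂_le fun x hx => iSup₂_le fun y hy => iSup_le fun hxy => ?_
  exact le_iSup₂_of_le x hx (le_iSup₂_of_le y hy (le_iSup_of_le (hxy.trans htt) le_rfl))

theorem le_modulusOn {h : X → ℝ} {s : Set X} {t : ℝ} {x y : X} (hx : x ∈ s) (hy : y ∈ s)
    (hxy : dist x y ≤ t) : ENNReal.ofReal |h x - h y| ≤ modulusOn h s t :=
  le_iSup₂_of_le x hx (le_iSup₂_of_le y hy (le_iSup_of_le hxy le_rfl))

theorem modulusOn_le_one {h : X → ℝ} (s : Set X) (h0 : ∀ x, 0 ≤ h x) (h1 : ∀ x, h x ≤ 1) (t : ℝ) :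
    modulusOn h s t ≤ 1 := by
  refine iSup₂_le fun x hx => iSup₂_le fun y hy => iSup_le fun hxy => ?_
  rw [← ENNReal.ofReal_one]
  refine ENNReal.ofReal_le_ofReal (abs_sub_le_iff.2 ⟨?_, ?_⟩) <;>
    linarith [h0 x, h1 x, h0 y, h1 y]

/-- By monotonicity the integrand is at least its numerator at the left end divided by the right
end, and the interval has length t(1 - b). -/
theorem modulusOn_mul_le_setLIntegral (h : X → ℝ) (s : Set X) {b t : ℝ} (ht : 0 < t) :
    modulusOn h s (t * b) * ENNReal.ofReal (1 - b) ≤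
      ∫⁻ r in Set.Ioc (t * b) t, modulusOn h s r / ENNReal.ofReal r := by
  calc modulusOn h s (t * b) * ENNReal.ofReal (1 - b)
      = ∫⁻ r in Set.Ioc (t * b) t, modulusOn h s (t * b) / ENNReal.ofReal t := by
        rw [setLIntegral_const, Real.volume_Ioc, show t - t * b = t * (1 - b) by ring,
          ENNReal.ofReal_mul ht.le, ← mul_assoc,
          ENNReal.div_mul_cancel (by simpa using ht) ENNReal.ofReal_ne_top]
    _ ≤ _ := by
        refine setLIntegral_mono' measurableSet_Ioc fun r hr => ?_
        exact ENNReal.div_le_div (modulusOn_mono h s hr.1.le) (ENNReal.ofReal_le_ofReal hr.2)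

/-- The Dini integral dominates, up to the factor 1 - b, the sum of the modulus along a geometric
sequence, one interval per term. -/
theorem DiniContinuousOn.tsum_modulusOn_ne_top {h : X → ℝ} {s : Set X} (hd : DiniContinuousOn h s)
    (h0 : ∀ x, 0 ≤ h x) (h1 : ∀ x, h x ≤ 1) {b T : ℝ} (hb0 : 0 < b) (hb1 : b < 1) (hT : 0 < T) :
    ∑' k : ℕ, modulusOn h s (T * b ^ k) ≠ ⊤ := by
  obtain ⟨c, hc, hInt⟩ := hd
  -- From the index N on, the intervals lie in (0, c], where the integral is finite; the finitely
  -- many earlier terms are at most 1.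
  obtain ⟨N, hN⟩ := exists_pow_lt_of_lt_one (show 0 < c / T by positivity) hb1
  rw [lt_div_iff₀ hT] at hN
  have hanti : Antitone fun k : ℕ => T * b ^ (k + N) := fun i j hij =>
    mul_le_mul_of_nonneg_left (pow_le_pow_of_le_one hb0.le hb1.le (by omega)) hT.le
  have hdisj : Pairwise (Function.onFun Disjoint
      fun k : ℕ => Set.Ioc (T * b ^ (k + 1 + N)) (T * b ^ (k + N))) := by
    simpa using hanti.pairwise_disjoint_on_Ioc_succ
  have htail : (∑' k : ℕ, modulusOn h s (T * b ^ (k + (N + 1)))) * ENNReal.ofReal (1 - b) ≠ ⊤ := by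
    refine ne_top_of_le_ne_top hInt.ne ?_
    rw [← ENNReal.tsum_mul_right]
    calc _ ≤ ∑' k : ℕ, ∫⁻ r in Set.Ioc (T * b ^ (k + 1 + N)) (T * b ^ (k + N)),
            modulusOn h s r / ENNReal.ofReal r := by
          refine ENNReal.tsum_le_tsum fun k => ?_
          have := modulusOn_mul_le_setLIntegral h s (b := b) (show 0 < T * b ^ (k + N) by positivity)
          rw [show T * b ^ (k + N) * b = T * b ^ (k + 1 + N) by ring] at this
          rwa [show k + (N + 1) = k + 1 + N by omega]
      _ = ∫⁻ r in ⋃ k : ℕ, Set.Ioc (T * b ^ (k + 1 + N)) (T * b ^ (k + N)),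
            modulusOn h s r / ENNReal.ofReal r :=
          (lintegral_iUnion (fun _ => measurableSet_Ioc) hdisj _).symm
      _ ≤ _ := by
          refine lintegral_mono_set (Set.iUnion_subset fun k r hr => ⟨?_, ?_⟩)
          · exact lt_of_le_of_lt (by positivity) hr.1
          · refine hr.2.trans ?_
            have := hanti (Nat.zero_le k)
            simp only [zero_add] at this
            linarith
  have htail' : ∑' k : ℕ, modulusOn h s (T * b ^ (k + (N + 1))) ≠ ⊤ := by
    intro htop
    refine htail ?_
    rw [htop]
    exact ENNReal.top_mul (by simpa using hb1)
  rw [← ENNReal.summable.sum_add_tsum_nat_add' (k := N + 1)]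
  refine ENNReal.add_ne_top.2 ⟨?_, htail'⟩
  exact ENNReal.sum_ne_top.2 fun k _ =>
    ne_top_of_le_ne_top ENNReal.one_ne_top (modulusOn_le_one s h0 h1 _)

end Dini

namespace MarkovSystem

variable {K V E : Type*} [MeasurableSpace K] [Fintype E] (𝓜 : MarkovSystem K V E)

/-! ### Contraction along words and overlap of word laws. -/

section Contraction

variable [PseudoMetricSpace K]

/-- Contractiveness on average with the given rate. -/
def ContractsBy (a : ℝ) : Prop :=
  ∀ v, ∀ x ∈ 𝓜.cell v, ∀ y ∈ 𝓜.cell v,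
    ∑ e, 𝓜.p e x * dist (𝓜.w e x) (𝓜.w e y) ≤ a * dist x y

variable {𝓜}

theorem ContractsBy.sum_wordProb_mul_dist_le {a : ℝ} (ha : 𝓜.ContractsBy a) (ha0 : 0 ≤ a) (n : ℕ)
    {v : V} {x y : K} (hx : x ∈ 𝓜.cell v) (hy : y ∈ 𝓜.cell v) :
    ∑ g : Fin n → E, 𝓜.wordProb (List.ofFn g) x *
      dist (𝓜.wordMap (List.ofFn g) x) (𝓜.wordMap (List.ofFn g) y) ≤ a ^ n * dist x y := by
  induction n generalizing v x y with
  | zero => simp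
  | succ n ih =>
    rw [sum_ofFn_succ n fun l => 𝓜.wordProb l x * dist (𝓜.wordMap l x) (𝓜.wordMap l y)]
    calc _ ≤ ∑ e, 𝓜.p e x * (a ^ n * dist (𝓜.w e x) (𝓜.w e y)) := by
          refine Finset.sum_le_sum fun e _ => ?_
          simp only [wordProb_cons, wordMap_cons, mul_assoc, ← Finset.mul_sum]
          by_cases hp : 𝓜.p e x = 0
          · simp [hp]
          obtain ⟨hx', hy'⟩ := 𝓜.mem_cell_of_p_ne_zero hp hx hy
          exact mul_le_mul_of_nonneg_left (ih hx' hy') (𝓜.p_nonneg e x)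
      _ = a ^ n * ∑ e, 𝓜.p e x * dist (𝓜.w e x) (𝓜.w e y) := by
          rw [Finset.mul_sum]
          exact Finset.sum_congr rfl fun e _ => by ring
      _ ≤ a ^ n * (a * dist x y) := mul_le_mul_of_nonneg_left (ha v x hx y hy) (by positivity)
      _ = _ := by ring

variable (𝓜) in
/-- The distances of two trajectories along a word, summed with the weights `b⁻ᵏ`. -/
noncomputable def weightedDist (b : ℝ) : List E → K → K → ℝ
  | [], _, _ => 0
  | e :: l, x, y => dist x y + b⁻¹ * weightedDist b l (𝓜.w e x) (𝓜.w e y)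

theorem weightedDist_nonneg {b : ℝ} (hb : 0 ≤ b) (l : List E) (x y : K) :
    0 ≤ 𝓜.weightedDist b l x y := by
  induction l generalizing x y with
  | nil => exact le_rfl
  | cons e l ih =>
    have := ih (𝓜.w e x) (𝓜.w e y)
    simp only [weightedDist]
    positivity

/-- After k letters the mean distance is at most a^k times the initial one, so the weights b⁻ᵏ give
a geometric series of ratio a/b. The hypothesis on c says that c bounds its sum, in the form that
the induction needs. -/
theorem ContractsBy.sum_wordProb_mul_weightedDist_le {a b c : ℝ} (ha : 𝓜.ContractsBy a)
    (hb : 0 < b) (hc : 0 ≤ c) (hbc : 1 + b⁻¹ * a * c ≤ c) (n : ℕ)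
    {v : V} {x y : K} (hx : x ∈ 𝓜.cell v) (hy : y ∈ 𝓜.cell v) :
    ∑ g : Fin n → E, 𝓜.wordProb (List.ofFn g) x *
      𝓜.weightedDist b (List.ofFn g) x y ≤ c * dist x y := by
  induction n generalizing v x y with
  | zero => simpa [weightedDist] using mul_nonneg hc dist_nonneg
  | succ n ih =>
    rw [sum_ofFn_succ n fun l => 𝓜.wordProb l x * 𝓜.weightedDist b l x y]
    calc _ ≤ ∑ e, 𝓜.p e x * (dist x y + b⁻¹ * (c * dist (𝓜.w e x) (𝓜.w e y))) := by
          refine Finset.sum_le_sum fun e _ => ?_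
          simp only [wordProb_cons, weightedDist, mul_assoc, ← Finset.mul_sum]
          by_cases hp : 𝓜.p e x = 0
          · simp [hp]
          obtain ⟨hx', hy'⟩ := 𝓜.mem_cell_of_p_ne_zero hp hx hy
          refine mul_le_mul_of_nonneg_left ?_ (𝓜.p_nonneg e x)
          simp only [mul_add, Finset.sum_add_distrib, ← Finset.sum_mul, sum_wordProb, one_mul]
          gcongr
          simp only [mul_left_comm _ b⁻¹, ← Finset.mul_sum]
          exact mul_le_mul_of_nonneg_left (ih hx' hy') (by positivity)
      _ = dist x y + b⁻¹ * c * ∑ e, 𝓜.p e x * dist (𝓜.w e x) (𝓜.w e y) := by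
          simp only [mul_add, Finset.sum_add_distrib, ← Finset.sum_mul, 𝓜.p_sum, one_mul]
          rw [Finset.mul_sum]
          congr 1
          exact Finset.sum_congr rfl fun e _ => by ring
      _ ≤ dist x y + b⁻¹ * c * (a * dist x y) := by
          gcongr
          exact ha v x hx y hy
      _ = (1 + b⁻¹ * a * c) * dist x y := by ring
      _ ≤ _ := mul_le_mul_of_nonneg_right hbc dist_nonneg

/-- A weighted distance of at most T forces the k-th distance below T b^k. The ratio of the two word
probabilities is then controlled factor by factor. -/
theorem wordProb_mul_exp_le {φ : ℝ → ℝ}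
    (hφ : ∀ e, ∀ x ∈ 𝓜.cell (𝓜.init e), ∀ y ∈ 𝓜.cell (𝓜.init e), ∀ t, dist x y ≤ t →
      𝓜.p e x * Real.exp (-φ t) ≤ 𝓜.p e y)
    {b : ℝ} (hb : 0 < b) (l : List E) {v : V} {x y : K} (hx : x ∈ 𝓜.cell v) (hy : y ∈ 𝓜.cell v)
    {T : ℝ} (hT : 𝓜.weightedDist b l x y ≤ T) :
    𝓜.wordProb l x * Real.exp (-∑ k ∈ Finset.range l.length, φ (T * b ^ k)) ≤ 𝓜.wordProb l y := by
  induction l generalizing v x y T with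
  | nil => simp
  | cons e l ih =>
    by_cases hp : 𝓜.p e x = 0
    · simpa [hp] using mul_nonneg (𝓜.p_nonneg e y) (𝓜.wordProb_nonneg _ _)
    obtain ⟨hx', hy'⟩ := 𝓜.mem_cell_of_p_ne_zero hp hx hy
    obtain rfl := 𝓜.cell_unique hx (𝓜.mem_cell_init_of_p_ne_zero hp)
    simp only [weightedDist] at hT
    have hW := weightedDist_nonneg (𝓜 := 𝓜) hb.le l (𝓜.w e x) (𝓜.w e y)
    have hW' : 0 ≤ b⁻¹ * 𝓜.weightedDist b l (𝓜.w e x) (𝓜.w e y) := by positivity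
    have h1 := hφ e x hx y hy T (by linarith)
    have h2 := ih hx' hy' (T := T * b) (by
      rw [← div_le_iff₀ hb, div_eq_inv_mul]
      linarith [dist_nonneg (x := x) (y := y)])
    rw [List.length_cons, Finset.sum_range_succ']
    simp only [wordProb_cons, pow_zero, mul_one, neg_add, Real.exp_add]
    have h3 : ∑ k ∈ Finset.range l.length, φ (T * b ^ (k + 1)) =
        ∑ k ∈ Finset.range l.length, φ (T * b * b ^ k) :=
      Finset.sum_congr rfl fun k _ => by rw [pow_succ', mul_assoc]
    rw [h3]
    calc _ = (𝓜.p e x * Real.exp (-φ T)) * (𝓜.wordProb l (𝓜.w e x) *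
          Real.exp (-∑ k ∈ Finset.range l.length, φ (T * b * b ^ k))) := by ring
      _ ≤ _ := mul_le_mul h1 h2 (mul_nonneg (𝓜.wordProb_nonneg _ _) (Real.exp_nonneg _))
          (𝓜.p_nonneg e y)

/-- The lower bound δ turns the modulus of continuity of p into one for the ratio: p(x)/p(y) ≤ 1 +
(modulus)/δ, which is at most the exponential of (modulus)/δ. Summing over the edges gives one φ for
all of them. -/
theorem exists_summable_modulus
    (hdini : ∀ e, DiniContinuousOn (𝓜.p e) (𝓜.cell (𝓜.init e)))
    (hpos : ∀ e, ∃ δ : ℝ, 0 < δ ∧ ∀ y ∈ 𝓜.cell (𝓜.init e), δ ≤ 𝓜.p e y) :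
    ∃ φ : ℝ → ℝ, (∀ t, 0 ≤ φ t) ∧
      (∀ e, ∀ x ∈ 𝓜.cell (𝓜.init e), ∀ y ∈ 𝓜.cell (𝓜.init e), ∀ t, dist x y ≤ t →
        𝓜.p e x * Real.exp (-φ t) ≤ 𝓜.p e y) ∧
      ∀ b T : ℝ, 0 < b → b < 1 → 0 < T → Summable fun k : ℕ => φ (T * b ^ k) := by
  choose δ hδ0 hδ using hpos
  have hfin : ∀ e t, modulusOn (𝓜.p e) (𝓜.cell (𝓜.init e)) t ≠ ⊤ := fun e t =>
    ne_top_of_le_ne_top ENNReal.one_ne_top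
      (modulusOn_le_one _ (𝓜.p_nonneg e) (𝓜.p_le_one e) t)
  refine ⟨fun t => ∑ e, (modulusOn (𝓜.p e) (𝓜.cell (𝓜.init e)) t).toReal / δ e,
    fun t => Finset.sum_nonneg fun e _ => div_nonneg ENNReal.toReal_nonneg (hδ0 e).le, ?_, ?_⟩
  · intro e x hx y hy t hxy
    have hy0 : 0 < 𝓜.p e y := (hδ0 e).trans_le (hδ e y hy)
    have h1 : 𝓜.p e x - 𝓜.p e y ≤ (modulusOn (𝓜.p e) (𝓜.cell (𝓜.init e)) t).toReal := by
      refine (le_abs_self _).trans ?_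
      rw [← ENNReal.ofReal_le_iff_le_toReal (hfin e t)]
      exact le_modulusOn hx hy hxy
    have h2 : 𝓜.p e x / 𝓜.p e y - 1 ≤
        ∑ e, (modulusOn (𝓜.p e) (𝓜.cell (𝓜.init e)) t).toReal / δ e := by
      calc 𝓜.p e x / 𝓜.p e y - 1 = (𝓜.p e x - 𝓜.p e y) / 𝓜.p e y := by field_simp
        _ ≤ (modulusOn (𝓜.p e) (𝓜.cell (𝓜.init e)) t).toReal / δ e :=
          div_le_div₀ ENNReal.toReal_nonneg h1 (hδ0 e) (hδ e y hy)
        _ ≤ _ := Finset.single_le_sum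
          (f := fun e => (modulusOn (𝓜.p e) (𝓜.cell (𝓜.init e)) t).toReal / δ e)
          (fun e _ => div_nonneg ENNReal.toReal_nonneg (hδ0 e).le) (Finset.mem_univ e)
    have h3 : 𝓜.p e x / 𝓜.p e y ≤
        Real.exp (∑ e, (modulusOn (𝓜.p e) (𝓜.cell (𝓜.init e)) t).toReal / δ e) := by
      refine le_trans ?_ (Real.exp_le_exp.2 h2)
      linarith [Real.add_one_le_exp (𝓜.p e x / 𝓜.p e y - 1)]
    rw [div_le_iff₀ hy0] at h3
    rw [Real.exp_neg, ← div_eq_mul_inv, div_le_iff₀ (Real.exp_pos _)]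
    linarith
  · intro b T hb0 hb1 hT
    refine summable_sum fun e _ => Summable.div_const ?_ _
    exact ENNReal.summable_toReal
      ((hdini e).tsum_modulusOn_ne_top (𝓜.p_nonneg e) (𝓜.p_le_one e) hb0 hb1 hT)

/-- The laws of the words that start at two points of a cell overlap, uniformly in the length. -/
theorem exists_overlap {a : ℝ} (ha : 𝓜.ContractsBy a) (ha0 : 0 < a) (ha1 : a < 1)
    (hdini : ∀ e, DiniContinuousOn (𝓜.p e) (𝓜.cell (𝓜.init e)))
    (hpos : ∀ e, ∃ δ : ℝ, 0 < δ ∧ ∀ y ∈ 𝓜.cell (𝓜.init e), δ ≤ 𝓜.p e y) {R : ℝ} (hR : 0 < R) :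
    ∃ η : ℝ, 0 < η ∧ ∀ (n : ℕ) (v : V), ∀ x ∈ 𝓜.cell v, ∀ y ∈ 𝓜.cell v, dist x y ≤ R →
      η ≤ ∑ g : Fin n → E, min (𝓜.wordProb (List.ofFn g) x) (𝓜.wordProb (List.ofFn g) y) := by
  obtain ⟨φ, hφ0, hφ, hsum⟩ := exists_summable_modulus hdini hpos
  -- With a < b the weighted distances have finite mean; with b < 1 the bounds T b^k decay
  -- geometrically, as summability of φ requires.
  obtain ⟨b, hab, hb1⟩ := exists_between ha1
  have hb0 : 0 < b := ha0.trans hab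
  set c : ℝ := (1 - b⁻¹ * a)⁻¹ with hcdef
  have hba : b⁻¹ * a < 1 := by rw [← div_eq_inv_mul, div_lt_one hb0]; exact hab
  have hba' : 1 - b⁻¹ * a ≠ 0 := by linarith
  have hc0 : 0 < c := inv_pos.2 (by linarith)
  have hc : 1 + b⁻¹ * a * c = c := by
    have : (1 - b⁻¹ * a) * c = 1 := mul_inv_cancel₀ hba'
    linarith
  -- The weighted distance has mean at most c R, so by Markov's inequality at least half of the mass
  -- of words stays below T.
  set T : ℝ := 2 * (c * R) with hTdef
  have hT : 0 < T := by positivity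
  set C : ℝ := ∑' k : ℕ, φ (T * b ^ k) with hC
  refine ⟨Real.exp (-C) * (1 / 2), by positivity, fun n v x hx y hy hxy => ?_⟩
  -- The factor 1 - W/T, with W the weighted distance, is at most the indicator of W ≤ T; summing
  -- this inequality builds Markov's inequality in.
  have key : ∀ g : Fin n → E, Real.exp (-C) * (𝓜.wordProb (List.ofFn g) x -
      𝓜.wordProb (List.ofFn g) x * 𝓜.weightedDist b (List.ofFn g) x y / T) ≤
      min (𝓜.wordProb (List.ofFn g) x) (𝓜.wordProb (List.ofFn g) y) := by
    intro g
    set l := List.ofFn g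
    have hP := 𝓜.wordProb_nonneg l x
    have hW := weightedDist_nonneg (𝓜 := 𝓜) hb0.le l x y
    have hC0 : 0 ≤ C := tsum_nonneg fun k => hφ0 _
    have hE : Real.exp (-C) ≤ 1 := Real.exp_le_one_iff.2 (by linarith)
    by_cases hWT : 𝓜.weightedDist b l x y ≤ T
    · have h0 : 𝓜.wordProb l x - 𝓜.wordProb l x * 𝓜.weightedDist b l x y / T ≤
          𝓜.wordProb l x := by
        have : 0 ≤ 𝓜.wordProb l x * 𝓜.weightedDist b l x y / T := by positivity
        linarith
      have h1 := wordProb_mul_exp_le hφ hb0 l hx hy hWT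
      have h2 : Real.exp (-C) ≤ Real.exp (-∑ k ∈ Finset.range l.length, φ (T * b ^ k)) :=
        Real.exp_le_exp.2 (neg_le_neg
          ((hsum b T hb0 hb1 hT).sum_le_tsum _ fun k _ => hφ0 _))
      refine le_min ?_ ?_
      · exact (mul_le_mul_of_nonneg_left h0 (Real.exp_nonneg _)).trans
          (mul_le_of_le_one_left hP hE)
      · calc _ ≤ Real.exp (-C) * 𝓜.wordProb l x :=
              mul_le_mul_of_nonneg_left h0 (Real.exp_nonneg _)
          _ ≤ _ := by
              rw [mul_comm]
              exact (mul_le_mul_of_nonneg_left h2 hP).trans h1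
    · refine le_trans ?_ (le_min hP (𝓜.wordProb_nonneg l y))
      refine mul_nonpos_of_nonneg_of_nonpos (Real.exp_nonneg _) ?_
      rw [sub_nonpos, mul_div_assoc]
      exact le_mul_of_one_le_right hP ((one_le_div hT).2 (not_le.1 hWT).le)
  refine le_trans ?_ (Finset.sum_le_sum fun g _ => key g)
  rw [← Finset.mul_sum, Finset.sum_sub_distrib, sum_wordProb, ← Finset.sum_div]
  refine mul_le_mul_of_nonneg_left ?_ (Real.exp_nonneg _)
  have h1 := ha.sum_wordProb_mul_weightedDist_le hb0 hc0.le hc.le n hx hy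
  have h2 : c * dist x y ≤ c * R := mul_le_mul_of_nonneg_left hxy hc0.le
  have : (∑ g : Fin n → E, 𝓜.wordProb (List.ofFn g) x *
      𝓜.weightedDist b (List.ofFn g) x y) / T ≤ 1 / 2 := by
    rw [div_le_iff₀ hT]
    linarith
  linarith

/-- Couple the two word laws through their common part, the pointwise minimum: there the Lipschitz
bound and contraction apply, and the rest contributes at most its mass because f has values in [0,
1]. -/
theorem ContractsBy.wordOp_sub_le {a : ℝ} (ha : 𝓜.ContractsBy a) (ha0 : 0 ≤ a) {f : K → ℝ}
    (hf0 : ∀ x, 0 ≤ f x) (hf1 : ∀ x, f x ≤ 1) {L : ℝ} (hL : 0 ≤ L)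
    (hf : ∀ x y, f x - f y ≤ L * dist x y)
    (n : ℕ) {v : V} {x y : K} (hx : x ∈ 𝓜.cell v) (hy : y ∈ 𝓜.cell v) :
    𝓜.wordOp n f x - 𝓜.wordOp n f y ≤ 1 -
      ∑ g : Fin n → E, min (𝓜.wordProb (List.ofFn g) x) (𝓜.wordProb (List.ofFn g) y) +
      L * (a ^ n * dist x y) := by
  refine le_trans ?_ (add_le_add_right
    (mul_le_mul_of_nonneg_left (ha.sum_wordProb_mul_dist_le ha0 n hx hy) hL) _)
  rw [← 𝓜.sum_wordProb n x, Finset.mul_sum, wordOp, wordOp, ← Finset.sum_sub_distrib,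
    ← Finset.sum_sub_distrib, ← Finset.sum_add_distrib]
  refine Finset.sum_le_sum fun g _ => ?_
  set l := List.ofFn g
  set P := 𝓜.wordProb l x
  set Q := 𝓜.wordProb l y
  have hm1 : min P Q ≤ P := min_le_left _ _
  have hm2 : min P Q ≤ Q := min_le_right _ _
  have hm0 : 0 ≤ min P Q := le_min (𝓜.wordProb_nonneg _ _) (𝓜.wordProb_nonneg _ _)
  set x' := 𝓜.wordMap l x
  set y' := 𝓜.wordMap l y
  have h1 : (P - min P Q) * f x' ≤ P - min P Q :=
    mul_le_of_le_one_right (by linarith) (hf1 _)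
  have h2 : 0 ≤ (Q - min P Q) * f y' := mul_nonneg (by linarith) (hf0 _)
  have h3 : min P Q * (f x' - f y') ≤ P * (L * dist x' y') :=
    (mul_le_mul_of_nonneg_left (hf x' y') hm0).trans
      (mul_le_mul_of_nonneg_right hm1 (mul_nonneg hL dist_nonneg))
  nlinarith

end Contraction

end MarkovSystem

/-! ### Uniqueness of the invariant measure -/

/-- Take a closed F ⊆ A of almost full ν₁-measure. As F is closed and ν₂-null, its small thickenings
have small ν₂-measure; f is a thickened indicator of F, which is Lipschitz. -/
theorem exists_lipschitz_separating {X : Type*} [MetricSpace X] [MeasurableSpace X] [BorelSpace X]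
    {ν₁ ν₂ : Measure X} [IsFiniteMeasure ν₁] [IsFiniteMeasure ν₂] {A : Set X}
    (hA : MeasurableSet A) (h₁ : ν₁ Aᶜ = 0) (h₂ : ν₂ A = 0) {ε : ℝ≥0∞} (hε : ε ≠ 0) :
    ∃ (f : X → ℝ) (L : ℝ), Measurable f ∧ 0 ≤ L ∧ (∀ x, 0 ≤ f x) ∧ (∀ x, f x ≤ 1) ∧
      (∀ x y, f x - f y ≤ L * dist x y) ∧
      ∫⁻ x, ENNReal.ofReal (1 - f x) ∂ν₁ < ε ∧ ∫⁻ x, ENNReal.ofReal (f x) ∂ν₂ < ε := by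
  obtain ⟨F, hFA, hF, hFε⟩ := hA.exists_isClosed_lt_add (measure_ne_top ν₁ A) hε
  have hF2 : ν₂ F = 0 := measure_mono_null hFA h₂
  have hlim := tendsto_measure_thickening_of_isClosed (μ := ν₂)
    ⟨1, one_pos, measure_ne_top _ _⟩ hF
  rw [hF2] at hlim
  obtain ⟨r, hr, hr0⟩ := ((hlim.eventually_lt_const hε.bot_lt).and self_mem_nhdsWithin).exists
  have hr0 : 0 < r := hr0
  set f : X → ℝ := fun x => thickenedIndicator hr0 F x with hf
  have hlip := lipschitzWith_thickenedIndicator hr0 F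
  have hf1 : ∀ x, f x ≤ 1 := fun x => by
    simpa [hf] using thickenedIndicator_le_one hr0 F x
  have hFm : MeasurableSet F := hF.measurableSet
  refine ⟨f, (r.toNNReal⁻¹ : NNReal), ?_, NNReal.coe_nonneg _, fun x => NNReal.coe_nonneg _, hf1,
    fun x y => ?_, ?_, ?_⟩
  · exact ((thickenedIndicator hr0 F).continuous.measurable).coe_nnreal_real
  · refine (le_abs_self _).trans ?_
    simpa [hf, Real.dist_eq, NNReal.dist_eq] using hlip.dist_le_mul x y
  · calc ∫⁻ x, ENNReal.ofReal (1 - f x) ∂ν₁ ≤ ∫⁻ x, Fᶜ.indicator 1 x ∂ν₁ := by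
          refine lintegral_mono fun x => ?_
          by_cases hx : x ∈ F
          · have h1 : f x = 1 := by simp only [hf, thickenedIndicator_one hr0 F hx, NNReal.coe_one]
            simp [h1]
          · simp only [Set.mem_compl_iff, hx, not_false_eq_true, Set.indicator_of_mem, Pi.one_apply]
            rw [← ENNReal.ofReal_one]
            exact ENNReal.ofReal_le_ofReal (by linarith [NNReal.coe_nonneg (thickenedIndicator hr0 F x)])
      _ = ν₁ Fᶜ := lintegral_indicator_one hFm.compl
      _ ≤ ν₁ (A \ F) + ν₁ Aᶜ := by
          refine le_trans (measure_mono ?_) (measure_union_le _ _)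
          intro x hx
          by_cases hxA : x ∈ A
          · exact Or.inl ⟨hxA, hx⟩
          · exact Or.inr hxA
      _ = ν₁ A - ν₁ F := by
          rw [h₁, add_zero, measure_sdiff hFA hFm.nullMeasurableSet (measure_ne_top _ _)]
      _ < ε := ENNReal.sub_lt_of_lt_add (measure_mono hFA) (by rwa [add_comm])
  · calc ∫⁻ x, ENNReal.ofReal (f x) ∂ν₂ ≤ ∫⁻ x, (Metric.thickening r F).indicator 1 x ∂ν₂ := by
          refine lintegral_mono fun x => ?_
          by_cases hx : x ∈ Metric.thickening r F
          · simpa [hx] using hf1 x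
          · have h1 : f x = 0 := by simp only [hf, thickenedIndicator_zero hr0 F hx, NNReal.coe_zero]
            simp [h1]
      _ = ν₂ (Metric.thickening r F) := lintegral_indicator_one Metric.isOpen_thickening.measurableSet
      _ < ε := hr

namespace MarkovSystem

variable {K V E : Type*} [MeasurableSpace K] [Fintype E] {𝓜 : MarkovSystem K V E}

/-- On subsets of A the measure ν₂ vanishes, so the relation gives ν₁ ≤ `push ν₁`; both have the
same total mass, which forces equality. -/
theorem eq_push_of_add_push_eq {ν₁ ν₂ : Measure K} [IsFiniteMeasure ν₁] [IsFiniteMeasure ν₂]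
    {A : Set K} (hA : MeasurableSet A) (h₁ : ν₁ Aᶜ = 0) (h₂ : ν₂ A = 0)
    (h : ν₂ + 𝓜.push ν₁ = ν₁ + 𝓜.push ν₂) : 𝓜.push ν₁ = ν₁ := by
  refine (Measure.eq_of_le_of_measure_univ_eq ?_ (𝓜.push_univ ν₁).symm).symm
  refine Measure.le_intro fun s hs _ => ?_
  have hsA : ν₁ s = ν₁ (s ∩ A) := by
    rw [← measure_inter_add_sdiff s hA, measure_mono_null (fun x hx => hx.2 : s \ A ⊆ Aᶜ) h₁,
      add_zero]
  have := congrArg (fun m => m (s ∩ A)) h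
  simp only [Measure.add_apply, measure_mono_null Set.inter_subset_right h₂, zero_add] at this
  calc ν₁ s = ν₁ (s ∩ A) := hsA
    _ ≤ 𝓜.push ν₁ (s ∩ A) := by rw [this]; exact le_self_add
    _ ≤ 𝓜.push ν₁ s := measure_mono Set.inter_subset_left

/-- Two different invariant measures give rise to two mutually singular ones. -/
theorem exists_singular_of_ne {μ₁ μ₂ : Measure K} [IsProbabilityMeasure μ₁]
    [IsProbabilityMeasure μ₂] (h₁ : 𝓜.push μ₁ = μ₁) (h₂ : 𝓜.push μ₂ = μ₂) (hne : μ₁ ≠ μ₂) :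
    ∃ (ν₁ ν₂ : Measure K) (A : Set K), IsFiniteMeasure ν₁ ∧ IsFiniteMeasure ν₂ ∧
      𝓜.push ν₁ = ν₁ ∧ 𝓜.push ν₂ = ν₂ ∧ MeasurableSet A ∧ ν₁ Aᶜ = 0 ∧ ν₂ A = 0 ∧
      ν₁ ≠ 0 ∧ ν₂ ≠ 0 := by
  -- The measures sought are the positive and negative parts of μ₁ - μ₂.
  obtain ⟨A, hA, hA1, hA2⟩ := hahn_decomposition μ₁ μ₂
  have hle1 : μ₂.restrict A ≤ μ₁.restrict A := Measure.le_intro fun s hs _ => by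
    rw [Measure.restrict_apply hs, Measure.restrict_apply hs]
    exact hA1 _ (hs.inter hA) Set.inter_subset_right
  have hle2 : μ₁.restrict Aᶜ ≤ μ₂.restrict Aᶜ := Measure.le_intro fun s hs _ => by
    rw [Measure.restrict_apply hs, Measure.restrict_apply hs]
    exact hA2 _ (hs.inter hA.compl) Set.inter_subset_right
  set ν₁ := μ₁.restrict A - μ₂.restrict A
  set ν₂ := μ₂.restrict Aᶜ - μ₁.restrict Aᶜ
  have e1 : ν₁ + μ₂.restrict A = μ₁.restrict A := Measure.sub_add_cancel_of_le hle1
  have e2 : ν₂ + μ₁.restrict Aᶜ = μ₂.restrict Aᶜ := Measure.sub_add_cancel_of_le hle2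
  have f1 : IsFiniteMeasure ν₁ := inferInstance
  have f2 : IsFiniteMeasure ν₂ := inferInstance
  have n1 : ν₁ Aᶜ = 0 := by
    have := Measure.sub_le (μ := μ₁.restrict A) (ν := μ₂.restrict A) Aᶜ
    simpa [Measure.restrict_apply hA.compl] using this
  have n2 : ν₂ A = 0 := by
    have := Measure.sub_le (μ := μ₂.restrict Aᶜ) (ν := μ₁.restrict Aᶜ) A
    simpa [Measure.restrict_apply hA] using this
  have hsum : μ₁ + ν₂ = μ₂ + ν₁ := by
    rw [← Measure.restrict_add_restrict_compl (μ := μ₁) hA,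
      ← Measure.restrict_add_restrict_compl (μ := μ₂) hA, ← e1, ← e2]
    abel
  have hsum' : μ₁ + 𝓜.push ν₂ = μ₂ + 𝓜.push ν₁ := by
    have := congrArg 𝓜.push hsum
    rwa [push_add, push_add, h₁, h₂] at this
  -- Measures cannot be subtracted freely, so the finite quantity μ₁ s + μ₂ s is added to both sides
  -- and cancelled.
  have hcross : ν₂ + 𝓜.push ν₁ = ν₁ + 𝓜.push ν₂ := by
    ext s hs
    have t1 := congrArg (fun m => m s) hsum
    have t2 := congrArg (fun m => m s) hsum'
    simp only [Measure.add_apply] at t1 t2 ⊢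
    have hfin : μ₁ s + μ₂ s ≠ ⊤ := ENNReal.add_ne_top.2 ⟨measure_ne_top _ _, measure_ne_top _ _⟩
    refine (ENNReal.add_right_inj hfin).1 ?_
    calc μ₁ s + μ₂ s + (ν₂ s + 𝓜.push ν₁ s) = (μ₁ s + ν₂ s) + (μ₂ s + 𝓜.push ν₁ s) := by ring
      _ = (μ₂ s + ν₁ s) + (μ₁ s + 𝓜.push ν₂ s) := by rw [t1, t2]
      _ = _ := by ring
  have hmass : ν₁ Set.univ = ν₂ Set.univ := by
    have := congrArg (fun m => m Set.univ) hsum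
    simp only [Measure.add_apply, measure_univ] at this
    exact ((ENNReal.add_right_inj ENNReal.one_ne_top).1 this).symm
  have hboth : ¬ (ν₁ = 0 ∧ ν₂ = 0) := by
    rintro ⟨z1, z2⟩
    rw [z1, z2, add_zero, add_zero] at hsum
    exact hne hsum
  refine ⟨ν₁, ν₂, A, f1, f2, eq_push_of_add_push_eq hA n1 n2 hcross,
    eq_push_of_add_push_eq hA.compl (by rwa [compl_compl]) n1 hcross.symm, hA, n1, n2, ?_, ?_⟩
  · intro z
    refine hboth ⟨z, ?_⟩
    rwa [z, Measure.coe_zero, Pi.zero_apply, eq_comm, Measure.measure_univ_eq_zero] at hmass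
  · intro z
    refine hboth ⟨?_, z⟩
    rwa [z, Measure.coe_zero, Pi.zero_apply, Measure.measure_univ_eq_zero] at hmass

/-- A positive fraction of the mass of the initial cell of an edge moves to its terminal cell, so a
null cell makes its predecessors null. By irreducibility one null cell makes them all null. -/
theorem measure_cell_ne_zero [Countable V] (hirr : 𝓜.IsIrreducible)
    (hpos : ∀ e, ∃ δ : ℝ, 0 < δ ∧ ∀ y ∈ 𝓜.cell (𝓜.init e), δ ≤ 𝓜.p e y)
    {ν : Measure K} (hν : 𝓜.push ν = ν) (h0 : ν ≠ 0) (v : V) : ν (𝓜.cell v) ≠ 0 := by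
  have hstep : ∀ e, ν (𝓜.cell (𝓜.term e)) = 0 → ν (𝓜.cell (𝓜.init e)) = 0 := by
    intro e he
    obtain ⟨δ, hδ0, hδ⟩ := hpos e
    have hle : ENNReal.ofReal δ * ν (𝓜.cell (𝓜.init e)) ≤ ν (𝓜.cell (𝓜.term e)) := by
      calc ENNReal.ofReal δ * ν (𝓜.cell (𝓜.init e))
          = ∫⁻ x in 𝓜.cell (𝓜.init e), ENNReal.ofReal δ ∂ν := by rw [setLIntegral_const]
        _ ≤ ∫⁻ x in 𝓜.cell (𝓜.init e), ∑ e', ENNReal.ofReal (𝓜.p e' x) *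
              (𝓜.cell (𝓜.term e)).indicator 1 (𝓜.w e' x) ∂ν := by
            refine setLIntegral_mono' (𝓜.cell_measurable _) fun x hx => ?_
            refine le_trans ?_ (Finset.single_le_sum (fun _ _ => zero_le) (Finset.mem_univ e))
            rw [Set.indicator_of_mem (𝓜.w_mapsTo e hx)]
            simpa using ENNReal.ofReal_le_ofReal (hδ x hx)
        _ ≤ ∫⁻ x, ∑ e', ENNReal.ofReal (𝓜.p e' x) *
              (𝓜.cell (𝓜.term e)).indicator 1 (𝓜.w e' x) ∂ν := setLIntegral_le_lintegral _ _
        _ = ν (𝓜.cell (𝓜.term e)) := by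
            rw [← lintegral_push, hν, lintegral_indicator_one (𝓜.cell_measurable _)]
            exact measurable_one.indicator (𝓜.cell_measurable _)
    rw [he, nonpos_iff_eq_zero, mul_eq_zero] at hle
    exact hle.resolve_left (by simpa using hδ0)
  intro hv
  refine h0 (Measure.measure_univ_eq_zero.1 ?_)
  rw [← 𝓜.cell_cover, measure_iUnion_null_iff]
  intro v'
  induction hirr v' v using Relation.ReflTransGen.head_induction_on with
  | refl => exact hv
  | head hab _ ih =>
    obtain ⟨e, rfl, rfl⟩ := hab
    exact hstep e ih

theorem exists_measure_inter_ball_ne_zero [PseudoMetricSpace K] {ν : Measure K} {s : Set K}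
    (h : ν s ≠ 0) (x : K) : ∃ R₀ : ℝ, ∀ R, R₀ ≤ R → ν (s ∩ Metric.ball x R) ≠ 0 := by
  by_contra! hc
  refine h ?_
  have : s ⊆ ⋃ n : ℕ, s ∩ Metric.ball x n := by
    rw [← Set.inter_iUnion, Metric.iUnion_ball_nat, Set.inter_univ]
  refine measure_mono_null this (measure_iUnion_null fun n => ?_)
  obtain ⟨R, hR, hR0⟩ := hc n
  exact measure_mono_null (Set.inter_subset_inter_right s (Metric.ball_subset_ball hR)) hR0

/-- Singularity yields a Lipschitz f that is nearly 1 in ν₁-mean and nearly 0 in ν₂-mean, and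
invariance passes this on to all its iterates. The uniform overlap of word laws prevents it on a
bounded part of a cell that both measures charge. -/
theorem push_eq_unique [MetricSpace K] [BorelSpace K] [Countable V] [Nonempty K]
    (hcontr : 𝓜.IsContractive) (hirr : 𝓜.IsIrreducible)
    (hdini : ∀ e, DiniContinuousOn (𝓜.p e) (𝓜.cell (𝓜.init e)))
    (hpos : ∀ e, ∃ δ : ℝ, 0 < δ ∧ ∀ y ∈ 𝓜.cell (𝓜.init e), δ ≤ 𝓜.p e y)
    {μ₁ μ₂ : Measure K} [IsProbabilityMeasure μ₁] [IsProbabilityMeasure μ₂]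
    (h₁ : 𝓜.push μ₁ = μ₁) (h₂ : 𝓜.push μ₂ = μ₂) : μ₁ = μ₂ := by
  by_contra hne
  obtain ⟨a, ha0, ha1, ha⟩ := hcontr
  have ha : 𝓜.ContractsBy a := ha
  obtain ⟨ν₁, ν₂, A, _, _, p₁, p₂, hA, n₁, n₂, z₁, z₂⟩ := exists_singular_of_ne h₁ h₂ hne
  obtain ⟨x₀⟩ := ‹Nonempty K›
  obtain ⟨v, -⟩ := 𝓜.exists_mem_cell x₀
  obtain ⟨R₁, hR₁⟩ := exists_measure_inter_ball_ne_zero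
    (measure_cell_ne_zero hirr hpos p₁ z₁ v) x₀
  obtain ⟨R₂, hR₂⟩ := exists_measure_inter_ball_ne_zero
    (measure_cell_ne_zero hirr hpos p₂ z₂ v) x₀
  set R := max 1 (max R₁ R₂)
  have hR0 : 0 < R := lt_of_lt_of_le one_pos (le_max_left _ _)
  set B := 𝓜.cell v ∩ Metric.ball x₀ R
  have hB₁ : ν₁ B ≠ 0 := hR₁ R ((le_max_left _ _).trans (le_max_right _ _))
  have hB₂ : ν₂ B ≠ 0 := hR₂ R ((le_max_right _ _).trans (le_max_right _ _))
  have hdiam : ∀ x ∈ B, ∀ y ∈ B, dist x y ≤ 2 * R := fun x hx y hy => by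
    have h1 := Metric.mem_ball.1 hx.2
    have h2 := Metric.mem_ball'.1 hy.2
    linarith [dist_triangle x x₀ y]
  obtain ⟨η, hη, hover⟩ := exists_overlap ha ha0 ha1 hdini hpos (show 0 < 2 * R by positivity)
  have hη4 : ENNReal.ofReal (η / 4) ≠ 0 := by simpa using hη
  -- Below this threshold neither 1 - `wordOp n f` nor `wordOp n f` can be at least η/4 on all of B,
  -- in ν₁-mean and ν₂-mean respectively.
  set ε := min (ENNReal.ofReal (η / 4) * ν₁ B) (ENNReal.ofReal (η / 4) * ν₂ B)
  have hε : ε ≠ 0 := by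
    have : 0 < ε := lt_min (pos_iff_ne_zero.2 (mul_ne_zero hη4 hB₁))
      (pos_iff_ne_zero.2 (mul_ne_zero hη4 hB₂))
    exact this.ne'
  obtain ⟨f, L, hfm, hL, hf0, hf1, hfL, hi₁, hi₂⟩ := exists_lipschitz_separating hA n₁ n₂ hε
  obtain ⟨n, hn⟩ : ∃ n : ℕ, L * (a ^ n * (2 * R)) < η / 2 := by
    have : Tendsto (fun n : ℕ => L * (a ^ n * (2 * R))) atTop (𝓝 (L * (0 * (2 * R)))) :=
      ((tendsto_pow_atTop_nhds_zero_of_lt_one ha0.le ha1).mul_const _).const_mul _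
    exact (this.eventually_lt_const (by simpa using hη)).exists
  have hdiff : ∀ x ∈ B, ∀ y ∈ B, η / 2 ≤ (1 - 𝓜.wordOp n f x) + 𝓜.wordOp n f y := by
    intro x hx y hy
    have h1 := ha.wordOp_sub_le ha0.le hf0 hf1 hL hfL n hx.1 hy.1
    have h2 := hover n v x hx.1 y hy.1 (hdiam x hx y hy)
    have h3 : L * (a ^ n * dist x y) ≤ L * (a ^ n * (2 * R)) := by
      gcongr
      exact hdiam x hx y hy
    linarith
  have hlow : ∀ (ν : Measure K) (G : K → ℝ), (∀ x ∈ B, η / 4 ≤ G x) →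
      ENNReal.ofReal (η / 4) * ν B ≤ ∫⁻ x, ENNReal.ofReal (G x) ∂ν := by
    intro ν G hG
    refine le_trans ?_ (setLIntegral_le_lintegral B _)
    rw [← setLIntegral_const]
    exact setLIntegral_mono' ((𝓜.cell_measurable v).inter measurableSet_ball) fun x hx =>
      ENNReal.ofReal_le_ofReal (hG x hx)
  have hone : ∀ x, 𝓜.wordOp n (fun x => 1 - f x) x = 1 - 𝓜.wordOp n f x := fun x => by
    simp [wordOp, mul_sub, Finset.sum_sub_distrib, sum_wordProb]
  -- By `hdiff`, a single point of B with 1 - `wordOp n f` below η/4 pushes `wordOp n f` above η/4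
  -- on the whole of B.
  by_cases hx : ∃ x ∈ B, 1 - 𝓜.wordOp n f x < η / 4
  · obtain ⟨x, hxB, hx⟩ := hx
    have := hlow ν₂ (𝓜.wordOp n f) fun y hy => by linarith [hdiff x hxB y hy]
    rw [𝓜.lintegral_wordOp_of_push_eq p₂ n hfm hf0] at this
    exact absurd (this.trans_lt hi₂) (not_lt.2 (min_le_right _ _))
  · push Not at hx
    have := hlow ν₁ (𝓜.wordOp n fun x => 1 - f x) fun y hy => by rw [hone]; exact hx y hy
    rw [𝓜.lintegral_wordOp_of_push_eq p₁ n (f := fun x => 1 - f x)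
      (measurable_const.sub hfm) (fun x => by linarith [hf1 x])] at this
    exact absurd (this.trans_lt hi₁) (not_lt.2 (min_le_left _ _))

end MarkovSystem

/-! ### Existence of an invariant measure -/

theorem DiniContinuousOn.tendsto_modulusOn {X : Type*} [PseudoMetricSpace X] {h : X → ℝ}
    {s : Set X} (hd : DiniContinuousOn h s) (h0 : ∀ x, 0 ≤ h x) (h1 : ∀ x, h x ≤ 1) :
    Tendsto (fun k : ℕ => modulusOn h s (1 * (1 / 2) ^ k)) atTop (𝓝 0) :=
  ENNReal.tendsto_atTop_zero_of_tsum_ne_top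
    (hd.tsum_modulusOn_ne_top h0 h1 (by norm_num) (by norm_num) one_pos)

theorem DiniContinuousOn.continuousOn {X : Type*} [PseudoMetricSpace X] {h : X → ℝ}
    {s : Set X} (hd : DiniContinuousOn h s) (h0 : ∀ x, 0 ≤ h x) (h1 : ∀ x, h x ≤ 1) :
    ContinuousOn h s := by
  rw [Metric.continuousOn_iff]
  intro x hx ε hε
  obtain ⟨k, hk⟩ := ((hd.tendsto_modulusOn h0 h1).eventually_lt_const
    (ENNReal.ofReal_pos.2 hε)).exists
  refine ⟨1 * (1 / 2) ^ k, by positivity, fun y hy hyx => ?_⟩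
  rw [Real.dist_eq]
  exact (ENNReal.ofReal_lt_ofReal_iff hε).1 ((le_modulusOn hy hx hyx.le).trans_lt hk)

namespace MarkovSystem

variable {K V E : Type*} [MeasurableSpace K] [Fintype E] {𝓜 : MarkovSystem K V E}

theorem isClopen_cell [TopologicalSpace K] (hopen : ∀ v, IsOpen (𝓜.cell v)) (v : V) :
    IsClopen (𝓜.cell v) := by
  refine ⟨⟨?_⟩, hopen v⟩
  have : (𝓜.cell v)ᶜ = ⋃ v' ∈ {v' | v' ≠ v}, 𝓜.cell v' := by
    ext x
    simp only [Set.mem_compl_iff, Set.mem_ofPred_eq, Set.mem_iUnion, exists_prop]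
    constructor
    · intro hx
      obtain ⟨v', hv'⟩ := 𝓜.exists_mem_cell x
      exact ⟨v', fun h => hx (h ▸ hv'), hv'⟩
    · rintro ⟨v', hne, hv'⟩ hx
      exact hne (𝓜.cell_unique hv' hx)
  rw [this]
  exact isOpen_biUnion fun v' _ => hopen v'

theorem abs_markovOp_le {f : K → ℝ} {C : ℝ} (hC : ∀ x, |f x| ≤ C) (x : K) :
    |𝓜.markovOp f x| ≤ C := by
  calc |𝓜.markovOp f x| ≤ ∑ e, |𝓜.p e x * f (𝓜.w e x)| := Finset.abs_sum_le_sum_abs _ _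
    _ ≤ ∑ e, 𝓜.p e x * C := by
        refine Finset.sum_le_sum fun e _ => ?_
        rw [abs_mul, abs_of_nonneg (𝓜.p_nonneg e x)]
        exact mul_le_mul_of_nonneg_left (hC _) (𝓜.p_nonneg e x)
    _ = C := by rw [← Finset.sum_mul, 𝓜.p_sum, one_mul]

variable (𝓜) in
/-- Averages of the laws of the chain started at `z`. -/
noncomputable def cesaro (z : K) (n : ℕ) : Measure K :=
  ((n : ℝ≥0∞) + 1)⁻¹ • ∑ k ∈ Finset.range (n + 1), 𝓜.push^[k] (Measure.dirac z)

theorem isProbabilityMeasure_iterate_push (z : K) (k : ℕ) :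
    IsProbabilityMeasure (𝓜.push^[k] (Measure.dirac z)) := by
  induction k with
  | zero => exact Measure.dirac.isProbabilityMeasure
  | succ k ih => rw [Function.iterate_succ_apply']; infer_instance

instance (z : K) (n : ℕ) : IsProbabilityMeasure (𝓜.cesaro z n) := by
  constructor
  have := fun k => isProbabilityMeasure_iterate_push (𝓜 := 𝓜) z k
  simp only [cesaro, Measure.smul_apply, Measure.finsetSum_apply, measure_univ, smul_eq_mul,
    Finset.sum_const, Finset.card_range, nsmul_eq_mul, mul_one, Nat.cast_add, Nat.cast_one]
  exact ENNReal.inv_mul_cancel (by simp) (by simp)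

theorem lintegral_cesaro_le {z : K} {f : K → ℝ≥0∞} {D : ℝ≥0∞}
    (h : ∀ k, ∫⁻ y, f y ∂(𝓜.push^[k] (Measure.dirac z)) ≤ D) (n : ℕ) :
    ∫⁻ y, f y ∂(𝓜.cesaro z n) ≤ D := by
  rw [cesaro, lintegral_smul_measure, lintegral_finsetSum_measure, smul_eq_mul]
  calc _ ≤ ((n : ℝ≥0∞) + 1)⁻¹ * ∑ k ∈ Finset.range (n + 1), D := by gcongr; exact h _
    _ = D := by
      rw [Finset.sum_const, Finset.card_range, nsmul_eq_mul, ← mul_assoc, Nat.cast_add,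
        Nat.cast_one, ENNReal.inv_mul_cancel (by simp) (by simp), one_mul]

/-- Applying the Markov operator shifts the average by one step, so the difference telescopes to its
first and last terms. -/
theorem abs_integral_markovOp_cesaro_sub_le {f : K → ℝ} (hf : Measurable f)
    (hUf : Measurable (𝓜.markovOp f)) {C : ℝ} (hC : ∀ x, |f x| ≤ C) (z : K) (n : ℕ) :
    |∫ y, 𝓜.markovOp f y ∂(𝓜.cesaro z n) - ∫ y, f y ∂(𝓜.cesaro z n)| ≤
      2 * C / ((n : ℝ) + 1) := by
  have hp := fun k => isProbabilityMeasure_iterate_push (𝓜 := 𝓜) z k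
  have hi : ∀ {g : K → ℝ}, Measurable g → (∀ x, |g x| ≤ C) → ∀ k,
      Integrable g (𝓜.push^[k] (Measure.dirac z)) := fun hg hgC k =>
    Integrable.of_bound hg.aestronglyMeasurable C (ae_of_all _ fun x => by simpa using hgC x)
  have hb : ∀ k, |∫ y, f y ∂(𝓜.push^[k] (Measure.dirac z))| ≤ C := fun k => by
    simpa using norm_integral_le_of_norm_le_const (μ := 𝓜.push^[k] (Measure.dirac z))
      (f := f) (C := C) (ae_of_all _ fun x => by simpa using hC x)
  have hstep : ∀ k, ∫ y, 𝓜.markovOp f y ∂(𝓜.push^[k] (Measure.dirac z)) =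
      ∫ y, f y ∂(𝓜.push^[k + 1] (Measure.dirac z)) := fun k => by
    rw [Function.iterate_succ_apply', 𝓜.integral_push _ hf hC]
  rw [cesaro, integral_smul_measure, integral_smul_measure,
    integral_finsetSum_measure fun k _ => hi hUf (abs_markovOp_le hC) k,
    integral_finsetSum_measure fun k _ => hi hf hC k]
  simp only [hstep]
  rw [← smul_sub, ← Finset.sum_sub_distrib, Finset.sum_range_sub fun k =>
    ∫ y, f y ∂(𝓜.push^[k] (Measure.dirac z))]
  have hn : ((n : ℝ≥0∞) + 1)⁻¹.toReal = ((n : ℝ) + 1)⁻¹ := by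
    rw [ENNReal.toReal_inv, ENNReal.toReal_add (by simp) (by simp)]
    simp
  rw [hn, smul_eq_mul, abs_mul, abs_of_nonneg (by positivity), div_eq_inv_mul]
  refine mul_le_mul_of_nonneg_left ?_ (by positivity)
  have h1 := abs_le.1 (hb (n + 1))
  have h2 := abs_le.1 (hb 0)
  rw [abs_le]
  constructor <;> linarith

/-! ### Continuity of the system, the drift inequality and tightness. -/

section Regularity

variable [MetricSpace K]

theorem continuous_p (hopen : ∀ v, IsOpen (𝓜.cell v))
    (hdini : ∀ e, DiniContinuousOn (𝓜.p e) (𝓜.cell (𝓜.init e))) (e : E) :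
    Continuous (𝓜.p e) := by
  have hc := isClopen_cell hopen (𝓜.init e)
  refine continuous_iff_continuousAt.2 fun x => ?_
  by_cases hx : x ∈ 𝓜.cell (𝓜.init e)
  · exact ((hdini e).continuousOn (𝓜.p_nonneg e) (𝓜.p_le_one e)).continuousAt
      (hc.isOpen.mem_nhds hx)
  · refine (continuousAt_const (y := (0 : ℝ))).congr ?_
    filter_upwards [hc.compl.isOpen.mem_nhds hx] with y hy
    exact (𝓜.p_eq_zero e y hy).symm

/-- A single term of the averaged contraction inequality, divided by the lower bound of its
probability. -/
theorem IsContractive.exists_lipschitz (hcontr : 𝓜.IsContractive)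
    (hpos : ∀ e, ∃ δ : ℝ, 0 < δ ∧ ∀ y ∈ 𝓜.cell (𝓜.init e), δ ≤ 𝓜.p e y) (e : E) :
    ∃ L : NNReal, LipschitzOnWith L (𝓜.w e) (𝓜.cell (𝓜.init e)) := by
  obtain ⟨a, ha0, -, ha⟩ := hcontr
  obtain ⟨δ, hδ0, hδ⟩ := hpos e
  refine ⟨(a / δ).toNNReal, LipschitzOnWith.of_dist_le_mul fun x hx y hy => ?_⟩
  rw [Real.coe_toNNReal _ (by positivity), div_mul_eq_mul_div, le_div_iff₀ hδ0, mul_comm]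
  refine le_trans ?_ (ha _ x hx y hy)
  refine le_trans ?_ (Finset.single_le_sum
    (f := fun e => 𝓜.p e x * dist (𝓜.w e x) (𝓜.w e y))
    (fun e _ => mul_nonneg (𝓜.p_nonneg e x) dist_nonneg) (Finset.mem_univ e))
  exact mul_le_mul_of_nonneg_right (hδ x hx) dist_nonneg

theorem IsContractive.continuousAt_w (hcontr : 𝓜.IsContractive)
    (hopen : ∀ v, IsOpen (𝓜.cell v))
    (hpos : ∀ e, ∃ δ : ℝ, 0 < δ ∧ ∀ y ∈ 𝓜.cell (𝓜.init e), δ ≤ 𝓜.p e y) {e : E} {x : K}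
    (hx : x ∈ 𝓜.cell (𝓜.init e)) : ContinuousAt (𝓜.w e) x := by
  obtain ⟨L, hL⟩ := hcontr.exists_lipschitz hpos e
  exact hL.continuousOn.continuousAt ((hopen _).mem_nhds hx)

theorem continuous_markovOp (hcontr : 𝓜.IsContractive) (hopen : ∀ v, IsOpen (𝓜.cell v))
    (hdini : ∀ e, DiniContinuousOn (𝓜.p e) (𝓜.cell (𝓜.init e)))
    (hpos : ∀ e, ∃ δ : ℝ, 0 < δ ∧ ∀ y ∈ 𝓜.cell (𝓜.init e), δ ≤ 𝓜.p e y)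
    {f : K → ℝ} (hf : Continuous f) : Continuous (𝓜.markovOp f) := by
  refine continuous_finsetSum _ fun e _ => continuous_iff_continuousAt.2 fun x => ?_
  by_cases hx : x ∈ 𝓜.cell (𝓜.init e)
  · exact (continuous_p hopen hdini e).continuousAt.mul
      (hf.continuousAt.comp (hcontr.continuousAt_w hopen hpos hx))
  · refine (continuousAt_const (y := (0 : ℝ))).congr ?_
    filter_upwards [(isClopen_cell hopen (𝓜.init e)).compl.isOpen.mem_nhds hx] with y hy
    simp [𝓜.p_eq_zero e y hy]

variable [Fintype V]

variable (𝓜) in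
/-- The distance to the base point of the cell. -/
noncomputable def height (x : V → K) (z : K) : ℝ :=
  ∑ v, (𝓜.cell v).indicator (fun z => dist z (x v)) z

theorem height_eq (x : V → K) {z : K} {v : V} (hz : z ∈ 𝓜.cell v) :
    𝓜.height x z = dist z (x v) := by
  rw [height, Finset.sum_eq_single v]
  · rw [Set.indicator_of_mem hz]
  · intro v' _ hne
    exact Set.indicator_of_notMem (fun h => hne (𝓜.cell_unique h hz)) _
  · simp

theorem height_nonneg (x : V → K) (z : K) : 0 ≤ 𝓜.height x z := by
  obtain ⟨v, hv⟩ := 𝓜.exists_mem_cell z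
  rw [height_eq x hv]
  exact dist_nonneg

theorem continuous_height (hopen : ∀ v, IsOpen (𝓜.cell v)) (x : V → K) :
    Continuous (𝓜.height x) :=
  continuous_finsetSum _ fun v _ =>
    (isClopen_cell hopen v).continuous_indicator (continuous_id.dist continuous_const)

/-- Drift inequality: the image of z is compared with the image of the base point, which contracts
on average, and that image with the new base point, at a distance that takes only finitely many
values. -/
theorem ContractsBy.markovOp_height_le {a : ℝ} (ha : 𝓜.ContractsBy a) {x : V → K}
    (hx : ∀ v, x v ∈ 𝓜.cell v) (z : K) :
    𝓜.markovOp (𝓜.height x) z ≤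
      a * 𝓜.height x z + ∑ e, dist (𝓜.w e (x (𝓜.init e))) (x (𝓜.term e)) := by
  obtain ⟨v, hv⟩ := 𝓜.exists_mem_cell z
  rw [height_eq x hv]
  refine le_trans ?_ (add_le_add_left (ha v z hv (x v) (hx v)) _)
  rw [← Finset.sum_add_distrib]
  refine Finset.sum_le_sum fun e _ => ?_
  by_cases hp : 𝓜.p e z = 0
  · simp [hp]
  obtain rfl := 𝓜.cell_unique hv (𝓜.mem_cell_init_of_p_ne_zero hp)
  rw [height_eq x (𝓜.w_mapsTo e hv)]
  have h1 := dist_triangle (𝓜.w e z) (𝓜.w e (x (𝓜.init e))) (x (𝓜.term e))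
  have h2 := mul_le_mul_of_nonneg_left h1 (𝓜.p_nonneg e z)
  have h3 : 𝓜.p e z * dist (𝓜.w e (x (𝓜.init e))) (x (𝓜.term e)) ≤
      dist (𝓜.w e (x (𝓜.init e))) (x (𝓜.term e)) :=
    mul_le_of_le_one_left dist_nonneg (𝓜.p_le_one e z)
  linarith

theorem isTightMeasureSet_of_lintegral_height_le [ProperSpace K] {x : V → K} {D : ℝ}
    (hm : Measurable (𝓜.height x)) {S : Set (Measure K)}
    (hS : ∀ μ ∈ S, ∫⁻ z, ENNReal.ofReal (𝓜.height x z) ∂μ ≤ ENNReal.ofReal D) :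
    IsTightMeasureSet S := by
  rw [isTightMeasureSet_iff_exists_isCompact_measure_compl_le]
  intro ε hε
  obtain ⟨r, hr0, hr⟩ : ∃ r : ℝ, 0 < r ∧ ENNReal.ofReal D / ENNReal.ofReal r ≤ ε := by
    have : Tendsto (fun r : ℝ => ENNReal.ofReal D / ENNReal.ofReal r) atTop
        (𝓝 (ENNReal.ofReal D / ⊤)) :=
      ENNReal.Tendsto.const_div ENNReal.tendsto_ofReal_atTop (Or.inr ENNReal.ofReal_ne_top)
    rw [ENNReal.div_top] at this
    obtain ⟨r, h1, h2⟩ := ((this.eventually_le_const hε).and (eventually_gt_atTop 0)).exists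
    exact ⟨r, h2, h1⟩
  refine ⟨⋃ v, Metric.closedBall (x v) r, isCompact_iUnion fun v => isCompact_closedBall _ _,
    fun μ hμ => ?_⟩
  refine le_trans (measure_mono ?_) ((meas_ge_le_lintegral_div
    hm.ennreal_ofReal.aemeasurable (ε := ENNReal.ofReal r) (by simpa using hr0)
    ENNReal.ofReal_ne_top).trans (le_trans (ENNReal.div_le_div_right (hS μ hμ) _) hr))
  intro z hz
  obtain ⟨v, hv⟩ := 𝓜.exists_mem_cell z
  simp only [Set.mem_compl_iff, Set.mem_iUnion, Metric.mem_closedBall, not_exists, not_le] at hz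
  simp only [Set.mem_ofPred_eq, height_eq x hv]
  exact ENNReal.ofReal_le_ofReal (hz v).le

end Regularity

/-! ### The invariant measure as a limit of averages. -/

section Existence

variable [MetricSpace K] [BorelSpace K] [Fintype V]

theorem ContractsBy.lintegral_height_push_le {a : ℝ} (ha : 𝓜.ContractsBy a) (ha0 : 0 ≤ a)
    (hopen : ∀ v, IsOpen (𝓜.cell v)) {x : V → K} (hx : ∀ v, x v ∈ 𝓜.cell v) {D : ℝ}
    (hD : a * D + ∑ e, dist (𝓜.w e (x (𝓜.init e))) (x (𝓜.term e)) ≤ D) (hD0 : 0 ≤ D)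
    {ν : Measure K} [IsProbabilityMeasure ν]
    (hν : ∫⁻ z, ENNReal.ofReal (𝓜.height x z) ∂ν ≤ ENNReal.ofReal D) :
    ∫⁻ z, ENNReal.ofReal (𝓜.height x z) ∂(𝓜.push ν) ≤ ENNReal.ofReal D := by
  have hC : 0 ≤ ∑ e, dist (𝓜.w e (x (𝓜.init e))) (x (𝓜.term e)) :=
    Finset.sum_nonneg fun e _ => dist_nonneg
  have hm := (continuous_height hopen x).measurable
  rw [𝓜.lintegral_push ν hm.ennreal_ofReal]
  calc _ ≤ ∫⁻ z, (ENNReal.ofReal a * ENNReal.ofReal (𝓜.height x z) +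
          ENNReal.ofReal (∑ e, dist (𝓜.w e (x (𝓜.init e))) (x (𝓜.term e)))) ∂ν := by
        refine lintegral_mono fun z => ?_
        have := ENNReal.ofReal_le_ofReal (ha.markovOp_height_le hx z)
        rw [ENNReal.ofReal_add (mul_nonneg ha0 (height_nonneg x z)) hC, ENNReal.ofReal_mul ha0,
          markovOp, ENNReal.ofReal_sum_of_nonneg fun e _ =>
            mul_nonneg (𝓜.p_nonneg e z) (height_nonneg x _)] at this
        simpa only [ENNReal.ofReal_mul (𝓜.p_nonneg _ z)] using this
    _ = ENNReal.ofReal a * ∫⁻ z, ENNReal.ofReal (𝓜.height x z) ∂ν +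
          ENNReal.ofReal (∑ e, dist (𝓜.w e (x (𝓜.init e))) (x (𝓜.term e))) := by
        rw [lintegral_add_right _ measurable_const, lintegral_const_mul _ hm.ennreal_ofReal]
        simp
    _ ≤ ENNReal.ofReal a * ENNReal.ofReal D +
          ENNReal.ofReal (∑ e, dist (𝓜.w e (x (𝓜.init e))) (x (𝓜.term e))) := by gcongr
    _ ≤ ENNReal.ofReal D := by
        rw [← ENNReal.ofReal_mul ha0, ← ENNReal.ofReal_add (mul_nonneg ha0 hD0) hC]
        exact ENNReal.ofReal_le_ofReal hD

variable [ProperSpace K]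

theorem exists_push_eq (hcontr : 𝓜.IsContractive) (hopen : ∀ v, IsOpen (𝓜.cell v))
    (hdini : ∀ e, DiniContinuousOn (𝓜.p e) (𝓜.cell (𝓜.init e)))
    (hpos : ∀ e, ∃ δ : ℝ, 0 < δ ∧ ∀ y ∈ 𝓜.cell (𝓜.init e), δ ≤ 𝓜.p e y)
    [Nonempty K] {x : V → K} (hx : ∀ v, x v ∈ 𝓜.cell v) :
    ∃ μ : Measure K, IsProbabilityMeasure μ ∧ 𝓜.push μ = μ ∧
      ∫⁻ z, ENNReal.ofReal (𝓜.height x z) ∂μ ≠ ⊤ := by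
  obtain ⟨z⟩ := ‹Nonempty K›
  obtain ⟨a, ha0, ha1, ha⟩ := id hcontr
  have ha : 𝓜.ContractsBy a := ha
  have hhm := (continuous_height hopen x).measurable
  set C := ∑ e, dist (𝓜.w e (x (𝓜.init e))) (x (𝓜.term e)) with hCdef
  have hC : 0 ≤ C := Finset.sum_nonneg fun e _ => dist_nonneg
  -- A level that bounds the initial height and is preserved by the drift inequality, since (1 - a)
  -- D ≥ C.
  set D : ℝ := 𝓜.height x z + C / (1 - a)
  have h1a : 0 < 1 - a := by linarith
  have hz0 := height_nonneg (𝓜 := 𝓜) x z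
  have hD0 : 0 ≤ D := by positivity
  have hD : a * D + C ≤ D := by
    have h : (1 - a) * D = (1 - a) * 𝓜.height x z + C := by
      simp only [D]; field_simp
    nlinarith [mul_nonneg h1a.le hz0]
  have hk : ∀ k, ∫⁻ y, ENNReal.ofReal (𝓜.height x y) ∂(𝓜.push^[k] (Measure.dirac z)) ≤
      ENNReal.ofReal D := by
    intro k
    induction k with
    | zero =>
      rw [Function.iterate_zero_apply, lintegral_dirac' _ hhm.ennreal_ofReal]
      refine ENNReal.ofReal_le_ofReal ?_
      have : 0 ≤ C / (1 - a) := by positivity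
      simp only [D]
      linarith
    | succ k ih =>
      have := isProbabilityMeasure_iterate_push (𝓜 := 𝓜) z k
      rw [Function.iterate_succ_apply']
      exact ha.lintegral_height_push_le ha0.le hopen hx hD hD0 ih
  set m : ℕ → ProbabilityMeasure K := fun n => ⟨𝓜.cesaro z n, inferInstance⟩
  have hmD : ∀ n, ∫⁻ y, ENNReal.ofReal (𝓜.height x y) ∂(m n : Measure K) ≤ ENNReal.ofReal D :=
    fun n => lintegral_cesaro_le hk n
  have hcomp : IsCompact (closure (Set.range m)) := by
    refine isCompact_closure_of_isTightMeasureSet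
      (isTightMeasureSet_of_lintegral_height_le (D := D) hhm ?_)
    rintro _ ⟨_, ⟨n, rfl⟩, rfl⟩
    exact hmD n
  -- A non-principal ultrafilter on ℕ plays the role of a convergent subsequence.
  obtain ⟨μ, -, hμ⟩ := hcomp.ultrafilter_le_nhds ((hyperfilter ℕ).map m) (by
    rw [le_principal_iff, Ultrafilter.mem_coe, Ultrafilter.mem_map]
    exact univ_mem' fun n => subset_closure ⟨n, rfl⟩)
  have hμ : Tendsto m (hyperfilter ℕ : Filter ℕ) (𝓝 μ) := hμ
  have htop : (hyperfilter ℕ : Filter ℕ) ≤ atTop := Nat.hyperfilter_le_atTop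
  refine ⟨μ, inferInstance, ?_, ?_⟩
  · refine ext_of_forall_integral_eq_of_IsFiniteMeasure fun f => ?_
    have hfm : Measurable f := f.continuous.measurable
    have hfC : ∀ y, |f y| ≤ ‖f‖ := fun y => f.norm_coe_le_norm y
    rw [𝓜.integral_push _ hfm hfC]
    have hUc := continuous_markovOp hcontr hopen hdini hpos f.continuous
    set U : BoundedContinuousFunction K ℝ := BoundedContinuousFunction.ofNormedAddCommGroup
      (𝓜.markovOp f) hUc ‖f‖ (abs_markovOp_le hfC)
    have t1 := ProbabilityMeasure.tendsto_iff_forall_integral_tendsto.1 hμ f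
    have t2 := ProbabilityMeasure.tendsto_iff_forall_integral_tendsto.1 hμ U
    have t3 : Tendsto (fun n => ∫ y, U y ∂(m n : Measure K) - ∫ y, f y ∂(m n : Measure K))
        (hyperfilter ℕ : Filter ℕ) (𝓝 0) := by
      refine squeeze_zero_norm (a := fun n : ℕ => 2 * ‖f‖ / ((n : ℝ) + 1))
        (fun n => abs_integral_markovOp_cesaro_sub_le hfm hUc.measurable hfC z n) ?_
      exact (tendsto_const_nhds.div_atTop
        (tendsto_atTop_add_const_right _ _ tendsto_natCast_atTop_atTop)).mono_left htop
    exact sub_eq_zero.1 (tendsto_nhds_unique (t2.sub t1) t3)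
  · refine ne_top_of_le_ne_top (ENNReal.ofReal_ne_top (r := D)) ?_
    -- Weak convergence only sees bounded continuous functions, so the height is truncated at N;
    -- Fatou's lemma then removes the truncation.
    have hR : ∀ N : ℕ, ∫⁻ y, ((min (𝓜.height x y).toNNReal N : NNReal) : ℝ≥0∞) ∂(μ : Measure K) ≤
        ENNReal.ofReal D := by
      intro N
      set f : BoundedContinuousFunction K NNReal := BoundedContinuousFunction.mkOfBound
        ⟨fun y => min (𝓜.height x y).toNNReal N,
          ((continuous_real_toNNReal.comp (continuous_height hopen x)).min continuous_const)⟩ N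
        (fun y y' => by
          rw [NNReal.dist_eq]
          refine abs_sub_le_iff.2 ⟨?_, ?_⟩ <;>
          · simp only [ContinuousMap.coe_mk]
            rw [sub_le_iff_le_add]
            norm_cast
            exact (min_le_right _ _).trans le_self_add)
      have t := ProbabilityMeasure.tendsto_iff_forall_lintegral_tendsto.1 hμ f
      refine le_of_tendsto t (Eventually.of_forall fun n => le_trans (lintegral_mono fun y => ?_)
        (hmD n))
      exact ENNReal.coe_le_coe.2 (min_le_left _ _)
    calc ∫⁻ y, ENNReal.ofReal (𝓜.height x y) ∂(μ : Measure K)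
        = ∫⁻ y, liminf (fun N : ℕ => ((min (𝓜.height x y).toNNReal N : NNReal) : ℝ≥0∞)) atTop
            ∂(μ : Measure K) := by
          refine lintegral_congr fun y => ?_
          refine (Tendsto.liminf_eq ?_).symm
          refine tendsto_const_nhds.congr' ?_
          obtain ⟨N₀, hN₀⟩ := exists_nat_ge (𝓜.height x y).toNNReal
          filter_upwards [eventually_ge_atTop N₀] with N hN
          rw [min_eq_left (hN₀.trans (Nat.cast_le.2 hN))]
          rfl
      _ ≤ liminf (fun N : ℕ => ∫⁻ y, ((min (𝓜.height x y).toNNReal N : NNReal) : ℝ≥0∞)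
            ∂(μ : Measure K)) atTop := by
          refine lintegral_liminf_le fun N => ?_
          exact (hhm.real_toNNReal.min measurable_const).coe_nnreal_ennreal
      _ ≤ ENNReal.ofReal D := by
          refine liminf_le_of_frequently_le' (Frequently.of_forall hR)

end Existence

end MarkovSystem

/-! ### Cylinders of the code space -/

section CodeSpace

variable {E : Type*}

/-- The word of length `n` that occurs in `σ` at the places `m, m + 1, …`. -/
def window (m : ℤ) (n : ℕ) (σ : ℤ → E) : Fin n → E := fun j => σ (m + j)

theorem cylinderAt_ofFn (m : ℤ) {n : ℕ} (g : Fin n → E) :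
    cylinderAt m (List.ofFn g) = window m n ⁻¹' {g} := by
  ext σ
  simp only [cylinderAt, Set.mem_ofPred_eq, Set.mem_preimage, Set.mem_singleton_iff,
    List.getElem_ofFn, List.length_ofFn]
  exact ⟨fun h => funext fun j => h j j.2, fun h j hj => congrFun h ⟨j, hj⟩⟩

@[simp] theorem cylinderAt_nil (m : ℤ) : cylinderAt m ([] : List E) = Set.univ := by
  ext σ
  simp [cylinderAt]

theorem mem_cylinderAt_cons {m : ℤ} {e : E} {l : List E} {σ : ℤ → E} :
    σ ∈ cylinderAt m (e :: l) ↔ σ m = e ∧ σ ∈ cylinderAt (m + 1) l := by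
  simp only [cylinderAt, Set.mem_ofPred_eq, List.length_cons]
  constructor
  · intro h
    refine ⟨by simpa using h 0 (by omega), fun j hj => ?_⟩
    have := h (j + 1) (by omega)
    simp only [Nat.cast_add, Nat.cast_one, List.getElem_cons_succ] at this
    rw [← this]
    congr 1
    ring
  · rintro ⟨h0, h⟩ j hj
    cases j with
    | zero => simpa using h0
    | succ j =>
      rw [List.getElem_cons_succ, ← h j (by omega)]
      congr 1
      push_cast
      ring

theorem mem_cylinderAt_append {m : ℤ} {l l' : List E} {σ : ℤ → E} :
    σ ∈ cylinderAt m (l ++ l') ↔ σ ∈ cylinderAt m l ∧ σ ∈ cylinderAt (m + l.length) l' := by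
  induction l generalizing m with
  | nil => simp
  | cons e l ih =>
    rw [List.cons_append, mem_cylinderAt_cons, ih, mem_cylinderAt_cons, and_assoc,
      List.length_cons, show m + 1 + (l.length : ℤ) = m + (l.length + 1 : ℕ) by push_cast; ring]

theorem cylinderAt_append_singleton (m : ℤ) (l : List E) (e : E) :
    cylinderAt m (l ++ [e]) = cylinderAt m l ∩ {σ | σ (m + l.length) = e} := by
  ext σ
  rw [mem_cylinderAt_append, mem_cylinderAt_cons]
  simp

theorem preimage_shiftBy_cylinderAt (k m : ℤ) (l : List E) :
    shiftBy k ⁻¹' cylinderAt m l = cylinderAt (m + k) l := by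
  ext σ
  simp only [cylinderAt, shiftBy, Set.mem_preimage, Set.mem_ofPred_eq, add_right_comm]

theorem ofFn_window_succ (m : ℤ) (n : ℕ) (σ : ℤ → E) :
    List.ofFn (window m (n + 1) σ) = σ m :: List.ofFn (window (m + 1) n σ) := by
  rw [List.ofFn_succ]
  simp only [window, Fin.val_zero, Nat.cast_zero, add_zero, Fin.val_succ]
  congr 2
  funext j
  congr 1
  push_cast
  ring

theorem ofFn_window_succ_last (m : ℤ) (n : ℕ) (σ : ℤ → E) :
    List.ofFn (window m (n + 1) σ) = List.ofFn (window m n σ) ++ [σ (m + n)] := by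
  induction n generalizing m with
  | zero => simp [window]
  | succ n ih =>
    rw [ofFn_window_succ, ih, ofFn_window_succ m n]
    simp only [List.cons_append, Nat.cast_add, Nat.cast_one]
    congr 4
    ring

@[simp] theorem window_leftShift (m : ℤ) (n : ℕ) (σ : ℤ → E) :
    window m n (leftShift σ) = window (m + 1) n σ := by
  funext j
  simp only [window, leftShift, shiftBy]
  congr 1
  ring

theorem shiftBy_shiftBy (j k : ℤ) (σ : ℤ → E) : shiftBy j (shiftBy k σ) = shiftBy (j + k) σ := by
  funext n
  simp only [shiftBy]
  congr 1
  ring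

@[simp] theorem shiftBy_zero (σ : ℤ → E) : shiftBy 0 σ = σ := by
  funext n
  simp [shiftBy]

theorem image_shiftBy (k : ℤ) (s : Set (ℤ → E)) : shiftBy k '' s = shiftBy (-k) ⁻¹' s := by
  refine congrFun (Set.image_eq_preimage_of_inverse (fun σ => ?_) (fun σ => ?_)) s <;>
    simp [shiftBy_shiftBy]

theorem iterate_leftShift (n : ℕ) : (leftShift : (ℤ → E) → (ℤ → E))^[n] = shiftBy n := by
  induction n with
  | zero => funext σ; simp
  | succ n ih =>
    rw [Function.iterate_succ', ih]
    funext σ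
    simp only [Function.comp_apply, leftShift, shiftBy_shiftBy]
    congr 1
    push_cast
    ring

/-- An extension of a word to a two-sided sequence. -/
def extendWord (e₀ : E) (n : ℕ) (g : Fin (2 * n + 1) → E) (j : ℤ) : E :=
  if h : (j + n).toNat < 2 * n + 1 then g ⟨(j + n).toNat, h⟩ else e₀

theorem window_extendWord (e₀ : E) (n : ℕ) (g : Fin (2 * n + 1) → E) :
    window (-n) (2 * n + 1) (extendWord e₀ n g) = g := by
  funext j
  have h : (-(n : ℤ) + j + n).toNat = j := by omega
  simp only [window, extendWord, h, j.2, dite_true]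

variable [MeasurableSpace E]

@[fun_prop]
theorem measurable_window (m : ℤ) (n : ℕ) : Measurable (window m n : (ℤ → E) → Fin n → E) :=
  measurable_pi_lambda _ fun _ => measurable_pi_apply _

@[fun_prop]
theorem measurable_shiftBy (k : ℤ) : Measurable (shiftBy k : (ℤ → E) → ℤ → E) :=
  measurable_pi_lambda _ fun _ => measurable_pi_apply _

@[fun_prop]
theorem measurable_leftShift : Measurable (leftShift : (ℤ → E) → ℤ → E) := measurable_shiftBy 1

theorem exists_window_of_mem_measurableCylinders {s : Set (ℤ → E)}
    (hs : s ∈ measurableCylinders fun _ : ℤ => E) :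
    ∃ (n : ℕ) (S : Set (Fin (2 * n + 1) → E)), s = window (-n) (2 * n + 1) ⁻¹' S := by
  obtain ⟨I, S, -, rfl⟩ := (mem_measurableCylinders _).1 hs
  obtain ⟨n, hn⟩ : ∃ n : ℕ, ∀ i ∈ I, |i| ≤ n := by
    refine ⟨∑ i ∈ I, i.natAbs, fun i hi => ?_⟩
    rw [Int.abs_eq_natAbs]
    exact_mod_cast Finset.single_le_sum (f := Int.natAbs) (fun _ _ => Nat.zero_le _) hi
  have hlt : ∀ i : I, ((i : ℤ) + n).toNat < 2 * n + 1 := fun i => by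
    have := abs_le.1 (hn i i.2)
    omega
  refine ⟨n, {g | (fun i : I => g ⟨((i : ℤ) + n).toNat, hlt i⟩) ∈ S}, ?_⟩
  ext σ
  simp only [mem_cylinder, Set.mem_preimage, Set.mem_ofPred_eq, window]
  suffices h : (I.restrict σ) = fun i : I => σ (-(n : ℤ) + ((i : ℤ) + n).toNat) by rw [h]
  funext i
  have := abs_le.1 (hn i i.2)
  simp only [Finset.restrict]
  congr 1
  omega

variable [DiscreteMeasurableSpace E] [Fintype E]

theorem measurableSet_cylinderAt (m : ℤ) (l : List E) : MeasurableSet (cylinderAt m l) := by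
  rw [← List.ofFn_getElem (xs := l), cylinderAt_ofFn]
  exact measurable_window _ _ (measurableSet_singleton _)

theorem measurable_of_window {X : Type*} [MeasurableSpace X] (m : ℤ) (n : ℕ)
    (f : (Fin n → E) → X) : Measurable fun σ : ℤ → E => f (window m n σ) :=
  (measurable_of_finite f).comp (measurable_window m n)

theorem measurableSet_eval (j : ℤ) (e : E) : MeasurableSet {σ : ℤ → E | σ j = e} := by
  have h : MeasurableSet ((fun σ : ℤ → E => σ j) ⁻¹' {e}) :=
    measurable_pi_apply j (measurableSet_singleton e)
  exact h

theorem lintegral_window (Λ : Measure (ℤ → E)) (m : ℤ) (n : ℕ) (f : (Fin n → E) → ℝ≥0∞) :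
    ∫⁻ σ, f (window m n σ) ∂Λ = ∑ g, f g * Λ (cylinderAt m (List.ofFn g)) := by
  rw [← lintegral_map (measurable_of_finite f) (measurable_window m n), lintegral_fintype]
  refine Finset.sum_congr rfl fun g _ => ?_
  rw [Measure.map_apply (measurable_window m n) (measurableSet_singleton _), cylinderAt_ofFn]

theorem integral_window (Λ : Measure (ℤ → E)) [IsFiniteMeasure Λ] (m : ℤ) (n : ℕ)
    (f : (Fin n → E) → ℝ) :
    ∫ σ, f (window m n σ) ∂Λ = ∑ g, Λ.real (cylinderAt m (List.ofFn g)) * f g := by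
  rw [← integral_map (measurable_window m n).aemeasurable
    (measurable_of_finite f).aestronglyMeasurable, integral_fintype .of_finite]
  refine Finset.sum_congr rfl fun g _ => ?_
  rw [map_measureReal_apply (measurable_window m n) (measurableSet_singleton _), cylinderAt_ofFn,
    smul_eq_mul]

theorem map_window_eq {Λ Λ' : Measure (ℤ → E)} {m : ℤ} {n : ℕ}
    (h : ∀ g : Fin n → E, Λ (cylinderAt m (List.ofFn g)) = Λ' (cylinderAt m (List.ofFn g))) :
    Λ.map (window m n) = Λ'.map (window m n) := by
  refine Measure.ext_of_singleton fun g => ?_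
  rw [Measure.map_apply (measurable_window m n) (measurableSet_singleton _),
    Measure.map_apply (measurable_window m n) (measurableSet_singleton _), ← cylinderAt_ofFn, h]

theorem measure_ext_of_cylinderAt {Λ Λ' : Measure (ℤ → E)} [IsFiniteMeasure Λ]
    (h : ∀ (n : ℕ) (g : Fin (2 * n + 1) → E),
      Λ (cylinderAt (-n) (List.ofFn g)) = Λ' (cylinderAt (-n) (List.ofFn g))) : Λ = Λ' := by
  have hwin : ∀ (n : ℕ) (S : Set (Fin (2 * n + 1) → E)),
      Λ (window (-n) (2 * n + 1) ⁻¹' S) = Λ' (window (-n) (2 * n + 1) ⁻¹' S) := fun n S => by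
    rw [← Measure.map_apply (measurable_window _ _) S.toFinite.measurableSet,
      ← Measure.map_apply (measurable_window _ _) S.toFinite.measurableSet,
      map_window_eq fun g => h n g]
  refine ext_of_generate_finite _ generateFrom_measurableCylinders.symm
    isPiSystem_measurableCylinders (fun s hs => ?_) (by simpa using hwin 0 Set.univ)
  obtain ⟨n, S, rfl⟩ := exists_window_of_mem_measurableCylinders hs
  exact hwin n S

theorem sum_measure_inter_eval (Λ : Measure (ℤ → E)) (s : Set (ℤ → E))
    (j : ℤ) : ∑ e, Λ (s ∩ {σ | σ j = e}) = Λ s := by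
  have := sum_measure_preimage_singleton (μ := Λ.restrict s) (Finset.univ : Finset E)
    (f := fun σ : ℤ → E => σ j) fun e _ => measurableSet_eval j e
  simp only [Finset.coe_univ, Set.preimage_univ, Measure.restrict_apply_univ] at this
  rw [← this]
  refine Finset.sum_congr rfl fun e _ => ?_
  have := Measure.restrict_apply (μ := Λ) (s := s) (measurableSet_eval j e)
  rw [Set.inter_comm, ← this]
  rfl

theorem sum_setLIntegral_eval (Λ : Measure (ℤ → E)) (j : ℤ) (f : (ℤ → E) → ℝ≥0∞) :
    ∑ e, ∫⁻ σ in {σ | σ j = e}, f σ ∂Λ = ∫⁻ σ, f σ ∂Λ := by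
  have hsplit : Λ = ∑ e, Λ.restrict {σ : ℤ → E | σ j = e} := by
    ext s hs
    rw [Measure.finsetSum_apply, ← sum_measure_inter_eval Λ s j]
    exact Finset.sum_congr rfl fun e _ => (Measure.restrict_apply hs).symm
  conv_rhs => rw [hsplit]
  rw [lintegral_finsetSum_measure]

theorem sum_measure_cylinderAt_cons (Λ : Measure (ℤ → E)) (m : ℤ) (l : List E) :
    ∑ e, Λ (cylinderAt m (e :: l)) = Λ (cylinderAt (m + 1) l) := by
  rw [← sum_measure_inter_eval Λ (cylinderAt (m + 1) l) m]
  refine Finset.sum_congr rfl fun e _ => congrArg _ ?_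
  ext σ
  rw [mem_cylinderAt_cons, and_comm]
  rfl

theorem sum_measure_cylinderAt_append (Λ : Measure (ℤ → E)) (m : ℤ) (l : List E) :
    ∑ e, Λ (cylinderAt m (l ++ [e])) = Λ (cylinderAt m l) := by
  simp only [cylinderAt_append_singleton]
  exact sum_measure_inter_eval Λ _ _

end CodeSpace

/-! ### The generalized Markov measure -/

namespace MarkovSystem

variable {K V E : Type*} [MeasurableSpace K] [Fintype E] (𝓜 : MarkovSystem K V E)

/-- The mean over `μ` of the probability of a word. -/
noncomputable def wordMass (μ : Measure K) (l : List E) : ℝ≥0∞ :=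
  ∫⁻ x, ENNReal.ofReal (𝓜.wordProb l x) ∂μ

theorem sum_wordMass_append (μ : Measure K) (l : List E) :
    ∑ e, 𝓜.wordMass μ (l ++ [e]) = 𝓜.wordMass μ l := by
  simp only [wordMass]
  rw [← lintegral_finsetSum _ fun e _ => (𝓜.measurable_wordProb _).ennreal_ofReal]
  refine lintegral_congr fun x => ?_
  simp only [wordProb_append, wordProb_cons, wordProb_nil, mul_one,
    ENNReal.ofReal_mul (𝓜.wordProb_nonneg l x), ← Finset.mul_sum, sum_ofReal_p]

variable {𝓜}

theorem sum_wordMass_cons {μ : Measure K} (hμ : 𝓜.push μ = μ) (l : List E) :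
    ∑ e, 𝓜.wordMass μ (e :: l) = 𝓜.wordMass μ l := by
  simp only [wordMass]
  conv_rhs => rw [← hμ, 𝓜.lintegral_push μ (𝓜.measurable_wordProb l).ennreal_ofReal]
  rw [← lintegral_finsetSum _ fun e _ => (𝓜.measurable_wordProb _).ennreal_ofReal]
  refine lintegral_congr fun x => Finset.sum_congr rfl fun e _ => ?_
  rw [wordProb_cons, ENNReal.ofReal_mul (𝓜.p_nonneg e x)]

theorem wordMass_nil (μ : Measure K) [IsProbabilityMeasure μ] : 𝓜.wordMass μ [] = 1 := by
  simp [wordMass]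

theorem sum_wordMass (μ : Measure K) [IsProbabilityMeasure μ] (n : ℕ) :
    ∑ g : Fin n → E, 𝓜.wordMass μ (List.ofFn g) = 1 := by
  induction n with
  | zero => simp [wordMass_nil]
  | succ n ih =>
    rw [sum_ofFn_succ_last n (𝓜.wordMass μ)]
    simp only [sum_wordMass_append, ih]

variable [MeasurableSpace E]

theorem IsGeneralizedMarkovMeasure.isProbabilityMeasure {μ : Measure K} [IsProbabilityMeasure μ]
    {M : Measure (ℤ → E)} (hM : 𝓜.IsGeneralizedMarkovMeasure μ M) : IsProbabilityMeasure M := by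
  constructor
  simpa using hM 0 []

variable [DiscreteMeasurableSpace E]

/-- Consistency: a word that fits in the window is completed to the right, using that the p_e sum to
1, and to the left, using that μ is invariant. -/
theorem measure_cylinderAt_eq_wordMass {μ : Measure K} (hμ : 𝓜.push μ = μ)
    {Λ : Measure (ℤ → E)} {m : ℤ} {N : ℕ}
    (h : ∀ g : Fin N → E, Λ (cylinderAt m (List.ofFn g)) = 𝓜.wordMass μ (List.ofFn g))
    (k : ℕ) (l : List E) (hl : k + l.length ≤ N) :
    Λ (cylinderAt (m + k) l) = 𝓜.wordMass μ l := by
  induction k generalizing l with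
  | zero =>
    obtain ⟨d, hd⟩ := Nat.exists_eq_add_of_le hl
    induction d generalizing l with
    | zero =>
      have := h fun j => l[j]'(by omega)
      have hl' : (List.ofFn fun j : Fin N => l[j]'(by omega)) = l := by
        refine List.ext_getElem (by simp; omega) fun i h1 h2 => by simp
      rw [hl'] at this
      simpa using this
    | succ d ih =>
      rw [← sum_measure_cylinderAt_append, ← 𝓜.sum_wordMass_append]
      refine Finset.sum_congr rfl fun e _ => ih (l ++ [e]) ?_ ?_ <;> simp <;> omega
  | succ k ih =>
    rw [Nat.cast_add, Nat.cast_one, ← add_assoc, ← sum_measure_cylinderAt_cons,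
      ← sum_wordMass_cons hμ]
    exact Finset.sum_congr rfl fun e _ => ih (e :: l) (by simp; omega)

/-- Atomic measures with the right masses on the words in [-n, n] have a limit point by compactness.
Every cylinder is clopen and its mass is eventually constant along the sequence, so the limit has
the right mass on it. -/
theorem exists_isGeneralizedMarkovMeasure [Nonempty K] {μ : Measure K} [IsProbabilityMeasure μ]
    (hμ : 𝓜.push μ = μ) :
    ∃ M : Measure (ℤ → E), IsProbabilityMeasure M ∧ 𝓜.IsGeneralizedMarkovMeasure μ M := by
  obtain ⟨x₀⟩ := ‹Nonempty K›
  have hE : Nonempty E := by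
    by_contra hE
    have := not_nonempty_iff.1 hE
    simpa using 𝓜.p_sum x₀
  obtain ⟨e₀⟩ := hE
  let _ : TopologicalSpace E := ⊥
  have : DiscreteTopology E := ⟨rfl⟩
  have hcl : ∀ (m : ℤ) (l : List E), IsClopen (cylinderAt m l) := fun m l => by
    rw [← List.ofFn_getElem (xs := l), cylinderAt_ofFn]
    exact (isClopen_discrete _).preimage (continuous_pi fun j => continuous_apply _)
  set m : ℕ → Measure (ℤ → E) := fun n =>
    ∑ g : Fin (2 * n + 1) → E, 𝓜.wordMass μ (List.ofFn g) • Measure.dirac (extendWord e₀ n g)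
  have hm : ∀ n, ∀ g : Fin (2 * n + 1) → E,
      m n (cylinderAt (-n) (List.ofFn g)) = 𝓜.wordMass μ (List.ofFn g) := fun n g => by
    classical
    rw [Measure.finsetSum_apply, Finset.sum_eq_single g]
    · rw [Measure.smul_apply, Measure.dirac_apply' _ (measurableSet_cylinderAt _ _),
        Set.indicator_of_mem]
      · simp
      · rw [cylinderAt_ofFn]
        exact window_extendWord e₀ n g
    · intro g' _ hne
      rw [Measure.smul_apply, Measure.dirac_apply' _ (measurableSet_cylinderAt _ _),
        Set.indicator_of_notMem]
      · simp
      · rw [cylinderAt_ofFn]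
        simpa [window_extendWord] using hne
    · simp
  have hp : ∀ n, IsProbabilityMeasure (m n) := fun n => ⟨by
    rw [Measure.finsetSum_apply]
    simpa using sum_wordMass μ (2 * n + 1)⟩
  set P : ℕ → ProbabilityMeasure (ℤ → E) := fun n => ⟨m n, hp n⟩
  obtain ⟨M, -, hM⟩ := (isCompact_univ (X := ProbabilityMeasure (ℤ → E))).ultrafilter_le_nhds
    ((hyperfilter ℕ).map P) (by simp)
  have hM : Tendsto P (hyperfilter ℕ : Filter ℕ) (𝓝 M) := hM
  refine ⟨M, inferInstance, fun j l => ?_⟩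
  have t := ProbabilityMeasure.tendsto_measure_of_isClopen_of_tendsto hM (hcl j l)
  have hev : ∀ᶠ n in (hyperfilter ℕ : Filter ℕ), m n (cylinderAt j l) = 𝓜.wordMass μ l := by
    refine Nat.hyperfilter_le_atTop ?_
    filter_upwards [eventually_ge_atTop (j.natAbs + l.length)] with n hn
    have := measure_cylinderAt_eq_wordMass hμ (hm n) (j + n).toNat l (by omega)
    rwa [show -(n : ℤ) + ((j + n).toNat : ℕ) = j by omega] at this
  have t' : Tendsto (fun n => m n (cylinderAt j l)) (hyperfilter ℕ : Filter ℕ)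
      (𝓝 ((M : Measure (ℤ → E)) (cylinderAt j l))) := by
    simpa [P, ProbabilityMeasure.ennreal_coeFn_eq_coeFn_toMeasure] using ENNReal.tendsto_coe.2 t
  exact tendsto_nhds_unique t' (tendsto_const_nhds.congr' (hev.mono fun n hn => hn.symm))

theorem IsGeneralizedMarkovMeasure.eq {μ : Measure K} [IsProbabilityMeasure μ]
    {M M' : Measure (ℤ → E)} (hM : 𝓜.IsGeneralizedMarkovMeasure μ M)
    (hM' : 𝓜.IsGeneralizedMarkovMeasure μ M') : M = M' := by
  have := hM.isProbabilityMeasure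
  exact measure_ext_of_cylinderAt fun n g => by rw [hM, hM']

theorem IsGeneralizedMarkovMeasure.isInvariantProb {μ : Measure K} [IsProbabilityMeasure μ]
    {M : Measure (ℤ → E)} (hM : 𝓜.IsGeneralizedMarkovMeasure μ M) :
    IsInvariantProb leftShift M := by
  have := hM.isProbabilityMeasure
  refine ⟨this, measurable_leftShift, ?_⟩
  refine IsGeneralizedMarkovMeasure.eq (𝓜 := 𝓜) (μ := μ) (fun m l => ?_) hM
  rw [Measure.map_apply measurable_leftShift (measurableSet_cylinderAt m l), leftShift,
    preimage_shiftBy_cylinderAt, hM]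

end MarkovSystem

/-! ### The coding map and the energy function -/

namespace MarkovSystem

variable {K V E : Type*} [MeasurableSpace K] [Fintype E] {𝓜 : MarkovSystem K V E}

variable (𝓜) in
/-- `w_{eₙ} ∘ ⋯ ∘ w_{e₀} (x_{i(e₀)})` for the word `e₀ … eₙ`. -/
def wordPoint (x : V → K) {n : ℕ} (g : Fin (n + 1) → E) : K :=
  𝓜.wordMap (List.ofFn g) (x (𝓜.init (g 0)))

theorem pastMap_eq_wordMap (σ : ℤ → E) (n : ℕ) (z : K) :
    𝓜.pastMap σ n z = 𝓜.wordMap (List.ofFn (window (-n) (n + 1) σ)) z := by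
  induction n generalizing z with
  | zero => simp [pastMap, window]
  | succ n ih =>
    rw [ofFn_window_succ, wordMap_cons, pastMap, Function.comp_apply, ih]
    simp

theorem codingSeq_eq_wordPoint (x : V → K) (σ : ℤ → E) (n : ℕ) :
    𝓜.codingSeq x σ n = 𝓜.wordPoint x (window (-n) (n + 1) σ) := by
  simp [codingSeq, pastMap_eq_wordMap, wordPoint, window]

theorem codingSeq_leftShift_succ (x : V → K) (σ : ℤ → E) (n : ℕ) :
    𝓜.codingSeq x (leftShift σ) (n + 1) = 𝓜.w (σ 1) (𝓜.codingSeq x σ n) := by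
  simp only [codingSeq_eq_wordPoint, wordPoint, window_leftShift]
  rw [ofFn_window_succ_last, wordMap_append]
  simp [window]

theorem pastMap_mem_cell {σ : ℤ → E} (hσ : σ ∈ 𝓜.pathSpace) (n : ℕ) {z : K}
    (hz : z ∈ 𝓜.cell (𝓜.init (σ (-n)))) : 𝓜.pastMap σ n z ∈ 𝓜.cell (𝓜.init (σ 1)) := by
  induction n generalizing z with
  | zero =>
    have := hσ 0
    rw [zero_add] at this
    rw [← this]
    exact 𝓜.w_mapsTo _ (by simpa using hz)
  | succ n ih =>
    refine ih ?_
    have := hσ (-((n : ℤ) + 1))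
    rw [show -((n : ℤ) + 1) + 1 = -n by ring] at this
    rw [← this]
    exact 𝓜.w_mapsTo _ (by simpa using hz)

theorem codingSeq_mem_cell {x : V → K} (hx : ∀ v, x v ∈ 𝓜.cell v) {σ : ℤ → E}
    (hσ : σ ∈ 𝓜.pathSpace) (n : ℕ) : 𝓜.codingSeq x σ n ∈ 𝓜.cell (𝓜.init (σ 1)) :=
  pastMap_mem_cell hσ n (hx _)

theorem mem_codingDomain [TopologicalSpace K] {x : V → K} {σ : ℤ → E} :
    σ ∈ 𝓜.codingDomain x ↔ ∀ k : ℤ, shiftBy k σ ∈ 𝓜.convergenceSet x := by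
  simp only [codingDomain, image_shiftBy, Set.mem_iInter, Set.mem_preimage]
  exact ⟨fun h k => by simpa using h (-k), fun h k => h (-k)⟩

theorem mem_convergenceSet_of_mem_codingDomain [TopologicalSpace K] {x : V → K} {σ : ℤ → E}
    (hσ : σ ∈ 𝓜.codingDomain x) : σ ∈ 𝓜.convergenceSet x := by
  simpa using mem_codingDomain.1 hσ 0

section Topology

variable [MetricSpace K] [Nonempty K] {x : V → K}

theorem tendsto_codingSeq {σ : ℤ → E} (hσ : σ ∈ 𝓜.convergenceSet x) :
    Tendsto (𝓜.codingSeq x σ) atTop (𝓝 (𝓜.codingMap x σ)) :=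
  tendsto_nhds_limUnder hσ.2

theorem codingMap_mem_cell (hopen : ∀ v, IsOpen (𝓜.cell v)) (hx : ∀ v, x v ∈ 𝓜.cell v)
    {σ : ℤ → E} (hσ : σ ∈ 𝓜.convergenceSet x) :
    𝓜.codingMap x σ ∈ 𝓜.cell (𝓜.init (σ 1)) :=
  (isClopen_cell hopen _).isClosed.mem_of_tendsto (tendsto_codingSeq hσ)
    (Eventually.of_forall fun n => codingSeq_mem_cell hx hσ.1 n)

/-- The new letter is applied last, so F(Sσ) is obtained from F(σ) by the map of the letter at place
1. Continuity of that map at F(σ) is available because F(σ) lies in its open initial cell. -/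
theorem codingMap_leftShift (hcontr : 𝓜.IsContractive) (hopen : ∀ v, IsOpen (𝓜.cell v))
    (hpos : ∀ e, ∃ δ : ℝ, 0 < δ ∧ ∀ y ∈ 𝓜.cell (𝓜.init e), δ ≤ 𝓜.p e y)
    (hx : ∀ v, x v ∈ 𝓜.cell v) {σ : ℤ → E} (hσ : σ ∈ 𝓜.codingDomain x) :
    𝓜.codingMap x (leftShift σ) = 𝓜.w (σ 1) (𝓜.codingMap x σ) := by
  have h0 := mem_convergenceSet_of_mem_codingDomain hσ
  have h1 : leftShift σ ∈ 𝓜.convergenceSet x := mem_codingDomain.1 hσ 1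
  refine tendsto_nhds_unique ((tendsto_codingSeq h1).comp (tendsto_add_atTop_nat 1)) ?_
  have := (hcontr.continuousAt_w hopen hpos (codingMap_mem_cell hopen hx h0)).tendsto.comp
    (tendsto_codingSeq h0)
  refine this.congr fun n => ?_
  simp [codingSeq_leftShift_succ]

end Topology

section Measurability

variable [MetricSpace K] [ProperSpace K] [Nonempty K] [BorelSpace K]
  [MeasurableSpace E] [DiscreteMeasurableSpace E]

theorem measurable_codingSeq {K V E : Type*} [MeasurableSpace K] [Fintype E]
    {𝓜 : MarkovSystem K V E} [MeasurableSpace E] [DiscreteMeasurableSpace E] (x : V → K) (n : ℕ) :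
    Measurable fun σ => 𝓜.codingSeq x σ n := by
  simp only [codingSeq_eq_wordPoint]
  exact measurable_of_window _ _ _

@[fun_prop]
theorem measurable_codingMap (x : V → K) : Measurable (𝓜.codingMap x) :=
  (StronglyMeasurable.limUnder fun n => (measurable_codingSeq x n).stronglyMeasurable).measurable

theorem measurableSet_pathSpace {K V E : Type*} [MeasurableSpace K] [Fintype E]
    {𝓜 : MarkovSystem K V E} [MeasurableSpace E] [DiscreteMeasurableSpace E] :
    MeasurableSet 𝓜.pathSpace := by
  have : 𝓜.pathSpace = ⋂ j : ℤ, (fun σ : ℤ → E => (σ j, σ (j + 1))) ⁻¹'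
      {q | 𝓜.term q.1 = 𝓜.init q.2} := by
    ext σ
    simp [pathSpace]
  rw [this]
  exact MeasurableSet.iInter fun j => ((measurable_pi_apply j).prodMk (measurable_pi_apply _))
    (Set.toFinite _).measurableSet

theorem measurableSet_convergenceSet {K V E : Type*} [MeasurableSpace K] [Fintype E]
    {𝓜 : MarkovSystem K V E} [MetricSpace K] [ProperSpace K] [BorelSpace K]
    [MeasurableSpace E] [DiscreteMeasurableSpace E] (x : V → K) :
    MeasurableSet (𝓜.convergenceSet x) :=
  measurableSet_pathSpace.inter (measurableSet_exists_tendsto fun n => measurable_codingSeq x n)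

theorem measurableSet_codingDomain {K V E : Type*} [MeasurableSpace K] [Fintype E]
    {𝓜 : MarkovSystem K V E} [MetricSpace K] [ProperSpace K] [BorelSpace K]
    [MeasurableSpace E] [DiscreteMeasurableSpace E] (x : V → K) :
    MeasurableSet (𝓜.codingDomain x) := by
  simp only [codingDomain, image_shiftBy]
  exact MeasurableSet.iInter fun k => measurable_shiftBy _ (measurableSet_convergenceSet x)

/-- A function of the letter at a given place and of a point is measurable. -/
theorem measurable_letter_comp {X Y Z E : Type*} [MeasurableSpace X] [MeasurableSpace Y]
    [MeasurableSpace Z] [MeasurableSpace E] [DiscreteMeasurableSpace E] [Finite E]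
    {f : E → Y → Z} (hf : ∀ e, Measurable (f e)) {c : X → E} (hc : Measurable c) {F : X → Y}
    (hF : Measurable F) : Measurable fun s => f (c s) (F s) :=
  (measurable_from_prod_countable_right (f := fun q : E × Y => f q.1 q.2) hf).comp (hc.prodMk hF)

variable (𝓜) in
/-- Minus the energy, on the domain of the coding map. -/
noncomputable def rate (x : V → K) (σ : ℤ → E) : ℝ :=
  -Real.log (𝓜.p (σ 1) (𝓜.codingMap x σ))

theorem neg_log_p_nonneg {K V E : Type*} [MeasurableSpace K] [Fintype E]
    (𝓜 : MarkovSystem K V E) (e : E) (z : K) : 0 ≤ -Real.log (𝓜.p e z) :=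
  neg_nonneg.2 (Real.log_nonpos (𝓜.p_nonneg e z) (𝓜.p_le_one e z))

theorem measurable_log_p {K V E : Type*} [MeasurableSpace K] [Fintype E]
    (𝓜 : MarkovSystem K V E) (e : E) : Measurable fun z => Real.log (𝓜.p e z) :=
  Real.measurable_log.comp (𝓜.p_measurable e)

@[fun_prop]
theorem measurable_rate (x : V → K) : Measurable (𝓜.rate x) :=
  (measurable_letter_comp 𝓜.measurable_log_p (measurable_pi_apply 1) (measurable_codingMap x)).neg

theorem isEnergyFunction_energy (x : V → K) : IsEnergyFunction (𝓜.energy x) := by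
  classical
  constructor
  · unfold energy
    refine Measurable.ite (measurableSet_codingDomain x) ?_ measurable_const
    exact (measurable_letter_comp 𝓜.measurable_log_p (measurable_pi_apply 1)
      (measurable_codingMap x)).coe_real_ereal
  · intro σ
    unfold energy
    split_ifs
    · have := 𝓜.neg_log_p_nonneg (σ 1) (𝓜.codingMap x σ)
      exact_mod_cast (neg_nonneg.1 this)
    · exact bot_le

theorem energyIntegral_energy {K V E : Type*} [MeasurableSpace K] [Fintype E]
    {𝓜 : MarkovSystem K V E} [MetricSpace K] [Nonempty K] [MeasurableSpace E] {x : V → K}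
    {Λ : Measure (ℤ → E)}
    (h : ∀ᵐ σ ∂Λ, σ ∈ 𝓜.codingDomain x) (hi : Integrable (𝓜.rate x) Λ) :
    energyIntegral Λ (𝓜.energy x) = ((-∫ σ, 𝓜.rate x σ ∂Λ : ℝ) : EReal) := by
  have h1 : ∫⁻ σ, (-𝓜.energy x σ).toENNReal ∂Λ = ENNReal.ofReal (∫ σ, 𝓜.rate x σ ∂Λ) := by
    rw [ofReal_integral_eq_lintegral_ofReal hi (ae_of_all _ fun σ => 𝓜.neg_log_p_nonneg _ _)]
    refine lintegral_congr_ae ?_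
    filter_upwards [h] with σ hσ
    rw [energy, if_pos hσ, ← EReal.coe_neg, EReal.toENNReal_of_ne_top (EReal.coe_ne_top _),
      EReal.toReal_coe, rate]
  have h2 : 0 ≤ ∫ σ, 𝓜.rate x σ ∂Λ := integral_nonneg fun σ => 𝓜.neg_log_p_nonneg _ _
  rw [energyIntegral, h1, EReal.coe_ennreal_ofReal, max_eq_left h2, EReal.coe_neg]

theorem energyIntegral_energy_eq_bot {x : V → K} {Λ : Measure (ℤ → E)}
    (h : ¬ ∀ᵐ σ ∂Λ, σ ∈ 𝓜.codingDomain x) :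
    energyIntegral Λ (𝓜.energy x) = ⊥ := by
  have h1 : ∫⁻ σ, (-𝓜.energy x σ).toENNReal ∂Λ = ⊤ := by
    rw [eq_top_iff]
    calc (⊤ : ℝ≥0∞) = ∫⁻ σ in (𝓜.codingDomain x)ᶜ, ⊤ ∂Λ := by
          rw [setLIntegral_const, ENNReal.top_mul]
          exact fun h0 => h (by rwa [ae_iff])
      _ ≤ ∫⁻ σ in (𝓜.codingDomain x)ᶜ, (-𝓜.energy x σ).toENNReal ∂Λ := by
          refine setLIntegral_mono' (measurableSet_codingDomain x).compl fun σ hσ => ?_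
          rw [energy, if_neg hσ]
          simp
      _ ≤ _ := setLIntegral_le_lintegral _ _
  rw [energyIntegral, h1]
  simp

end Measurability

end MarkovSystem

/-! ### The coding map under the generalized Markov measure -/

/-- Finite Borel measures on a metric space are determined by the integrals of Lipschitz
functions. -/
theorem measure_ext_of_lipschitz {X : Type*} [MetricSpace X] [MeasurableSpace X] [BorelSpace X]
    {ν₁ ν₂ : Measure X} [IsFiniteMeasure ν₁] [IsFiniteMeasure ν₂]
    (h : ∀ (f : X → ℝ) (L : ℝ), Continuous f → 0 ≤ L → (∀ x, 0 ≤ f x) → (∀ x, f x ≤ 1) →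
      (∀ x y, |f x - f y| ≤ L * dist x y) → ∫ x, f x ∂ν₁ = ∫ x, f x ∂ν₂) : ν₁ = ν₂ := by
  have hclosed : ∀ s : Set X, IsClosed s → ν₁ s = ν₂ s := by
    intro s hs
    rw [← measureReal_eq_measureReal_iff]
    have hpos : ∀ n : ℕ, (0 : ℝ) < 1 / (n + 1) := fun n => by positivity
    have t₁ := tendsto_integral_thickenedIndicator_of_isClosed ν₁ hs hpos
      tendsto_one_div_add_atTop_nhds_zero_nat
    have t₂ := tendsto_integral_thickenedIndicator_of_isClosed ν₂ hs hpos
      tendsto_one_div_add_atTop_nhds_zero_nat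
    refine tendsto_nhds_unique t₁ (t₂.congr fun n => ?_)
    refine (h _ ((1 / ((n : ℝ) + 1)).toNNReal⁻¹ : NNReal) ?_ (NNReal.coe_nonneg _)
      (fun y => NNReal.coe_nonneg _) (fun y => ?_) (fun y z => ?_)).symm
    · exact NNReal.continuous_coe.comp (thickenedIndicator (hpos n) s).continuous
    · exact_mod_cast thickenedIndicator_le_one (hpos n) s y
    · have := (lipschitzWith_thickenedIndicator (hpos n) s).dist_le_mul y z
      rwa [NNReal.dist_eq] at this
  refine ext_of_generate_finite _ (BorelSpace.measurable_eq.trans borel_eq_generateFrom_isClosed)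
    isPiSystem_isClosed (fun s hs => hclosed s hs) (hclosed _ isClosed_univ)

namespace MarkovSystem

variable {K V E : Type*} [MeasurableSpace K] [Fintype E] {𝓜 : MarkovSystem K V E}

theorem integrable_of_measurable_of_abs_le {X : Type*} [MeasurableSpace X] {ν : Measure X}
    [IsFiniteMeasure ν] {f : X → ℝ} (hf : Measurable f) {C : ℝ} (hC : ∀ x, |f x| ≤ C) :
    Integrable f ν :=
  Integrable.of_bound hf.aestronglyMeasurable C (ae_of_all _ hC)

theorem integral_wordOp_of_push_eq {ν : Measure K} (hν : 𝓜.push ν = ν) (n : ℕ) {f : K → ℝ}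
    (hf : Measurable f) (hf0 : ∀ x, 0 ≤ f x) :
    ∫ x, 𝓜.wordOp n f x ∂ν = ∫ x, f x ∂ν := by
  have hm : Measurable (𝓜.wordOp n f) := Finset.measurable_sum _ fun g _ =>
    (𝓜.measurable_wordProb _).mul (hf.comp (𝓜.measurable_wordMap _))
  have h0 : ∀ x, 0 ≤ 𝓜.wordOp n f x := fun x =>
    Finset.sum_nonneg fun g _ => mul_nonneg (𝓜.wordProb_nonneg _ _) (hf0 _)
  rw [integral_eq_lintegral_of_nonneg_ae (ae_of_all _ h0) hm.aestronglyMeasurable,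
    integral_eq_lintegral_of_nonneg_ae (ae_of_all _ hf0) hf.aestronglyMeasurable,
    𝓜.lintegral_wordOp_of_push_eq hν n hf hf0]

theorem integrable_wordProb (μ : Measure K) [IsFiniteMeasure μ] (l : List E) :
    Integrable (𝓜.wordProb l) μ :=
  integrable_of_measurable_of_abs_le (𝓜.measurable_wordProb l) (C := 1) fun x => by
    rw [abs_of_nonneg (𝓜.wordProb_nonneg l x)]
    exact 𝓜.wordProb_le_one l x

/-! ### Integrals of functions of finitely many letters. -/

section Window

variable [MeasurableSpace E] {μ : Measure K} {M : Measure (ℤ → E)}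

theorem IsGeneralizedMarkovMeasure.measureReal_cylinderAt
    (hM : 𝓜.IsGeneralizedMarkovMeasure μ M) (m : ℤ) (l : List E) :
    M.real (cylinderAt m l) = ∫ y, 𝓜.wordProb l y ∂μ := by
  rw [Measure.real, hM, integral_eq_lintegral_of_nonneg_ae
    (ae_of_all _ fun y => 𝓜.wordProb_nonneg l y)
    (𝓜.measurable_wordProb l).aestronglyMeasurable]

variable [DiscreteMeasurableSpace E]

theorem IsGeneralizedMarkovMeasure.lintegral_window
    (hM : 𝓜.IsGeneralizedMarkovMeasure μ M) (m : ℤ) (n : ℕ) (f : (Fin n → E) → ℝ≥0∞) :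
    ∫⁻ σ, f (window m n σ) ∂M =
      ∫⁻ y, ∑ g, ENNReal.ofReal (𝓜.wordProb (List.ofFn g) y) * f g ∂μ := by
  rw [_root_.lintegral_window, lintegral_finsetSum _ fun g _ =>
    (𝓜.measurable_wordProb _).ennreal_ofReal.mul_const _]
  refine Finset.sum_congr rfl fun g _ => ?_
  rw [lintegral_mul_const _ (𝓜.measurable_wordProb _).ennreal_ofReal, hM, mul_comm]

theorem IsGeneralizedMarkovMeasure.integral_window [IsProbabilityMeasure μ]
    (hM : 𝓜.IsGeneralizedMarkovMeasure μ M) (m : ℤ) (n : ℕ) (f : (Fin n → E) → ℝ) :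
    ∫ σ, f (window m n σ) ∂M = ∫ y, ∑ g, 𝓜.wordProb (List.ofFn g) y * f g ∂μ := by
  have := hM.isProbabilityMeasure
  rw [_root_.integral_window, integral_finsetSum _ fun g _ =>
    (integrable_wordProb μ _).mul_const _]
  refine Finset.sum_congr rfl fun g _ => ?_
  rw [integral_mul_const, hM.measureReal_cylinderAt]

theorem IsGeneralizedMarkovMeasure.ae_shiftBy [IsProbabilityMeasure μ]
    (hM : 𝓜.IsGeneralizedMarkovMeasure μ M) {s : Set (ℤ → E)} (hs : ∀ᵐ σ ∂M, σ ∈ s) :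
    ∀ᵐ σ ∂M, ∀ k : ℤ, shiftBy k σ ∈ s := by
  refine ae_all_iff.2 fun k => ?_
  have hmap : M.map (shiftBy k) = M := by
    refine IsGeneralizedMarkovMeasure.eq (𝓜 := 𝓜) (μ := μ) (fun m l => ?_) hM
    rw [Measure.map_apply (measurable_shiftBy k) (measurableSet_cylinderAt m l),
      preimage_shiftBy_cylinderAt, hM]
  rw [← hmap] at hs
  exact ae_of_ae_map (measurable_shiftBy k).aemeasurable hs

theorem IsGeneralizedMarkovMeasure.ae_mem_pathSpace
    (hM : 𝓜.IsGeneralizedMarkovMeasure μ M) : ∀ᵐ σ ∂M, σ ∈ 𝓜.pathSpace := by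
  classical
  refine (ae_all_iff (ι := ℤ)).2 fun j => ?_
  set f : (Fin 2 → E) → ℝ≥0∞ := fun g => if 𝓜.term (g 0) = 𝓜.init (g 1) then 0 else 1
  have h0 : ∫⁻ σ, f (window j 2 σ) ∂M = 0 := by
    rw [hM.lintegral_window]
    refine (lintegral_congr fun y => ?_).trans lintegral_zero
    refine Finset.sum_eq_zero fun g _ => ?_
    by_cases hg : 𝓜.term (g 0) = 𝓜.init (g 1)
    · simp [f, hg]
    · suffices h : 𝓜.wordProb (List.ofFn g) y = 0 by rw [h]; simp
      simp only [List.ofFn_succ, wordProb_cons, List.ofFn_zero]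
      by_cases hp : 𝓜.p (g 0) y = 0
      · simp [hp]
      have hy := 𝓜.w_mapsTo _ (𝓜.mem_cell_init_of_p_ne_zero hp)
      have := 𝓜.p_eq_zero (g 1) (𝓜.w (g 0) y) fun h => hg (𝓜.cell_unique hy h)
      simp [this]
  rw [lintegral_eq_zero_iff (measurable_of_window _ _ _)] at h0
  filter_upwards [h0] with σ hσ
  by_contra hne
  simp [f, window, hne] at hσ

end Window

/-! ### Convergence and law of the coding map. -/

section Coding

variable [MetricSpace K] [Fintype V]

/-- A word of positive probability at y starts at the cell of y, so its coded point starts from the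
base point of that cell and contraction applies. -/
theorem ContractsBy.sum_wordProb_mul_dist_wordPoint_le {a : ℝ} (ha : 𝓜.ContractsBy a)
    (ha0 : 0 ≤ a) {x : V → K} (hx : ∀ v, x v ∈ 𝓜.cell v) (n : ℕ) (y : K) :
    ∑ g : Fin (n + 1) → E, 𝓜.wordProb (List.ofFn g) y *
      dist (𝓜.wordMap (List.ofFn g) y) (𝓜.wordPoint x g) ≤ a ^ (n + 1) * 𝓜.height x y := by
  obtain ⟨v, hv⟩ := 𝓜.exists_mem_cell y
  rw [height_eq x hv]
  refine le_trans (Finset.sum_le_sum fun g _ => le_of_eq ?_)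
    (ha.sum_wordProb_mul_dist_le ha0 (n + 1) hv (hx v))
  by_cases hp : 𝓜.p (g 0) y = 0
  · simp [List.ofFn_succ, hp]
  · rw [wordPoint, 𝓜.cell_unique (𝓜.mem_cell_init_of_p_ne_zero hp) hv]

/-- Both coded points are compared with the true trajectory from y. Without its first letter e the
word starts from w_e y, whence the Markov operator in the bound. -/
theorem ContractsBy.sum_wordProb_mul_dist_wordPoint_tail_le {a : ℝ} (ha : 𝓜.ContractsBy a)
    (ha0 : 0 ≤ a) {x : V → K} (hx : ∀ v, x v ∈ 𝓜.cell v) (n : ℕ) (y : K) :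
    ∑ g : Fin (n + 2) → E, 𝓜.wordProb (List.ofFn g) y *
      dist (𝓜.wordPoint x (Fin.tail g)) (𝓜.wordPoint x g) ≤
      a ^ (n + 1) * 𝓜.markovOp (𝓜.height x) y + a ^ (n + 2) * 𝓜.height x y := by
  calc _ ≤ ∑ g : Fin (n + 2) → E, (𝓜.wordProb (List.ofFn g) y *
        dist (𝓜.wordMap (List.ofFn g) y) (𝓜.wordPoint x (Fin.tail g)) +
        𝓜.wordProb (List.ofFn g) y * dist (𝓜.wordMap (List.ofFn g) y) (𝓜.wordPoint x g)) := by
        refine Finset.sum_le_sum fun g _ => ?_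
        rw [← mul_add]
        refine mul_le_mul_of_nonneg_left ?_ (𝓜.wordProb_nonneg _ _)
        exact dist_triangle_left _ _ _
    _ ≤ _ := by
        rw [Finset.sum_add_distrib]
        refine add_le_add ?_ (ha.sum_wordProb_mul_dist_wordPoint_le ha0 hx (n + 1) y)
        rw [← (Fin.consEquiv fun _ => E).sum_comp, Fintype.sum_prod_type, markovOp,
          Finset.mul_sum]
        refine Finset.sum_le_sum fun e _ => ?_
        have := mul_le_mul_of_nonneg_left
          (ha.sum_wordProb_mul_dist_wordPoint_le ha0 hx n (𝓜.w e y)) (𝓜.p_nonneg e y)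
        rw [Finset.mul_sum] at this
        calc _ = ∑ g : Fin (n + 1) → E, 𝓜.p e y * (𝓜.wordProb (List.ofFn g) (𝓜.w e y) *
              dist (𝓜.wordMap (List.ofFn g) (𝓜.w e y)) (𝓜.wordPoint x g)) := by
              refine Finset.sum_congr rfl fun g _ => ?_
              simp only [Fin.consEquiv, Equiv.coe_fn_mk, Fin.tail_cons]
              rw [List.ofFn_succ (f := Fin.cons e g)]
              simp [mul_assoc]
          _ ≤ _ := this
          _ = _ := by ring

variable [BorelSpace K] [MeasurableSpace E] [DiscreteMeasurableSpace E]
  {μ : Measure K} {M : Measure (ℤ → E)}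

theorem IsGeneralizedMarkovMeasure.lintegral_edist_codingSeq_le {a : ℝ} (ha : 𝓜.ContractsBy a)
    (ha0 : 0 ≤ a) (hopen : ∀ v, IsOpen (𝓜.cell v)) {x : V → K} (hx : ∀ v, x v ∈ 𝓜.cell v)
    (hμ : 𝓜.push μ = μ) (hM : 𝓜.IsGeneralizedMarkovMeasure μ M) (n : ℕ) :
    ∫⁻ σ, edist (𝓜.codingSeq x σ n) (𝓜.codingSeq x σ (n + 1)) ∂M ≤
      (ENNReal.ofReal (a ^ (n + 1)) + ENNReal.ofReal (a ^ (n + 2))) *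
        ∫⁻ z, ENNReal.ofReal (𝓜.height x z) ∂μ := by
  have hhm := (continuous_height hopen x).measurable
  have htail : ∀ σ : ℤ → E,
      window (-n) (n + 1) σ = Fin.tail (window (-(n + 1 : ℕ)) (n + 2) σ) := fun σ => by
    funext j
    simp only [window, Fin.tail]
    congr 1
    rw [Fin.val_succ]
    push_cast
    ring
  calc _ = ∫⁻ σ, (fun g : Fin (n + 2) → E => edist (𝓜.wordPoint x (Fin.tail g))
        (𝓜.wordPoint x g)) (window (-(n + 1 : ℕ)) (n + 2) σ) ∂M := by
        refine lintegral_congr fun σ => ?_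
        simp only [codingSeq_eq_wordPoint, htail]
    _ = ∫⁻ y, ∑ g : Fin (n + 2) → E, ENNReal.ofReal (𝓜.wordProb (List.ofFn g) y) *
        edist (𝓜.wordPoint x (Fin.tail g)) (𝓜.wordPoint x g) ∂μ :=
        hM.lintegral_window (-(n + 1 : ℕ)) (n + 2) fun g => edist (𝓜.wordPoint x (Fin.tail g))
          (𝓜.wordPoint x g)
    _ ≤ ∫⁻ y, (ENNReal.ofReal (a ^ (n + 1)) * ENNReal.ofReal (𝓜.wordOp 1 (𝓜.height x) y) +
        ENNReal.ofReal (a ^ (n + 2)) * ENNReal.ofReal (𝓜.height x y)) ∂μ := by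
        refine lintegral_mono fun y => ?_
        have h1 := ENNReal.ofReal_le_ofReal
          (ha.sum_wordProb_mul_dist_wordPoint_tail_le ha0 hx n y)
        have h0 : 0 ≤ 𝓜.markovOp (𝓜.height x) y := Finset.sum_nonneg fun e _ =>
          mul_nonneg (𝓜.p_nonneg e y) (height_nonneg x _)
        have h2 : 𝓜.wordOp 1 (𝓜.height x) y = 𝓜.markovOp (𝓜.height x) y := by
          rw [wordOp_succ]
          simp [wordOp, markovOp]
        rw [ENNReal.ofReal_add (by positivity) (mul_nonneg (by positivity) (height_nonneg x y)),
          ENNReal.ofReal_mul (by positivity), ENNReal.ofReal_mul (by positivity),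
          ENNReal.ofReal_sum_of_nonneg fun g _ => mul_nonneg (𝓜.wordProb_nonneg _ _)
            dist_nonneg, ← h2] at h1
        refine le_trans (Finset.sum_le_sum fun g _ => ?_) h1
        rw [ENNReal.ofReal_mul (𝓜.wordProb_nonneg _ _), edist_dist]
    _ = _ := by
        rw [lintegral_add_right _ (hhm.ennreal_ofReal.const_mul _), lintegral_const_mul' _ _
          ENNReal.ofReal_ne_top, lintegral_const_mul' _ _ ENNReal.ofReal_ne_top,
          𝓜.lintegral_wordOp_of_push_eq hμ 1 hhm (height_nonneg x), add_mul]

variable [ProperSpace K]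

/-- The mean distances of successive terms form a geometric series, so almost every coding sequence
is Cauchy; shift invariance extends this to all shifts at once. -/
theorem IsGeneralizedMarkovMeasure.ae_mem_codingDomain [IsProbabilityMeasure μ]
    (hcontr : 𝓜.IsContractive) (hopen : ∀ v, IsOpen (𝓜.cell v)) {x : V → K}
    (hx : ∀ v, x v ∈ 𝓜.cell v) (hμ : 𝓜.push μ = μ)
    (hH : ∫⁻ z, ENNReal.ofReal (𝓜.height x z) ∂μ ≠ ⊤)
    (hM : 𝓜.IsGeneralizedMarkovMeasure μ M) : ∀ᵐ σ ∂M, σ ∈ 𝓜.codingDomain x := by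
  obtain ⟨a, ha0, ha1, ha⟩ := hcontr
  have ha : 𝓜.ContractsBy a := ha
  simp only [mem_codingDomain]
  refine hM.ae_shiftBy ?_
  have hm : ∀ n, Measurable fun σ => edist (𝓜.codingSeq x σ n) (𝓜.codingSeq x σ (n + 1)) :=
    fun n => (measurable_codingSeq x n).edist (measurable_codingSeq x (n + 1))
  have hsum : ∫⁻ σ, ∑' n, edist (𝓜.codingSeq x σ n) (𝓜.codingSeq x σ (n + 1)) ∂M ≠ ⊤ := by
    rw [lintegral_tsum fun n => (hm n).aemeasurable]
    refine ne_top_of_le_ne_top ?_ (ENNReal.tsum_le_tsum fun n =>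
      hM.lintegral_edist_codingSeq_le ha ha0.le hopen hx hμ n)
    rw [ENNReal.tsum_mul_right, ENNReal.tsum_add]
    have hgeom : ∀ k : ℕ, ∑' n : ℕ, ENNReal.ofReal (a ^ (n + k)) ≠ ⊤ := fun k => by
      rw [← ENNReal.ofReal_tsum_of_nonneg (fun n => by positivity)
        ((summable_nat_add_iff k).2 (summable_geometric_of_lt_one ha0.le ha1))]
      exact ENNReal.ofReal_ne_top
    exact ENNReal.mul_ne_top (ENNReal.add_ne_top.2 ⟨hgeom 1, hgeom 2⟩) hH
  filter_upwards [hM.ae_mem_pathSpace, ae_lt_top' (AEMeasurable.tsum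
    fun n => (hm n).aemeasurable) hsum] with σ hσ hlt
  exact ⟨hσ, cauchySeq_tendsto_of_complete
    (cauchySeq_of_edist_le_of_tsum_ne_top _ (fun n => le_rfl) hlt.ne)⟩

variable [Nonempty K]

/-- Under the generalized Markov measure, the letter at the place `1` is distributed according to
the probabilities at the value of the coding map, which has the law `μ`. -/
theorem IsGeneralizedMarkovMeasure.map_restrict_codingMap [IsProbabilityMeasure μ]
    (hcontr : 𝓜.IsContractive) (hopen : ∀ v, IsOpen (𝓜.cell v)) {x : V → K}
    (hx : ∀ v, x v ∈ 𝓜.cell v) (hμ : 𝓜.push μ = μ)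
    (hH : ∫⁻ z, ENNReal.ofReal (𝓜.height x z) ∂μ ≠ ⊤)
    (hM : 𝓜.IsGeneralizedMarkovMeasure μ M) (e : E) :
    (M.restrict {σ | σ 1 = e}).map (𝓜.codingMap x) =
      μ.withDensity fun y => ENNReal.ofReal (𝓜.p e y) := by
  classical
  have hprob := hM.isProbabilityMeasure
  have hY := hM.ae_mem_codingDomain hcontr hopen hx hμ hH
  obtain ⟨a, ha0, ha1, ha⟩ := hcontr
  have ha : 𝓜.ContractsBy a := ha
  have hhm := (continuous_height hopen x).measurable
  have hfin : IsFiniteMeasure (μ.withDensity fun y => ENNReal.ofReal (𝓜.p e y)) :=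
    isFiniteMeasure_withDensity_ofReal (integrable_of_measurable_of_abs_le (𝓜.p_measurable e)
      (C := 1) fun y => by
        rw [abs_of_nonneg (𝓜.p_nonneg e y)]; exact 𝓜.p_le_one e y).hasFiniteIntegral
  have hHi : Integrable (𝓜.height x) μ := by
    refine ⟨hhm.aestronglyMeasurable, ?_⟩
    rw [hasFiniteIntegral_iff_ofReal (ae_of_all _ (height_nonneg x))]
    exact hH.lt_top
  refine measure_ext_of_lipschitz fun f L hf hL hf0 hf1 hfL => ?_
  have hfm : Measurable f := hf.measurable
  rw [integral_map (measurable_codingMap x).aemeasurable hfm.aestronglyMeasurable,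
    integral_withDensity_eq_integral_toReal_smul (𝓜.measurable_ofReal_p e)
      (ae_of_all _ fun x => ENNReal.ofReal_lt_top)]
  simp only [ENNReal.toReal_ofReal (𝓜.p_nonneg e _), smul_eq_mul]
  have t1 : Tendsto (fun n => ∫ σ in {σ | σ 1 = e}, f (𝓜.codingSeq x σ n) ∂M) atTop
      (𝓝 (∫ σ in {σ | σ 1 = e}, f (𝓜.codingMap x σ) ∂M)) := by
    refine tendsto_integral_of_dominated_convergence (fun _ => 1)
      (fun n => (hfm.comp (measurable_codingSeq x n)).aestronglyMeasurable)
      (integrable_const _) (fun n => ae_of_all _ fun σ => ?_) ?_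
    · rw [Real.norm_eq_abs, abs_of_nonneg (hf0 _)]
      exact hf1 _
    · filter_upwards [ae_restrict_of_ae hY] with σ hσ
      exact (hf.tendsto _).comp
        (tendsto_codingSeq (mem_convergenceSet_of_mem_codingDomain hσ))
  -- The letter at place 1 is the last one of the window, so its probability is evaluated at the
  -- true endpoint of the trajectory. In `hB`, invariance writes the target integral in the same
  -- form with f at that endpoint, so only the Lipschitz continuity of f is needed.
  have hA : ∀ n, ∫ σ in {σ | σ 1 = e}, f (𝓜.codingSeq x σ n) ∂M =
      ∫ y, ∑ g : Fin (n + 1) → E, 𝓜.wordProb (List.ofFn g) y *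
        (𝓜.p e (𝓜.wordMap (List.ofFn g) y) * f (𝓜.wordPoint x g)) ∂μ := by
    intro n
    rw [← integral_indicator (measurableSet_eval 1 e)]
    calc _ = ∫ σ, (fun g : Fin (n + 2) → E => if g (Fin.last (n + 1)) = e then
          f (𝓜.wordPoint x (Fin.init g)) else 0) (window (-n) (n + 2) σ) ∂M := by
          refine integral_congr_ae (ae_of_all _ fun σ => ?_)
          have h1 : window (-n) (n + 2) σ (Fin.last (n + 1)) = σ 1 := by
            simp [window]
          simp only [h1, codingSeq_eq_wordPoint, Set.indicator_apply, Set.mem_ofPred_eq]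
          rfl
      _ = _ := by
          rw [hM.integral_window (-n) (n + 2) fun g => if g (Fin.last (n + 1)) = e then
            f (𝓜.wordPoint x (Fin.init g)) else 0]
          refine integral_congr_ae (ae_of_all _ fun y => ?_)
          simp only
          rw [← (Fin.snocEquiv fun _ => E).sum_comp, Fintype.sum_prod_type_right]
          refine Finset.sum_congr rfl fun g _ => ?_
          rw [Finset.sum_eq_single e]
          · simp only [Fin.snocEquiv, Equiv.coe_fn_mk, Fin.snoc_last, Fin.init_snoc, if_true]
            rw [List.ofFn_succ_last]
            simp [wordProb_append, mul_assoc]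
          · intro e' _ hne
            simp [Fin.snocEquiv, hne]
          · simp
  have hB : ∀ n, ∫ y, 𝓜.p e y * f y ∂μ =
      ∫ y, 𝓜.wordOp (n + 1) (fun y => 𝓜.p e y * f y) y ∂μ := fun n =>
    (integral_wordOp_of_push_eq hμ _ ((𝓜.p_measurable e).mul hfm) fun y =>
      mul_nonneg (𝓜.p_nonneg e y) (hf0 y)).symm
  have hpf1 : ∀ y z, |𝓜.p e y * f z| ≤ 1 := fun y z => by
    rw [abs_of_nonneg (mul_nonneg (𝓜.p_nonneg e y) (hf0 z))]
    exact mul_le_one₀ (𝓜.p_le_one e y) (hf0 z) (hf1 z)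
  have t2 : Tendsto (fun n => ∫ σ in {σ | σ 1 = e}, f (𝓜.codingSeq x σ n) ∂M -
      ∫ y, 𝓜.p e y * f y ∂μ) atTop (𝓝 0) := by
    have hlim : Tendsto (fun n : ℕ => L * (a ^ (n + 1) * ∫ y, 𝓜.height x y ∂μ)) atTop (𝓝 0) := by
      have := (((tendsto_pow_atTop_nhds_zero_of_lt_one ha0.le ha1).comp
        (tendsto_add_atTop_nat 1)).mul_const (∫ y, 𝓜.height x y ∂μ)).const_mul L
      simpa using this
    refine squeeze_zero_norm (fun n => ?_) hlim
    have hInt : ∀ {G : (Fin (n + 1) → E) → K → ℝ}, (∀ g, Measurable (G g)) →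
        (∀ g y, |G g y| ≤ 1) → Integrable (fun y => ∑ g : Fin (n + 1) → E,
          𝓜.wordProb (List.ofFn g) y * G g y) μ := fun hG hG1 => by
      refine integrable_finsetSum _ fun g _ => integrable_of_measurable_of_abs_le (C := 1)
        ((𝓜.measurable_wordProb _).mul (hG g)) fun y => ?_
      rw [abs_mul, abs_of_nonneg (𝓜.wordProb_nonneg _ _)]
      exact mul_le_one₀ (𝓜.wordProb_le_one _ _) (abs_nonneg _) (hG1 g y)
    rw [hA n, hB n]
    simp only [wordOp]
    rw [← integral_sub]
    · rw [← integral_const_mul, ← integral_const_mul]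
      refine norm_integral_le_of_norm_le ((hHi.const_mul _).const_mul _) (ae_of_all _ fun y => ?_)
      rw [← Finset.sum_sub_distrib, Real.norm_eq_abs]
      refine (Finset.abs_sum_le_sum_abs _ _).trans ?_
      refine le_trans ?_ (mul_le_mul_of_nonneg_left
        (ha.sum_wordProb_mul_dist_wordPoint_le ha0.le hx n y) hL)
      rw [Finset.mul_sum]
      refine Finset.sum_le_sum fun g _ => ?_
      rw [← mul_sub, ← mul_sub, abs_mul, abs_mul, abs_of_nonneg (𝓜.wordProb_nonneg _ _),
        abs_of_nonneg (𝓜.p_nonneg _ _), mul_left_comm L]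
      refine mul_le_mul_of_nonneg_left ?_ (𝓜.wordProb_nonneg _ _)
      refine (mul_le_of_le_one_left (abs_nonneg _) (𝓜.p_le_one _ _)).trans ?_
      rw [abs_sub_comm]
      exact hfL _ _
    · exact hInt (fun g => ((𝓜.p_measurable e).comp (𝓜.measurable_wordMap _)).mul_const _)
        fun g y => hpf1 _ _
    · exact hInt (G := fun g y => 𝓜.p e (𝓜.wordMap (List.ofFn g) y) *
          f (𝓜.wordMap (List.ofFn g) y))
        (fun g => ((𝓜.p_measurable e).comp (𝓜.measurable_wordMap _)).mul
          (hfm.comp (𝓜.measurable_wordMap _))) fun g y => hpf1 _ _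
  have := tendsto_nhds_unique t2 (t1.sub_const _)
  linarith

theorem IsGeneralizedMarkovMeasure.lintegral_letter_codingMap [IsProbabilityMeasure μ]
    (hcontr : 𝓜.IsContractive) (hopen : ∀ v, IsOpen (𝓜.cell v)) {x : V → K}
    (hx : ∀ v, x v ∈ 𝓜.cell v) (hμ : 𝓜.push μ = μ)
    (hH : ∫⁻ z, ENNReal.ofReal (𝓜.height x z) ∂μ ≠ ⊤)
    (hM : 𝓜.IsGeneralizedMarkovMeasure μ M) {f : E → K → ℝ≥0∞} (hf : ∀ e, Measurable (f e)) :
    ∫⁻ σ, f (σ 1) (𝓜.codingMap x σ) ∂M =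
      ∑ e, ∫⁻ y, ENNReal.ofReal (𝓜.p e y) * f e y ∂μ := by
  rw [← sum_setLIntegral_eval M 1]
  refine Finset.sum_congr rfl fun e _ => ?_
  calc _ = ∫⁻ σ in {σ | σ 1 = e}, f e (𝓜.codingMap x σ) ∂M := by
        refine setLIntegral_congr_fun (measurableSet_eval 1 e) fun σ hσ => ?_
        have hσ : σ 1 = e := hσ
        simp only [hσ]
    _ = ∫⁻ y, f e y ∂(M.restrict {σ | σ 1 = e}).map (𝓜.codingMap x) :=
        (lintegral_map (hf e) (measurable_codingMap x)).symm
    _ = _ := by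
        rw [hM.map_restrict_codingMap hcontr hopen hx hμ hH e,
          lintegral_withDensity_eq_lintegral_mul _ (𝓜.measurable_ofReal_p e) (hf e)]
        rfl

theorem IsGeneralizedMarkovMeasure.map_codingMap [IsProbabilityMeasure μ]
    (hcontr : 𝓜.IsContractive) (hopen : ∀ v, IsOpen (𝓜.cell v)) {x : V → K}
    (hx : ∀ v, x v ∈ 𝓜.cell v) (hμ : 𝓜.push μ = μ)
    (hH : ∫⁻ z, ENNReal.ofReal (𝓜.height x z) ∂μ ≠ ⊤)
    (hM : 𝓜.IsGeneralizedMarkovMeasure μ M) : M.map (𝓜.codingMap x) = μ := by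
  refine Measure.ext_of_lintegral _ fun f hf => ?_
  have hpf : ∀ e, Measurable fun y => ENNReal.ofReal (𝓜.p e y) * f y := fun e =>
    (𝓜.measurable_ofReal_p e).mul hf
  rw [lintegral_map hf (measurable_codingMap x),
    hM.lintegral_letter_codingMap hcontr hopen hx hμ hH (f := fun _ => f) fun _ => hf,
    ← lintegral_finsetSum _ fun e _ => hpf e]
  refine lintegral_congr fun y => ?_
  rw [← Finset.sum_mul, 𝓜.sum_ofReal_p, one_mul]

end Coding

end MarkovSystem

/-! ### Entropy of finite partitions -/

section Entropy

theorem negMulLog_le_add {P q : ℝ} (hP : 0 ≤ P) (hq : 0 ≤ q) (hPq : q = 0 → P = 0) :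
    Real.negMulLog P ≤ P * -Real.log q + (q - P) := by
  rcases hP.eq_or_lt with rfl | hP
  · simpa using hq
  have hq : 0 < q := lt_of_le_of_ne hq fun h => hP.ne' (hPq h.symm)
  have h1 := Real.log_le_sub_one_of_pos (div_pos hq hP)
  rw [Real.log_div hq.ne' hP.ne'] at h1
  have h2 := mul_le_mul_of_nonneg_left h1 hP.le
  rw [mul_sub, mul_sub, mul_div_cancel₀ _ hP.ne', mul_one] at h2
  rw [Real.negMulLog]
  linarith

/-- Gibbs' inequality. -/
theorem sum_negMulLog_le {ι : Type*} [Fintype ι] {P q : ι → ℝ} (hP : ∀ i, 0 ≤ P i)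
    (hq : ∀ i, 0 ≤ q i) (hPq : ∀ i, q i = 0 → P i = 0) (hsum : ∑ i, q i ≤ ∑ i, P i) :
    ∑ i, Real.negMulLog (P i) ≤ ∑ i, P i * -Real.log (q i) := by
  have := Finset.sum_le_sum fun i (_ : i ∈ Finset.univ) =>
    negMulLog_le_add (hP i) (hq i) (hPq i)
  rw [Finset.sum_add_distrib, Finset.sum_sub_distrib] at this
  linarith

theorem negMulLog_sum_le {ι : Type*} [Fintype ι] {P : ι → ℝ} (hP : ∀ i, 0 ≤ P i) :
    Real.negMulLog (∑ i, P i) ≤ ∑ i, Real.negMulLog (P i) := by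
  simp only [Real.negMulLog]
  rw [neg_mul, Finset.sum_mul, ← Finset.sum_neg_distrib]
  refine Finset.sum_le_sum fun i _ => ?_
  rw [neg_mul]
  refine neg_le_neg ?_
  rcases (hP i).eq_or_lt with h | h
  · simp [← h]
  · exact mul_le_mul_of_nonneg_left (Real.log_le_log h
      (Finset.single_le_sum (fun i _ => hP i) (Finset.mem_univ i))) (hP i)

theorem partitionEntropy_le_prodMk {X : Type*} [MeasurableSpace X] {μ : Measure X}
    [IsProbabilityMeasure μ] {ι κ : Type*} [Fintype ι] [Fintype κ] [MeasurableSpace κ]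
    [MeasurableSingletonClass κ] (ξ : X → ι) {η : X → κ} (hη : Measurable η) :
    partitionEntropy μ ξ ≤ partitionEntropy μ fun x => (ξ x, η x) := by
  rw [partitionEntropy, partitionEntropy, Fintype.sum_prod_type]
  refine Finset.sum_le_sum fun j _ => ?_
  have : μ.real (ξ ⁻¹' {j}) = ∑ i, μ.real ((fun x => (ξ x, η x)) ⁻¹' {(j, i)}) := by
    have h := sum_measureReal_preimage_singleton (μ := μ.restrict (ξ ⁻¹' {j}))
      (Finset.univ : Finset κ) (f := η) fun i _ => hη (measurableSet_singleton i)
    simp only [Finset.coe_univ, Set.preimage_univ, measureReal_restrict_apply_univ] at h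
    rw [← h]
    refine Finset.sum_congr rfl fun i _ => ?_
    rw [measureReal_restrict_apply (hη (measurableSet_singleton i))]
    congr 1
    ext x
    simp [and_comm]
  rw [this]
  exact negMulLog_sum_le fun i => measureReal_nonneg

variable {X : Type*} [MeasurableSpace X] {μ : Measure X} [IsProbabilityMeasure μ]
  {ι : Type*} [Fintype ι] [MeasurableSpace ι] [MeasurableSingletonClass ι]

theorem integral_comp_fintype {ξ : X → ι} (hξ : Measurable ξ) (f : ι → ℝ) :
    ∫ x, f (ξ x) ∂μ = ∑ j, μ.real (ξ ⁻¹' {j}) * f j := by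
  have : IsFiniteMeasure (μ.map ξ) := inferInstance
  rw [← integral_map hξ.aemeasurable (measurable_of_finite f).aestronglyMeasurable,
    integral_fintype .of_finite]
  exact Finset.sum_congr rfl fun j _ => by
    rw [map_measureReal_apply hξ (measurableSet_singleton _), smul_eq_mul]

theorem sum_measureReal_preimage {ξ : X → ι} (hξ : Measurable ξ) :
    ∑ j, μ.real (ξ ⁻¹' {j}) = 1 := by
  simpa using (integral_comp_fintype (μ := μ) hξ fun _ => 1).symm

/-- If the coordinates of `ζ` are predicted from `A` up to an error of probability at most `θ`,
then the entropy of `ζ` exceeds that of `A` by little. -/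
theorem partitionEntropy_le_of_predicts {n k : ℕ} (hk : 0 < k) {ζ : X → Fin n → Fin k}
    (hζ : Measurable ζ) {A : X → ι} (hA : Measurable A) (φ : Fin n → ι → Fin k) {ε θ : ℝ}
    (hε0 : 0 < ε) (hε1 : ε < 1) (hθ : ∀ j, μ.real {x | ζ x j ≠ φ j (A x)} ≤ θ) :
    partitionEntropy μ ζ ≤
      partitionEntropy μ A + n * (-Real.log (1 - ε) + θ * -Real.log (ε / k)) := by
  classical
  have hk' : (0 : ℝ) < k := by exact_mod_cast hk
  have hk1 : (1 : ℝ) ≤ k := by exact_mod_cast hk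
  have hεk : 0 < ε / k := by positivity
  have hεk1 : ε / k ≤ 1 := (div_le_one hk').2 (hε1.le.trans hk1)
  -- The predicted value is believed with weight 1 - ε, and ε is spread uniformly. A right
  -- prediction then costs at most -log(1 - ε), and a wrong one at most -log(ε/k) more.
  set Q : Fin k → Fin k → ℝ := fun i s => (if s = i then 1 - ε else 0) + ε / k
  have hQpos : ∀ i s, 0 < Q i s := fun i s => by
    simp only [Q]
    split_ifs <;> linarith
  have hQsum : ∀ i, ∑ s, Q i s = 1 := fun i => by
    simp only [Q, Finset.sum_add_distrib, Finset.sum_ite_eq', Finset.mem_univ, if_true,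
      Finset.sum_const, Finset.card_univ, Fintype.card_fin, nsmul_eq_mul]
    field_simp
    ring
  have hQlog : ∀ i s, -Real.log (Q i s) ≤
      -Real.log (1 - ε) + (if s ≠ i then -Real.log (ε / k) else 0) := fun i s => by
    have h1 : 0 ≤ -Real.log (1 - ε) := neg_nonneg.2 (Real.log_nonpos (by linarith) (by linarith))
    by_cases hs : s = i
    · simp only [Q, hs, if_true, ne_eq, not_true_eq_false, if_false, add_zero]
      exact neg_le_neg (Real.log_le_log (by linarith) (by linarith))
    · simp only [Q, hs, if_false, zero_add, ne_eq, not_false_eq_true, if_true]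
      linarith
  refine (partitionEntropy_le_prodMk ζ hA).trans ?_
  have hζA : Measurable fun x => (ζ x, A x) := hζ.prodMk hA
  set P : (Fin n → Fin k) × ι → ℝ := fun r => μ.real ((fun x => (ζ x, A x)) ⁻¹' {r})
  -- Reference distribution for Gibbs' inequality: the law of A followed by independent guesses of
  -- the coordinates.
  set q : (Fin n → Fin k) × ι → ℝ := fun r =>
    μ.real (A ⁻¹' {r.2}) * ∏ j, Q (φ j r.2) (r.1 j)
  have hPle : ∀ r, P r ≤ μ.real (A ⁻¹' {r.2}) := fun r =>
    measureReal_mono fun x hx => by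
      have : (ζ x, A x) = r := hx
      simp [← this]
  have hprod : ∀ r : (Fin n → Fin k) × ι, 0 < ∏ j, Q (φ j r.2) (r.1 j) := fun r =>
    Finset.prod_pos fun j _ => hQpos _ _
  have hqsum : ∑ r, q r = 1 := by
    rw [Fintype.sum_prod_type_right, ← sum_measureReal_preimage (μ := μ) hA]
    refine Finset.sum_congr rfl fun g _ => ?_
    simp only [q, ← Finset.mul_sum]
    have : ∑ s : Fin n → Fin k, ∏ j, Q (φ j g) (s j) = 1 := by
      have h := Finset.prod_univ_sum (fun _ : Fin n => (Finset.univ : Finset (Fin k)))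
        fun j s => Q (φ j g) s
      rw [Fintype.piFinset_univ] at h
      rw [← h]
      exact Finset.prod_eq_one fun j _ => hQsum _
    rw [this, mul_one]
  have hgibbs := sum_negMulLog_le (P := P) (q := q) (fun r => measureReal_nonneg)
    (fun r => mul_nonneg measureReal_nonneg (hprod r).le)
    (fun r hr => le_antisymm ((hPle r).trans
      ((mul_eq_zero.1 hr).resolve_right (hprod r).ne').le) measureReal_nonneg)
    (by rw [hqsum, sum_measureReal_preimage hζA])
  refine hgibbs.trans ?_
  have hlog : ∀ r, P r * -Real.log (q r) = P r * (-Real.log (μ.real (A ⁻¹' {r.2})) +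
      ∑ j, -Real.log (Q (φ j r.2) (r.1 j))) := fun r => by
    by_cases hr : μ.real (A ⁻¹' {r.2}) = 0
    · have : P r = 0 := le_antisymm (hr ▸ hPle r) measureReal_nonneg
      simp [this]
    · simp only [q]
      rw [Real.log_mul hr (hprod r).ne', Real.log_prod fun j _ => (hQpos _ _).ne',
        Finset.sum_neg_distrib, neg_add]
  have hbdd : ∀ {γ : Type _} [Fintype γ] (f : γ → ℝ), ∃ C, ∀ i, |f i| ≤ C := fun f =>
    ⟨∑ i, |f i|, fun i => Finset.single_le_sum (f := fun i => |f i|)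
      (fun i _ => abs_nonneg _) (Finset.mem_univ i)⟩
  have hInt : ∀ f : (Fin n → Fin k) × ι → ℝ, Integrable (fun x => f (ζ x, A x)) μ := fun f => by
    obtain ⟨C, hC⟩ := hbdd f
    exact Integrable.of_bound ((measurable_of_finite f).comp hζA).aestronglyMeasurable C
      (ae_of_all _ fun x => hC _)
  rw [Finset.sum_congr rfl fun r _ => hlog r, ← integral_comp_fintype hζA,
    integral_add (hInt fun r => -Real.log (μ.real (A ⁻¹' {r.2})))
      (hInt fun r => ∑ j, -Real.log (Q (φ j r.2) (r.1 j)))]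
  refine add_le_add (le_of_eq ?_) ?_
  · rw [integral_comp_fintype hA fun g => -Real.log (μ.real (A ⁻¹' {g})), partitionEntropy]
    exact Finset.sum_congr rfl fun g _ => by rw [Real.negMulLog]; ring
  · rw [integral_finsetSum _ fun j _ => hInt fun r => -Real.log (Q (φ j r.2) (r.1 j))]
    have hj : ∀ j : Fin n, ∫ x, -Real.log (Q (φ j (A x)) (ζ x j)) ∂μ ≤
        -Real.log (1 - ε) + θ * -Real.log (ε / k) := by
      intro j
      have hm : MeasurableSet {x | ζ x j ≠ φ j (A x)} :=
        hζA (Set.toFinite {r : (Fin n → Fin k) × ι | r.1 j ≠ φ j r.2}).measurableSet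
      calc _ ≤ ∫ x, (-Real.log (1 - ε) +
            {x | ζ x j ≠ φ j (A x)}.indicator (fun _ => -Real.log (ε / k)) x) ∂μ := by
            refine integral_mono (hInt fun r => -Real.log (Q (φ j r.2) (r.1 j)))
              ((integrable_const _).add ((integrable_const _).indicator hm)) fun x => ?_
            have := hQlog (φ j (A x)) (ζ x j)
            simpa [Set.indicator_apply] using this
        _ = -Real.log (1 - ε) + μ.real {x | ζ x j ≠ φ j (A x)} * -Real.log (ε / k) := by
            rw [integral_add (integrable_const _) ((integrable_const _).indicator hm),
              integral_indicator_const _ hm]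
            simp
        _ ≤ _ := by
            gcongr
            · exact neg_nonneg.2 (Real.log_nonpos hεk.le hεk1)
            · exact hθ j
    calc _ ≤ ∑ j : Fin n, (-Real.log (1 - ε) + θ * -Real.log (ε / k)) :=
          Finset.sum_le_sum fun j _ => hj j
      _ = _ := by
          rw [Finset.sum_const, Finset.card_univ, Fintype.card_fin, nsmul_eq_mul]

end Entropy

/-! ### Entropy of the shift -/

/-- Finite measurable partitions are approximated by partitions into cylinders. -/
theorem exists_window_approx {E : Type*} [MeasurableSpace E] {Λ : Measure (ℤ → E)}
    [IsFiniteMeasure Λ] {k : ℕ} (hk : 0 < k) {ξ : (ℤ → E) → Fin k}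
    (hξ : Measurable ξ) {θ : ℝ} (hθ : 0 < θ) :
    ∃ (m : ℕ) (φ : (Fin (2 * m + 1) → E) → Fin k),
      Λ.real {σ | ξ σ ≠ φ (window (-m) (2 * m + 1) σ)} ≤ θ := by
  classical
  -- Cylinder sets form an algebra generating the σ-algebra, so each level set of ξ is approximated
  -- by one in measure.
  have hdense := Measure.MeasureDense.of_generateFrom_isSetAlgebra_finite Λ
    (isSetAlgebra_measurableCylinders (α := fun _ : ℤ => E)) generateFrom_measurableCylinders.symm
  have hk' : (0 : ℝ) < k := by exact_mod_cast hk
  choose t ht htlt using fun j : Fin k => hdense.approx (ξ ⁻¹' {j})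
    (hξ (measurableSet_singleton j)) (measure_ne_top _ _) (θ / k) (by positivity)
  choose n S hS using fun j => exists_window_of_mem_measurableCylinders (ht j)
  obtain ⟨m, hm⟩ : ∃ m, ∀ j, n j ≤ m := ⟨∑ j, n j, fun j =>
    Finset.single_le_sum (f := n) (fun _ _ => Nat.zero_le _) (Finset.mem_univ j)⟩
  set ρ : ∀ j, (Fin (2 * m + 1) → E) → Fin (2 * n j + 1) → E := fun j g i =>
    g ⟨i + (m - n j), by have := i.2; have := hm j; omega⟩
  have hρ : ∀ j σ, ρ j (window (-m) (2 * m + 1) σ) = window (-(n j)) (2 * n j + 1) σ := by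
    intro j σ
    funext i
    simp only [ρ, window]
    congr 1
    have := hm j
    push_cast [Nat.cast_sub this]
    ring
  -- Off the symmetric differences exactly one j qualifies, namely ξ σ; elsewhere the choice,
  -- including the default 0, is immaterial.
  set φ : (Fin (2 * m + 1) → E) → Fin k := fun g =>
    if h : ∃ j, ρ j g ∈ S j then h.choose else ⟨0, hk⟩
  refine ⟨m, φ, ?_⟩
  have hsub : {σ | ξ σ ≠ φ (window (-m) (2 * m + 1) σ)} ⊆
      ⋃ j, symmDiff (ξ ⁻¹' {j}) (t j) := by
    intro σ hσ
    by_contra hcon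
    simp only [Set.mem_iUnion, not_exists] at hcon
    have hiff : ∀ j, ξ σ = j ↔ ρ j (window (-m) (2 * m + 1) σ) ∈ S j := fun j => by
      have h1 : σ ∈ ξ ⁻¹' {j} ↔ σ ∈ t j := by
        have := hcon j
        rw [Set.mem_symmDiff] at this
        tauto
      rw [hρ, ← Set.mem_preimage, ← hS j]
      simpa using h1
    have hex : ∃ j, ρ j (window (-m) (2 * m + 1) σ) ∈ S j := ⟨ξ σ, (hiff _).1 rfl⟩
    refine hσ ?_
    simp only [φ, hex, dite_true]
    exact (hiff _).2 hex.choose_spec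
  calc Λ.real {σ | ξ σ ≠ φ (window (-m) (2 * m + 1) σ)}
      ≤ Λ.real (⋃ j, symmDiff (ξ ⁻¹' {j}) (t j)) := measureReal_mono hsub
    _ ≤ ∑ j, Λ.real (symmDiff (ξ ⁻¹' {j}) (t j)) := measureReal_iUnion_fintype_le _
    _ ≤ ∑ j : Fin k, θ / k := Finset.sum_le_sum fun j _ =>
        ENNReal.toReal_le_of_le_ofReal (by positivity) (htlt j).le
    _ = θ := by
        rw [Finset.sum_const, Finset.card_univ, Fintype.card_fin, nsmul_eq_mul]
        field_simp

section ShiftEntropy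

variable {E : Type*} [Fintype E] [MeasurableSpace E]

/-- The entropy of the distribution of the words of length `n`. -/
noncomputable def blockEntropy (Λ : Measure (ℤ → E)) (n : ℕ) : ℝ :=
  ∑ g : Fin n → E, Real.negMulLog (Λ.real (cylinderAt 1 (List.ofFn g)))

variable {Λ : Measure (ℤ → E)}

theorem IsInvariantProb.iterate {X : Type*} [MeasurableSpace X] {T : X → X} {Θ : Measure X}
    (h : IsInvariantProb T Θ) (n : ℕ) : MeasurePreserving T^[n] Θ Θ :=
  h.2.iterate n

variable [DiscreteMeasurableSpace E]

theorem IsInvariantProb.measure_cylinderAt_add_one (h : IsInvariantProb leftShift Λ) (m : ℤ)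
    (l : List E) : Λ (cylinderAt (m + 1) l) = Λ (cylinderAt m l) := by
  rw [← preimage_shiftBy_cylinderAt]
  exact h.2.measure_preimage (measurableSet_cylinderAt m l).nullMeasurableSet

theorem IsInvariantProb.measure_cylinderAt (h : IsInvariantProb leftShift Λ) (m m' : ℤ)
    (l : List E) : Λ (cylinderAt m l) = Λ (cylinderAt m' l) := by
  suffices h0 : ∀ m : ℤ, Λ (cylinderAt m l) = Λ (cylinderAt 0 l) by rw [h0 m, h0 m']
  intro m
  induction m using Int.induction_on with
  | zero => rfl
  | succ i ih => rw [h.measure_cylinderAt_add_one, ih]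
  | pred i ih => rw [← ih, ← h.measure_cylinderAt_add_one, sub_add_cancel]

theorem IsInvariantProb.partitionEntropy_window (h : IsInvariantProb leftShift Λ) (m : ℤ) (n : ℕ) :
    partitionEntropy Λ (window m n) = blockEntropy Λ n := by
  refine Finset.sum_congr rfl fun g _ => ?_
  rw [← cylinderAt_ofFn, Measure.real, Measure.real, h.measure_cylinderAt m 1]

/-- The letters from place -m to n + m - 1 contain the windows of radius m around all times 0, …, n
- 1, so one block predicts each coordinate of the itinerary; by invariance every error has the same
probability. -/
theorem IsInvariantProb.partitionEntropy_itinerary_le (h : IsInvariantProb leftShift Λ) {k : ℕ}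
    (hk : 0 < k) {ξ : (ℤ → E) → Fin k} (hξ : Measurable ξ) {ε θ : ℝ} (hε0 : 0 < ε) (hε1 : ε < 1)
    {m : ℕ} {φ : (Fin (2 * m + 1) → E) → Fin k}
    (hφ : Λ.real {σ | ξ σ ≠ φ (window (-m) (2 * m + 1) σ)} ≤ θ) (n : ℕ) :
    partitionEntropy Λ (itinerary leftShift ξ n) ≤
      blockEntropy Λ (n + 2 * m) + n * (-Real.log (1 - ε) + θ * -Real.log (ε / k)) := by
  have := h.1
  rw [← h.partitionEntropy_window (-m)]
  have hit : Measurable (itinerary leftShift ξ n) :=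
    measurable_pi_lambda _ fun j => hξ.comp (h.iterate j).measurable
  refine partitionEntropy_le_of_predicts hk hit (measurable_window _ _)
    (fun j g => φ fun i => g ⟨j + i, by omega⟩) hε0 hε1 fun j => ?_
  refine le_trans (le_of_eq ?_) hφ
  have hm : MeasurableSet {σ | ξ σ ≠ φ (window (-m) (2 * m + 1) σ)} :=
    (measurableSet_eq_fun hξ (measurable_of_window _ _ φ)).compl
  have hpre := (h.iterate j).measureReal_preimage hm.nullMeasurableSet
  rw [← hpre]
  congr 1
  ext σ
  simp only [Set.mem_ofPred_eq, Set.mem_preimage, itinerary, iterate_leftShift]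
  suffices hw : (fun i : Fin (2 * m + 1) => window (-m) (n + 2 * m) σ ⟨j + i, by omega⟩) =
      window (-m) (2 * m + 1) (shiftBy (j : ℕ) σ) by rw [hw]
  funext i
  simp only [window, shiftBy]
  congr 1
  push_cast
  ring

/-- The partition according to one letter is a generator. -/
theorem IsInvariantProb.ksEntropy_le (h : IsInvariantProb leftShift Λ) {r : ℝ}
    (hr : ∀ᶠ n : ℕ in atTop, blockEntropy Λ n ≤ n * r) : ksEntropy leftShift Λ ≤ r := by
  have := h.1
  refine iSup_le fun k => iSup_le fun ξ => iSup_le fun hξ => ?_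
  have hk : 0 < k := by
    obtain ⟨σ⟩ : Nonempty (ℤ → E) := nonempty_of_isProbabilityMeasure Λ
    exact Fin.pos (ξ σ)
  have hk' : (0 : ℝ) < k := by exact_mod_cast hk
  rw [← EReal.le_of_forall_lt_iff_le]
  intro s hs
  have hs : r < s := by exact_mod_cast hs
  -- The slack covers four terms: -log(1 - ε), the prediction errors, and the 2m extra letters each
  -- use at most d per step.
  set d := (s - r) / 4
  have hd : 0 < d := by simp only [d]; linarith
  obtain ⟨ε, ⟨hε0, hε1⟩, hεd⟩ : ∃ ε : ℝ, (0 < ε ∧ ε < 1) ∧ -Real.log (1 - ε) ≤ d := by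
    refine ⟨1 - Real.exp (-d), ⟨?_, ?_⟩, ?_⟩
    · have : Real.exp (-d) < 1 := Real.exp_lt_one_iff.2 (by linarith)
      linarith
    · linarith [Real.exp_pos (-d)]
    · simp
  set ℓ := -Real.log (ε / k)
  have hℓ : 0 ≤ ℓ := neg_nonneg.2 (Real.log_nonpos (by positivity)
    ((div_le_one hk').2 (hε1.le.trans (by exact_mod_cast hk))))
  -- With error probability d/(ℓ + 1) the cost of wrong predictions is at most d; the added 1 keeps
  -- the quotient meaningful when ℓ = 0.
  obtain ⟨m, φ, hφ⟩ := exists_window_approx (Λ := Λ) hk hξ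
    (show 0 < d / (ℓ + 1) by positivity)
  have hc : -Real.log (1 - ε) + d / (ℓ + 1) * ℓ ≤ 2 * d := by
    have : d / (ℓ + 1) * ℓ ≤ d := by
      rw [div_mul_eq_mul_div, div_le_iff₀ (by positivity)]
      nlinarith
    linarith
  refine limsup_le_of_le (by isBoundedDefault) ?_
  have hlarge : ∀ᶠ n : ℕ in atTop, 2 * m * r ≤ n * d :=
    ((tendsto_natCast_atTop_atTop (R := ℝ)).atTop_mul_const hd).eventually_ge_atTop _
  have hr' : ∀ᶠ n : ℕ in atTop, blockEntropy Λ (n + 2 * m) ≤ (n + 2 * m : ℕ) * r :=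
    (tendsto_add_atTop_nat (2 * m)).eventually hr
  filter_upwards [hlarge, hr', eventually_gt_atTop 0] with n h1 h2 h3
  have h3 : (0 : ℝ) < n := by exact_mod_cast h3
  rw [EReal.coe_le_coe_iff, div_le_iff₀ h3]
  have h4 := h.partitionEntropy_itinerary_le hk hξ hε0 hε1 hφ n
  have h5 := mul_le_mul_of_nonneg_left hc h3.le
  push_cast at h2
  have h6 : s = r + 4 * d := by simp only [d]; ring
  rw [h6]
  nlinarith

/-- The partition by the letter at place 0, relabelled by `Fin`, has the block entropies as its
joined entropies. -/
theorem IsInvariantProb.le_ksEntropy (h : IsInvariantProb leftShift Λ) {r : ℝ}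
    (hr : ∀ n : ℕ, n * r ≤ blockEntropy Λ n) : (r : EReal) ≤ ksEntropy leftShift Λ := by
  set c : E ≃ Fin (Fintype.card E) := Fintype.equivFin E
  set ξ : (ℤ → E) → Fin (Fintype.card E) := fun σ => c (σ 0)
  have hξ : Measurable ξ := (measurable_of_finite c).comp (measurable_pi_apply 0)
  refine le_trans ?_ (le_iSup_of_le (Fintype.card E) (le_iSup_of_le ξ (le_iSup_of_le hξ le_rfl)))
  refine le_limsup_of_frequently_le (Eventually.frequently ?_) (by isBoundedDefault)
  filter_upwards [eventually_gt_atTop 0] with n hn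
  have hn : (0 : ℝ) < n := by exact_mod_cast hn
  rw [EReal.coe_le_coe_iff, le_div_iff₀ hn, mul_comm]
  refine (hr n).trans (le_of_eq ?_)
  rw [← h.partitionEntropy_window 0, partitionEntropy, partitionEntropy]
  rw [← (Equiv.arrowCongr (Equiv.refl (Fin n)) c).sum_comp]
  refine Finset.sum_congr rfl fun g _ => ?_
  congr 2
  ext σ
  simp only [Set.mem_preimage, Set.mem_singleton_iff, ξ]
  rw [funext_iff, funext_iff]
  refine forall_congr' fun j => ?_
  simp [window, shiftBy, Equiv.arrowCongr, itinerary, iterate_leftShift]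

end ShiftEntropy

/-! ### The variational principle -/

section Real

theorem eventually_le_mul_of_sub_le {u : ℕ → ℝ} {r s : ℝ} (hrs : s < r)
    (h : ∀ᶠ n in atTop, u (n + 1) - u n ≤ s) : ∀ᶠ n : ℕ in atTop, u n ≤ n * r := by
  obtain ⟨N, hN⟩ := eventually_atTop.1 h
  have hle : ∀ d : ℕ, u (N + d) ≤ u N + d * s := by
    intro d
    induction d with
    | zero => simp
    | succ d ih =>
      have := hN (N + d) (Nat.le_add_right _ _)
      push_cast
      rw [← add_assoc]
      linarith
  have hlarge : ∀ᶠ n : ℕ in atTop, u N - N * s ≤ n * (r - s) :=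
    ((tendsto_natCast_atTop_atTop (R := ℝ)).atTop_mul_const (sub_pos.2 hrs)).eventually_ge_atTop _
  filter_upwards [hlarge, eventually_ge_atTop N] with n h1 h2
  obtain ⟨d, rfl⟩ := Nat.exists_eq_add_of_le h2
  have := hle d
  push_cast at h1 ⊢
  linarith

/-- Sharpened Gibbs inequality: applying log t ≤ t - 1 to √B/√A, twice, instead of to B/A leaves a
squared Hellinger term. -/
theorem negMulLog_add_mul_log_le {A B : ℝ} (hA : 0 ≤ A) (hB : 0 ≤ B) (hAB : B = 0 → A = 0) :
    Real.negMulLog A + A * Real.log B ≤ B - A - (√A - √B) ^ 2 := by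
  rcases hA.eq_or_lt with rfl | hA
  · simp [Real.sq_sqrt hB]
  have hB : 0 < B := lt_of_le_of_ne hB fun h => hA.ne' (hAB h.symm)
  have h1 := Real.log_le_sub_one_of_pos (div_pos (Real.sqrt_pos.2 hB) (Real.sqrt_pos.2 hA))
  rw [Real.log_div (Real.sqrt_pos.2 hB).ne' (Real.sqrt_pos.2 hA).ne', Real.log_sqrt hA.le,
    Real.log_sqrt hB.le] at h1
  have h2 := mul_le_mul_of_nonneg_left h1 hA.le
  have h3 : A * (√B / √A - 1) = √A * √B - A := by
    have : √A ≠ 0 := (Real.sqrt_pos.2 hA).ne'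
    rw [mul_sub, mul_one]
    congr 1
    rw [mul_div_assoc', div_eq_iff this]
    nth_rewrite 1 [← Real.mul_self_sqrt hA.le]
    ring
  rw [h3] at h2
  have h4 : (√A - √B) ^ 2 = A + B - 2 * (√A * √B) := by
    rw [sub_sq, Real.sq_sqrt hA.le, Real.sq_sqrt hB.le]
    ring
  rw [Real.negMulLog, h4]
  linarith

/-- Cauchy–Schwarz for |A - B| = |√A - √B| (√A + √B). -/
theorem sq_sum_abs_sub_le {ι : Type*} [Fintype ι] {A B : ι → ℝ} (hA : ∀ i, 0 ≤ A i)
    (hB : ∀ i, 0 ≤ B i) (hA1 : ∑ i, A i = 1) (hB1 : ∑ i, B i = 1) :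
    (∑ i, |A i - B i|) ^ 2 ≤ 4 * ∑ i, (√(A i) - √(B i)) ^ 2 := by
  have h1 : ∀ i, |A i - B i| = |√(A i) - √(B i)| * (√(A i) + √(B i)) := fun i => by
    rw [← abs_of_nonneg (add_nonneg (Real.sqrt_nonneg (A i)) (Real.sqrt_nonneg (B i))), ← abs_mul]
    congr 1
    nlinarith [Real.mul_self_sqrt (hA i), Real.mul_self_sqrt (hB i)]
  simp only [h1]
  refine (Finset.sum_mul_sq_le_sq_mul_sq _ _ _).trans ?_
  simp only [sq_abs]
  rw [mul_comm]
  refine mul_le_mul_of_nonneg_right ?_ (Finset.sum_nonneg fun i _ => sq_nonneg _)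
  calc ∑ i, (√(A i) + √(B i)) ^ 2 ≤ ∑ i, (2 * A i + 2 * B i) := by
        refine Finset.sum_le_sum fun i _ => ?_
        nlinarith [Real.mul_self_sqrt (hA i), Real.mul_self_sqrt (hB i),
          sq_nonneg (√(A i) - √(B i))]
    _ = 4 := by
        rw [Finset.sum_add_distrib, ← Finset.mul_sum, ← Finset.mul_sum, hA1, hB1]
        norm_num

end Real

theorem cylinderAt_ofFn_append {E : Type*} (k : ℕ) (g : Fin (k + 1) → E) (e : E) :
    cylinderAt (-k) (List.ofFn g ++ [e]) = cylinderAt (-k) (List.ofFn g) ∩ {σ | σ 1 = e} := by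
  rw [cylinderAt_append_singleton, List.length_ofFn]
  congr 3
  push_cast
  simp

namespace MarkovSystem

variable {K V E : Type*} [MeasurableSpace K] [Fintype E] {𝓜 : MarkovSystem K V E}

theorem exists_neg_log_p_le
    (hpos : ∀ e, ∃ δ : ℝ, 0 < δ ∧ ∀ y ∈ 𝓜.cell (𝓜.init e), δ ≤ 𝓜.p e y) :
    ∃ B : ℝ, ∀ e, ∀ y ∈ 𝓜.cell (𝓜.init e), -Real.log (𝓜.p e y) ≤ B := by
  choose δ hδ0 hδ using hpos
  refine ⟨∑ e, |Real.log (δ e)|, fun e y hy => ?_⟩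
  refine (neg_le_neg (Real.log_le_log (hδ0 e) (hδ e y hy))).trans ((neg_le_abs _).trans ?_)
  exact Finset.single_le_sum (f := fun e => |Real.log (δ e)|) (fun e _ => abs_nonneg _)
    (Finset.mem_univ e)

theorem p_pos (hpos : ∀ e, ∃ δ : ℝ, 0 < δ ∧ ∀ y ∈ 𝓜.cell (𝓜.init e), δ ≤ 𝓜.p e y) {e : E}
    {y : K} (hy : y ∈ 𝓜.cell (𝓜.init e)) : 0 < 𝓜.p e y := by
  obtain ⟨δ, hδ0, hδ⟩ := hpos e
  exact hδ0.trans_le (hδ y hy)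

variable [MeasurableSpace E] {Λ : Measure (ℤ → E)}

variable (𝓜 Λ) in
/-- The mean of minus the logarithm of the probability of the next letter, computed from `k + 1`
letters of the past. -/
noncomputable def meanRate (x : V → K) (k : ℕ) : ℝ :=
  ∫ σ, -Real.log (𝓜.p (σ 1) (𝓜.codingSeq x σ k)) ∂Λ

/-! ### Limits as the remembered past grows. -/

section Limit

variable [MetricSpace K] [Nonempty K] [DiscreteMeasurableSpace E] {x : V → K}

theorem integrable_rate [ProperSpace K] [BorelSpace K] [IsFiniteMeasure Λ] (hopen : ∀ v, IsOpen (𝓜.cell v))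
    (hpos : ∀ e, ∃ δ : ℝ, 0 < δ ∧ ∀ y ∈ 𝓜.cell (𝓜.init e), δ ≤ 𝓜.p e y)
    (hx : ∀ v, x v ∈ 𝓜.cell v) (hY : ∀ᵐ σ ∂Λ, σ ∈ 𝓜.codingDomain x) :
    Integrable (𝓜.rate x) Λ := by
  obtain ⟨B, hB⟩ := exists_neg_log_p_le hpos
  refine Integrable.of_bound (measurable_rate x).aestronglyMeasurable B ?_
  filter_upwards [hY] with σ hσ
  rw [Real.norm_eq_abs, rate, abs_of_nonneg (𝓜.neg_log_p_nonneg _ _)]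
  exact hB _ _ (codingMap_mem_cell hopen hx (mem_convergenceSet_of_mem_codingDomain hσ))

theorem tendsto_meanRate [IsFiniteMeasure Λ] (hopen : ∀ v, IsOpen (𝓜.cell v))
    (hdini : ∀ e, DiniContinuousOn (𝓜.p e) (𝓜.cell (𝓜.init e)))
    (hpos : ∀ e, ∃ δ : ℝ, 0 < δ ∧ ∀ y ∈ 𝓜.cell (𝓜.init e), δ ≤ 𝓜.p e y)
    (hx : ∀ v, x v ∈ 𝓜.cell v) (hY : ∀ᵐ σ ∂Λ, σ ∈ 𝓜.codingDomain x) :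
    Tendsto (𝓜.meanRate Λ x) atTop (𝓝 (∫ σ, 𝓜.rate x σ ∂Λ)) := by
  obtain ⟨B, hB⟩ := exists_neg_log_p_le hpos
  refine tendsto_integral_of_dominated_convergence (fun _ => B)
    (fun n => (measurable_letter_comp 𝓜.measurable_log_p (measurable_pi_apply 1)
      (measurable_codingSeq x n)).neg.aestronglyMeasurable)
    (integrable_const _) (fun n => ?_) ?_
  · filter_upwards [hY] with σ hσ
    rw [Real.norm_eq_abs, abs_of_nonneg (𝓜.neg_log_p_nonneg _ _)]
    exact hB _ _ (codingSeq_mem_cell hx (mem_convergenceSet_of_mem_codingDomain hσ).1 n)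
  · filter_upwards [hY] with σ hσ
    have hσ := mem_convergenceSet_of_mem_codingDomain hσ
    have hp := p_pos hpos (codingMap_mem_cell hopen hx hσ)
    exact ((Real.continuousAt_log hp.ne').tendsto.comp
      (((continuous_p hopen hdini (σ 1)).tendsto _).comp (tendsto_codingSeq hσ))).neg

theorem tendsto_setIntegral_p [IsFiniteMeasure Λ] (hopen : ∀ v, IsOpen (𝓜.cell v))
    (hdini : ∀ e, DiniContinuousOn (𝓜.p e) (𝓜.cell (𝓜.init e)))
    (hY : ∀ᵐ σ ∂Λ, σ ∈ 𝓜.codingDomain x) (C : Set (ℤ → E)) (e : E) :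
    Tendsto (fun k => ∫ σ in C, 𝓜.p e (𝓜.codingSeq x σ k) ∂Λ) atTop
      (𝓝 (∫ σ in C, 𝓜.p e (𝓜.codingMap x σ) ∂Λ)) := by
  refine tendsto_integral_of_dominated_convergence (fun _ => 1)
    (fun n => ((𝓜.p_measurable e).comp (measurable_codingSeq x n)).aestronglyMeasurable)
    (integrable_const _) (fun n => ae_of_all _ fun σ => ?_) ?_
  · rw [Real.norm_eq_abs, abs_of_nonneg (𝓜.p_nonneg _ _)]
    exact 𝓜.p_le_one _ _
  · filter_upwards [ae_restrict_of_ae hY] with σ hσ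
    exact ((continuous_p hopen hdini e).tendsto _).comp
      (tendsto_codingSeq (mem_convergenceSet_of_mem_codingDomain hσ))

end Limit

/-! ### Relative entropy of the true next letter with respect to the predicted one. -/

section Defect

variable [TopologicalSpace K] [DiscreteMeasurableSpace E] {x : V → K}

variable (𝓜) in
/-- The probability of the word `g` followed by `e`, if the letter after `g` were chosen by the
probabilities at the point coded by `g`. -/
noncomputable def predictedProb (Λ : Measure (ℤ → E)) (x : V → K) {k : ℕ}
    (r : (Fin (k + 1) → E) × E) : ℝ :=
  Λ.real (cylinderAt (-k) (List.ofFn r.1)) * 𝓜.p r.2 (𝓜.wordPoint x r.1)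

/-- The probability of the word `g` followed by `e`. -/
noncomputable def nextProb (Λ : Measure (ℤ → E)) {k : ℕ} (r : (Fin (k + 1) → E) × E) : ℝ :=
  Λ.real (cylinderAt (-k) (List.ofFn r.1) ∩ {σ | σ 1 = r.2})

theorem sum_nextProb [IsFiniteMeasure Λ] {k : ℕ} (g : Fin (k + 1) → E) :
    ∑ e, nextProb Λ (g, e) = Λ.real (cylinderAt (-k) (List.ofFn g)) := by
  simp only [nextProb, Measure.real]
  rw [← ENNReal.toReal_sum fun e _ => measure_ne_top _ _, sum_measure_inter_eval]

theorem sum_measureReal_cylinderAt [IsProbabilityMeasure Λ] (m : ℤ) (n : ℕ) :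
    ∑ g : Fin n → E, Λ.real (cylinderAt m (List.ofFn g)) = 1 := by
  simpa using (integral_window Λ m n fun _ => 1).symm

/-- By invariance the increment of block entropies is the conditional entropy of the next letter
given k + 1 past letters, so the right side is the relative entropy of `nextProb` with respect to
`predictedProb`. -/
theorem sum_sq_le_meanRate_sub [IsProbabilityMeasure Λ] (h : IsInvariantProb leftShift Λ)
    (hpos : ∀ e, ∃ δ : ℝ, 0 < δ ∧ ∀ y ∈ 𝓜.cell (𝓜.init e), δ ≤ 𝓜.p e y)
    (hx : ∀ v, x v ∈ 𝓜.cell v) (hY : ∀ᵐ σ ∂Λ, σ ∈ 𝓜.codingDomain x) (k : ℕ) :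
    ∑ r : (Fin (k + 1) → E) × E, (√(nextProb Λ r) - √(𝓜.predictedProb Λ x r)) ^ 2 ≤
      𝓜.meanRate Λ x k - (blockEntropy Λ (k + 2) - blockEntropy Λ (k + 1)) := by
  have hA0 : ∀ r : (Fin (k + 1) → E) × E, 0 ≤ nextProb Λ r := fun r => measureReal_nonneg
  have hB0 : ∀ r : (Fin (k + 1) → E) × E, 0 ≤ 𝓜.predictedProb Λ x r := fun r =>
    mul_nonneg measureReal_nonneg (𝓜.p_nonneg _ _)
  -- A word charged by Λ occurs in some path of the graph, whose coding sequence stays in the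
  -- initial cell of the next letter; there p is positive. This makes all logarithms legitimate.
  have hp : ∀ r : (Fin (k + 1) → E) × E, nextProb Λ r ≠ 0 →
      0 < 𝓜.p r.2 (𝓜.wordPoint x r.1) := by
    intro r hr
    have hne : Λ (cylinderAt (-k) (List.ofFn r.1) ∩ {σ | σ 1 = r.2}) ≠ 0 := fun h0 =>
      hr (by rw [nextProb, Measure.real, h0, ENNReal.toReal_zero])
    obtain ⟨σ, ⟨hσ1, hσ2⟩, hσY⟩ := (frequently_ae_mem_iff.2 hne).and_eventually hY |>.exists
    have hσ2 : σ 1 = r.2 := hσ2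
    rw [cylinderAt_ofFn] at hσ1
    have hσ1 : window (-k) (k + 1) σ = r.1 := hσ1
    rw [← hσ2, ← hσ1, ← codingSeq_eq_wordPoint]
    exact p_pos hpos (codingSeq_mem_cell hx (mem_convergenceSet_of_mem_codingDomain hσY).1 k)
  have hc : ∀ r : (Fin (k + 1) → E) × E, nextProb Λ r ≠ 0 →
      Λ.real (cylinderAt (-k) (List.ofFn r.1)) ≠ 0 := fun r hr h0 =>
    hr (le_antisymm ((measureReal_mono Set.inter_subset_left).trans h0.le) (hA0 r))
  have hH2 : blockEntropy Λ (k + 2) =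
      ∑ r : (Fin (k + 1) → E) × E, Real.negMulLog (nextProb Λ r) := by
    rw [Fintype.sum_prod_type, blockEntropy,
      sum_ofFn_succ_last (k + 1) fun l => Real.negMulLog (Λ.real (cylinderAt 1 l))]
    refine Finset.sum_congr rfl fun g _ => Finset.sum_congr rfl fun e _ => ?_
    rw [nextProb, ← cylinderAt_ofFn_append, Measure.real, Measure.real,
      h.measure_cylinderAt 1 (-k)]
  have hH1 : blockEntropy Λ (k + 1) = -∑ r : (Fin (k + 1) → E) × E,
      nextProb Λ r * Real.log (Λ.real (cylinderAt (-k) (List.ofFn r.1))) := by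
    rw [Fintype.sum_prod_type, blockEntropy, ← Finset.sum_neg_distrib]
    refine Finset.sum_congr rfl fun g _ => ?_
    simp only
    rw [← Finset.sum_mul, sum_nextProb, Measure.real, h.measure_cylinderAt 1 (-k),
      Real.negMulLog, neg_mul]
    rfl
  have hE : 𝓜.meanRate Λ x k = -∑ r : (Fin (k + 1) → E) × E,
      nextProb Λ r * Real.log (𝓜.p r.2 (𝓜.wordPoint x r.1)) := by
    have hwin : 𝓜.meanRate Λ x k = ∫ σ, (fun g : Fin (k + 2) → E =>
        -Real.log (𝓜.p (g (Fin.last (k + 1))) (𝓜.wordPoint x (Fin.init g))))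
        (window (-k) (k + 2) σ) ∂Λ := by
      refine integral_congr_ae (ae_of_all _ fun σ => ?_)
      have h1 : window (-k) (k + 2) σ (Fin.last (k + 1)) = σ 1 := by simp [window]
      simp only [h1, codingSeq_eq_wordPoint]
      rfl
    rw [hwin, integral_window Λ (-k) (k + 2) fun g =>
      -Real.log (𝓜.p (g (Fin.last (k + 1))) (𝓜.wordPoint x (Fin.init g))),
      ← (Fin.snocEquiv fun _ => E).sum_comp, Fintype.sum_prod_type_right,
      Fintype.sum_prod_type, ← Finset.sum_neg_distrib]
    refine Finset.sum_congr rfl fun g _ => ?_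
    rw [← Finset.sum_neg_distrib]
    refine Finset.sum_congr rfl fun e _ => ?_
    simp only [Fin.snocEquiv, Equiv.coe_fn_mk, Fin.snoc_last, Fin.init_snoc]
    rw [List.ofFn_succ_last, nextProb, ← cylinderAt_ofFn_append]
    simp
  have hterm := Finset.sum_le_sum fun r (_ : r ∈ (Finset.univ : Finset ((Fin (k + 1) → E) × E))) =>
    negMulLog_add_mul_log_le (hA0 r) (hB0 r) fun hB => by
      by_contra hne
      exact (mul_ne_zero (hc r hne) (hp r hne).ne') hB
  have hlog : ∀ r : (Fin (k + 1) → E) × E, nextProb Λ r * Real.log (𝓜.predictedProb Λ x r) =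
      nextProb Λ r * Real.log (Λ.real (cylinderAt (-k) (List.ofFn r.1))) +
      nextProb Λ r * Real.log (𝓜.p r.2 (𝓜.wordPoint x r.1)) := fun r => by
    by_cases hr : nextProb Λ r = 0
    · simp [hr]
    · rw [predictedProb, Real.log_mul (hc r hr) (hp r hr).ne', mul_add]
  have hsumA : ∑ r : (Fin (k + 1) → E) × E, nextProb Λ r = 1 := by
    rw [Fintype.sum_prod_type]
    simp only [sum_nextProb, sum_measureReal_cylinderAt]
  have hsumB : ∑ r : (Fin (k + 1) → E) × E, 𝓜.predictedProb Λ x r = 1 := by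
    rw [Fintype.sum_prod_type]
    simp only [predictedProb, ← Finset.mul_sum, 𝓜.p_sum, mul_one, sum_measureReal_cylinderAt]
  simp only [hlog] at hterm
  rw [Finset.sum_add_distrib, Finset.sum_add_distrib, Finset.sum_sub_distrib,
    Finset.sum_sub_distrib, hsumA, hsumB] at hterm
  rw [hH1, hH2, hE]
  linarith

theorem sq_sum_abs_le_meanRate_sub [IsProbabilityMeasure Λ] (h : IsInvariantProb leftShift Λ)
    (hpos : ∀ e, ∃ δ : ℝ, 0 < δ ∧ ∀ y ∈ 𝓜.cell (𝓜.init e), δ ≤ 𝓜.p e y)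
    (hx : ∀ v, x v ∈ 𝓜.cell v) (hY : ∀ᵐ σ ∂Λ, σ ∈ 𝓜.codingDomain x) (k : ℕ) :
    (∑ r : (Fin (k + 1) → E) × E, |nextProb Λ r - 𝓜.predictedProb Λ x r|) ^ 2 ≤
      4 * (𝓜.meanRate Λ x k - (blockEntropy Λ (k + 2) - blockEntropy Λ (k + 1))) := by
  refine (sq_sum_abs_sub_le (A := nextProb Λ) (B := 𝓜.predictedProb Λ x)
    (fun r => measureReal_nonneg) (fun r => mul_nonneg measureReal_nonneg (𝓜.p_nonneg _ _)) ?_ ?_).trans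
    (mul_le_mul_of_nonneg_left (sum_sq_le_meanRate_sub h hpos hx hY k) (by norm_num))
  · rw [Fintype.sum_prod_type]
    simp only [sum_nextProb, sum_measureReal_cylinderAt]
  · rw [Fintype.sum_prod_type]
    simp only [predictedProb, ← Finset.mul_sum, 𝓜.p_sum, mul_one, sum_measureReal_cylinderAt]

end Defect

/-! ### The entropy bound and the case of equality. -/

section Variational

variable [MetricSpace K] [Nonempty K] [DiscreteMeasurableSpace E] {x : V → K}

/-- Increments of block entropy are eventually at most the mean rate minus ε, and they bound the
entropy. The case ε = 0 is the variational inequality; ε > 0 shows that a persistent gap costs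
entropy. -/
theorem ksEntropy_le_integral_rate (h : IsInvariantProb leftShift Λ)
    (hopen : ∀ v, IsOpen (𝓜.cell v))
    (hdini : ∀ e, DiniContinuousOn (𝓜.p e) (𝓜.cell (𝓜.init e)))
    (hpos : ∀ e, ∃ δ : ℝ, 0 < δ ∧ ∀ y ∈ 𝓜.cell (𝓜.init e), δ ≤ 𝓜.p e y)
    (hx : ∀ v, x v ∈ 𝓜.cell v) (hY : ∀ᵐ σ ∂Λ, σ ∈ 𝓜.codingDomain x) {ε : ℝ}
    (hε : ∀ᶠ k in atTop, ε ≤ 𝓜.meanRate Λ x k -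
      (blockEntropy Λ (k + 2) - blockEntropy Λ (k + 1))) :
    ksEntropy leftShift Λ ≤ ((∫ σ, 𝓜.rate x σ ∂Λ) - ε : ℝ) := by
  have := h.1
  rw [← EReal.le_of_forall_lt_iff_le]
  intro r hr
  have hr : (∫ σ, 𝓜.rate x σ ∂Λ) - ε < r := by exact_mod_cast hr
  obtain ⟨s, hs1, hs2⟩ := exists_between hr
  refine h.ksEntropy_le (eventually_le_mul_of_sub_le hs2 ?_)
  have hev : ∀ᶠ k in atTop, blockEntropy Λ (k + 1 + 1) - blockEntropy Λ (k + 1) ≤ s := by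
    filter_upwards [hε, (tendsto_meanRate hopen hdini hpos hx hY).eventually_lt_const
      (show ∫ σ, 𝓜.rate x σ ∂Λ < s + ε by linarith)] with k h1 h2
    linarith
  obtain ⟨N, hN⟩ := eventually_atTop.1 hev
  filter_upwards [eventually_ge_atTop (N + 1)] with n hn
  obtain ⟨d, rfl⟩ := Nat.exists_eq_add_of_le hn
  have := hN (N + d) (Nat.le_add_right _ _)
  rwa [show N + 1 + d = N + d + 1 by ring]

/-- If the entropy is as large as the energy permits, then the letter at the place `1` is
distributed, given the past, according to the probabilities at the value of the coding map. -/
theorem measureReal_inter_eq_of_le_ksEntropy (h : IsInvariantProb leftShift Λ)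
    (hopen : ∀ v, IsOpen (𝓜.cell v))
    (hdini : ∀ e, DiniContinuousOn (𝓜.p e) (𝓜.cell (𝓜.init e)))
    (hpos : ∀ e, ∃ δ : ℝ, 0 < δ ∧ ∀ y ∈ 𝓜.cell (𝓜.init e), δ ≤ 𝓜.p e y)
    (hx : ∀ v, x v ∈ 𝓜.cell v) (hY : ∀ᵐ σ ∂Λ, σ ∈ 𝓜.codingDomain x)
    (hks : ((∫ σ, 𝓜.rate x σ ∂Λ : ℝ) : EReal) ≤ ksEntropy leftShift Λ)
    (j : ℕ) (g₀ : Fin (j + 1) → E) (e : E) :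
    Λ.real (cylinderAt (-j) (List.ofFn g₀) ∩ {σ | σ 1 = e}) =
      ∫ σ in cylinderAt (-j) (List.ofFn g₀), 𝓜.p e (𝓜.codingMap x σ) ∂Λ := by
  classical
  have := h.1
  set C := cylinderAt (-j) (List.ofFn g₀)
  have hC : MeasurableSet C := measurableSet_cylinderAt _ _
  have hfreq : ∀ ε : ℝ, 0 < ε → ∃ᶠ k in atTop, 𝓜.meanRate Λ x k -
      (blockEntropy Λ (k + 2) - blockEntropy Λ (k + 1)) < ε := by
    intro ε hε
    by_contra hcon
    rw [not_frequently] at hcon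
    have hle := ksEntropy_le_integral_rate h hopen hdini hpos hx hY
      (hcon.mono fun k hk => not_lt.1 hk)
    have := hks.trans hle
    rw [EReal.coe_le_coe_iff] at this
    linarith
  -- Both quantities are sums over the longer words ending in g₀, so they differ by at most the
  -- total variation at level k.
  have hbound : ∀ k, j ≤ k → |Λ.real (C ∩ {σ | σ 1 = e}) -
      ∫ σ in C, 𝓜.p e (𝓜.codingSeq x σ k) ∂Λ| ≤
      ∑ r : (Fin (k + 1) → E) × E, |nextProb Λ r - 𝓜.predictedProb Λ x r| := by
    intro k hjk
    set ρ : (Fin (k + 1) → E) → Fin (j + 1) → E := fun g i => g ⟨i + (k - j), by omega⟩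
    have hρ : ∀ σ, ρ (window (-k) (k + 1) σ) = window (-j) (j + 1) σ := by
      intro σ
      funext i
      simp only [ρ, window]
      congr 1
      push_cast [Nat.cast_sub hjk]
      ring
    set ψ : (Fin (k + 1) → E) → ℝ := fun g => if ρ g = g₀ then 1 else 0
    have hψC : ∀ σ, ψ (window (-k) (k + 1) σ) = C.indicator 1 σ := by
      intro σ
      simp only [ψ, hρ, C, cylinderAt_ofFn, Set.indicator_apply, Set.mem_preimage,
        Set.mem_singleton_iff, Pi.one_apply]
    have h1 : Λ.real (C ∩ {σ | σ 1 = e}) = ∑ g, ψ g * nextProb Λ (g, e) := by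
      have hr : ∀ g : Fin (k + 1) → E, nextProb Λ (g, e) =
          (Λ.restrict {σ | σ 1 = e}).real (cylinderAt (-k) (List.ofFn g)) := fun g => by
        rw [measureReal_restrict_apply (measurableSet_cylinderAt _ _), nextProb]
      have hi := integral_window (Λ.restrict {σ | σ 1 = e}) (-k) (k + 1) ψ
      simp only [hψC] at hi
      rw [integral_indicator_one hC, measureReal_restrict_apply hC] at hi
      rw [hi]
      exact Finset.sum_congr rfl fun g _ => by rw [hr, mul_comm]
    have h2 : ∫ σ in C, 𝓜.p e (𝓜.codingSeq x σ k) ∂Λ =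
        ∑ g, ψ g * 𝓜.predictedProb Λ x (g, e) := by
      rw [← integral_indicator hC]
      have hi := integral_window Λ (-k) (k + 1) fun g => ψ g * 𝓜.p e (𝓜.wordPoint x g)
      calc _ = ∫ σ, ψ (window (-k) (k + 1) σ) *
            𝓜.p e (𝓜.wordPoint x (window (-k) (k + 1) σ)) ∂Λ := by
            refine integral_congr_ae (ae_of_all _ fun σ => ?_)
            simp only [hψC, codingSeq_eq_wordPoint, Set.indicator_apply]
            split_ifs <;> simp
        _ = _ := by
            rw [hi]
            exact Finset.sum_congr rfl fun g _ => by simp only [predictedProb]; ring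
    rw [h1, h2, ← Finset.sum_sub_distrib]
    refine (Finset.abs_sum_le_sum_abs _ _).trans ?_
    rw [Fintype.sum_prod_type]
    refine Finset.sum_le_sum fun g _ => ?_
    refine le_trans ?_ (Finset.single_le_sum
      (f := fun e => |nextProb Λ (g, e) - 𝓜.predictedProb Λ x (g, e)|)
      (fun e _ => abs_nonneg _) (Finset.mem_univ e))
    rw [← mul_sub, abs_mul]
    refine mul_le_of_le_one_left (abs_nonneg _) ?_
    simp only [ψ]
    split_ifs <;> simp
  have hlim := tendsto_setIntegral_p (x := x) hopen hdini hY C e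
  by_contra hne
  set d := |Λ.real (C ∩ {σ | σ 1 = e}) - ∫ σ in C, 𝓜.p e (𝓜.codingMap x σ) ∂Λ|
  have hd : 0 < d := abs_pos.2 (sub_ne_zero.2 hne)
  have hev : ∀ᶠ k in atTop, d / 2 < |Λ.real (C ∩ {σ | σ 1 = e}) -
      ∫ σ in C, 𝓜.p e (𝓜.codingSeq x σ k) ∂Λ| :=
    ((tendsto_const_nhds.sub hlim).abs).eventually_const_lt (by linarith)
  -- The constant closes the argument: 4 · d²/16 = (d/2)², while the total variation at level k
  -- exceeds d/2.
  obtain ⟨k, hk1, hk2, hk3⟩ := ((hfreq (d ^ 2 / 16) (by positivity)).and_eventually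
    (hev.and (eventually_ge_atTop j))).exists
  have h1 := sq_sum_abs_le_meanRate_sub h hpos hx hY k
  have h2 := hbound k hk3
  nlinarith

end Variational

end MarkovSystem

/-! ### Equilibrium states are generalized Markov measures -/

section Past

variable {E : Type*}

/-- The sequence that agrees with `σ` up to the place `0` and is constant from there on. -/
def pastProj (σ : ℤ → E) : ℤ → E := fun j => σ (min j 0)

@[fun_prop]
theorem measurable_pastProj [MeasurableSpace E] : Measurable (pastProj : (ℤ → E) → ℤ → E) :=
  measurable_pi_lambda _ fun _ => measurable_pi_apply _

theorem pastProj_shiftBy_pastProj (σ : ℤ → E) :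
    pastProj (shiftBy (-1) (pastProj σ)) = pastProj (shiftBy (-1) σ) := by
  funext j
  simp only [pastProj, shiftBy]
  congr 1
  omega

theorem window_pastProj (n : ℕ) (σ : ℤ → E) :
    window (-n) (n + 1) (pastProj σ) = window (-n) (n + 1) σ := by
  funext j
  simp only [window, pastProj]
  congr 1
  omega

theorem map_pastProj_eq [Fintype E] [MeasurableSpace E] [DiscreteMeasurableSpace E]
    {Λ₁ Λ₂ : Measure (ℤ → E)} [IsFiniteMeasure Λ₁]
    (h : ∀ (n : ℕ) (g : Fin (n + 1) → E),
      Λ₁ (cylinderAt (-n) (List.ofFn g)) = Λ₂ (cylinderAt (-n) (List.ofFn g))) :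
    Λ₁.map pastProj = Λ₂.map pastProj := by
  refine measure_ext_of_cylinderAt fun n g => ?_
  set ρ : (Fin (n + 1) → E) → Fin (2 * n + 1) → E := fun f j => f ⟨min j n, by omega⟩
  have hρ : pastProj ⁻¹' cylinderAt (-n) (List.ofFn g) = window (-n) (n + 1) ⁻¹' (ρ ⁻¹' {g}) := by
    rw [cylinderAt_ofFn, ← Set.preimage_comp, ← Set.preimage_comp]
    congr 1
    funext σ j
    simp only [Function.comp_apply, ρ, window, pastProj]
    congr 1
    push_cast
    omega
  have hS : MeasurableSet (ρ ⁻¹' {g}) := (Set.toFinite _).measurableSet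
  rw [Measure.map_apply measurable_pastProj (measurableSet_cylinderAt _ _),
    Measure.map_apply measurable_pastProj (measurableSet_cylinderAt _ _), hρ,
    ← Measure.map_apply (measurable_window _ _) hS, ← Measure.map_apply (measurable_window _ _) hS,
    map_window_eq fun f => h n f]

end Past

namespace MarkovSystem

variable {K V E : Type*} [MeasurableSpace K] [Fintype E] {𝓜 : MarkovSystem K V E}
  [MetricSpace K] [Nonempty K] {x : V → K}

theorem codingMap_pastProj (σ : ℤ → E) : 𝓜.codingMap x (pastProj σ) = 𝓜.codingMap x σ := by
  have h : 𝓜.codingSeq x (pastProj σ) = 𝓜.codingSeq x σ := by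
    funext n
    rw [codingSeq_eq_wordPoint, codingSeq_eq_wordPoint, window_pastProj]
  rw [codingMap, codingMap, h]

variable [ProperSpace K] [BorelSpace K] [MeasurableSpace E] [DiscreteMeasurableSpace E]
  {Λ : Measure (ℤ → E)}

variable (𝓜 Λ x) in
/-- Given the past, the letter at the place `1` is distributed according to the probabilities at
the value of the coding map. -/
def NextLetterLaw : Prop :=
  ∀ (n : ℕ) (g : Fin (n + 1) → E) (e : E),
    Λ.real (cylinderAt (-n) (List.ofFn g) ∩ {σ | σ 1 = e}) =
      ∫ σ in cylinderAt (-n) (List.ofFn g), 𝓜.p e (𝓜.codingMap x σ) ∂Λ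

/-- The cylinders ending at place 0 determine a measure on the past, so the defining identity
extends from them to every function of the past. -/
theorem NextLetterLaw.setLIntegral_pastProj [IsFiniteMeasure Λ] (hΛ : 𝓜.NextLetterLaw x Λ) (e : E)
    {G : (ℤ → E) → ℝ≥0∞} (hG : Measurable G) :
    ∫⁻ σ in {σ | σ 1 = e}, G (pastProj σ) ∂Λ =
      ∫⁻ σ, ENNReal.ofReal (𝓜.p e (𝓜.codingMap x σ)) * G (pastProj σ) ∂Λ := by
  have hp : Measurable fun σ => 𝓜.p e (𝓜.codingMap x σ) :=
    (𝓜.p_measurable e).comp (measurable_codingMap x)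
  have hmap : (Λ.restrict {σ | σ 1 = e}).map pastProj =
      (Λ.withDensity fun σ => ENNReal.ofReal (𝓜.p e (𝓜.codingMap x σ))).map pastProj := by
    refine map_pastProj_eq fun n g => ?_
    have hC := measurableSet_cylinderAt (-n) (List.ofFn g)
    rw [Measure.restrict_apply hC, withDensity_apply _ hC,
      ← ofReal_integral_eq_lintegral_ofReal, ← hΛ n g e, ofReal_measureReal]
    · refine integrable_of_measurable_of_abs_le hp (C := 1) fun σ => ?_
      rw [abs_of_nonneg (𝓜.p_nonneg _ _)]
      exact 𝓜.p_le_one _ _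
    · exact ae_of_all _ fun σ => 𝓜.p_nonneg _ _
  rw [← lintegral_map hG measurable_pastProj, hmap, lintegral_map hG measurable_pastProj,
    lintegral_withDensity_eq_lintegral_mul _ hp.ennreal_ofReal (g := fun σ => G (pastProj σ))
      (hG.comp measurable_pastProj)]
  rfl

/-- F(Sσ) arises from F(σ) by one step of the chain, since the next letter is drawn according to p
at F(σ); shift invariance says that both have the same law. -/
theorem NextLetterLaw.push_map_codingMap (hΛ : 𝓜.NextLetterLaw x Λ)
    (h : IsInvariantProb leftShift Λ) (hcontr : 𝓜.IsContractive) (hopen : ∀ v, IsOpen (𝓜.cell v))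
    (hpos : ∀ e, ∃ δ : ℝ, 0 < δ ∧ ∀ y ∈ 𝓜.cell (𝓜.init e), δ ≤ 𝓜.p e y)
    (hx : ∀ v, x v ∈ 𝓜.cell v) (hY : ∀ᵐ σ ∂Λ, σ ∈ 𝓜.codingDomain x) :
    𝓜.push (Λ.map (𝓜.codingMap x)) = Λ.map (𝓜.codingMap x) := by
  have := h.1
  have hF := measurable_codingMap (𝓜 := 𝓜) x
  refine Measure.ext_of_lintegral _ fun f hf => ?_
  have hfw : ∀ e, Measurable fun y => f (𝓜.w e y) := fun e => hf.comp (𝓜.w_measurable e)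
  have hpf : ∀ e, Measurable fun y => ENNReal.ofReal (𝓜.p e y) * f (𝓜.w e y) := fun e =>
    (𝓜.measurable_ofReal_p e).mul (hfw e)
  have hpfF : ∀ e, Measurable fun σ => ENNReal.ofReal (𝓜.p e (𝓜.codingMap x σ)) *
      f (𝓜.w e (𝓜.codingMap x σ)) := fun e => (hpf e).comp hF
  have hshift : ∫⁻ σ, f (𝓜.codingMap x (leftShift σ)) ∂Λ = ∫⁻ σ, f (𝓜.codingMap x σ) ∂Λ :=
    h.2.lintegral_comp (hf.comp hF)
  rw [𝓜.lintegral_push _ hf, lintegral_map (Finset.measurable_sum _ fun e _ => hpf e) hF,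
    lintegral_finsetSum _ fun e _ => hpfF e, lintegral_map hf hF, ← hshift, ← sum_setLIntegral_eval Λ 1]
  refine Finset.sum_congr rfl fun e _ => ?_
  have := hΛ.setLIntegral_pastProj e ((hfw e).comp hF)
  simp only [Function.comp_apply, codingMap_pastProj] at this
  rw [← this]
  refine setLIntegral_congr_fun_ae (measurableSet_eval 1 e) ?_
  filter_upwards [hY] with σ hσ he
  have he : σ 1 = e := he
  rw [codingMap_leftShift hcontr hopen hpos hx hσ, he]

theorem NextLetterLaw.setLIntegral_cylinderAt (hΛ : 𝓜.NextLetterLaw x Λ)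
    (h : IsInvariantProb leftShift Λ) (hcontr : 𝓜.IsContractive) (hopen : ∀ v, IsOpen (𝓜.cell v))
    (hpos : ∀ e, ∃ δ : ℝ, 0 < δ ∧ ∀ y ∈ 𝓜.cell (𝓜.init e), δ ≤ 𝓜.p e y)
    (hx : ∀ v, x v ∈ 𝓜.cell v) (hY : ∀ᵐ σ ∂Λ, σ ∈ 𝓜.codingDomain x) (l : List E)
    {G : (ℤ → E) → ℝ≥0∞} (hG : Measurable G) :
    ∫⁻ σ in cylinderAt 1 l, G (pastProj σ) ∂Λ =
      ∫⁻ σ, G (pastProj σ) * ENNReal.ofReal (𝓜.wordProb l (𝓜.codingMap x σ)) ∂Λ := by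
  have := h.1
  have hF := measurable_codingMap (𝓜 := 𝓜) x
  induction l generalizing G with
  | nil => simp
  | cons e l ih =>
    -- After one shift the first letter e sits at place 0 and joins the past. `H` reads the old past
    -- from the shifted sequence, and `G'` is again a function of the past, so the induction
    -- hypothesis applies to it.
    set H : (ℤ → E) → ℝ≥0∞ := fun τ => G (pastProj (shiftBy (-1) τ))
    have hH : Measurable H := hG.comp (measurable_pastProj.comp (measurable_shiftBy _))
    have hHS : ∀ σ, H (leftShift σ) = G (pastProj σ) := fun σ => by
      simp [H, leftShift, shiftBy_shiftBy]
    set G' : (ℤ → E) → ℝ≥0∞ := {τ : ℤ → E | τ 0 = e}.indicator H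
    have hG' : Measurable G' := hH.indicator (measurableSet_eval 0 e)
    have hG'p : ∀ τ, G' (pastProj τ) = G' τ := fun τ => by
      classical
      simp only [G', H, Set.indicator_apply, Set.mem_ofPred_eq, pastProj_shiftBy_pastProj]
      rfl
    have hG'S : ∀ σ, G' (leftShift σ) =
        {σ : ℤ → E | σ 1 = e}.indicator (fun σ => G (pastProj σ)) σ := fun σ => by
      classical
      simp only [G', Set.indicator_apply, Set.mem_ofPred_eq, hHS]
      rfl
    have hcyl : cylinderAt 1 (e :: l) =
        {σ : ℤ → E | σ 1 = e} ∩ leftShift ⁻¹' cylinderAt 1 l := by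
      rw [leftShift, preimage_shiftBy_cylinderAt]
      ext σ
      exact mem_cylinderAt_cons
    have hW : Measurable fun τ => ENNReal.ofReal (𝓜.wordProb l (𝓜.codingMap x τ)) :=
      ((𝓜.measurable_wordProb l).comp hF).ennreal_ofReal
    have hWe : Measurable fun τ => ENNReal.ofReal (𝓜.wordProb l (𝓜.w e (𝓜.codingMap x τ))) :=
      ((𝓜.measurable_wordProb l).comp ((𝓜.w_measurable e).comp hF)).ennreal_ofReal
    calc ∫⁻ σ in cylinderAt 1 (e :: l), G (pastProj σ) ∂Λ
        = ∫⁻ σ in leftShift ⁻¹' cylinderAt 1 l, G' (leftShift σ) ∂Λ := by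
          simp only [hG'S]
          rw [lintegral_indicator (measurableSet_eval 1 e),
            Measure.restrict_restrict (measurableSet_eval 1 e), hcyl]
      _ = ∫⁻ τ in cylinderAt 1 l, G' (pastProj τ) ∂Λ := by
          simp only [hG'p]
          exact h.2.setLIntegral_comp_preimage (measurableSet_cylinderAt 1 l) hG'
      _ = ∫⁻ τ, G' τ * ENNReal.ofReal (𝓜.wordProb l (𝓜.codingMap x τ)) ∂Λ := by
          rw [ih hG']
          simp only [hG'p]
      _ = ∫⁻ σ, G' (leftShift σ) *
            ENNReal.ofReal (𝓜.wordProb l (𝓜.codingMap x (leftShift σ))) ∂Λ :=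
          (h.2.lintegral_comp (hG'.mul hW)).symm
      _ = ∫⁻ σ in {σ | σ 1 = e}, G (pastProj σ) *
            ENNReal.ofReal (𝓜.wordProb l (𝓜.w e (𝓜.codingMap x σ))) ∂Λ := by
          rw [← lintegral_indicator (measurableSet_eval 1 e)]
          refine lintegral_congr_ae ?_
          filter_upwards [hY] with σ hσ
          classical
          rw [hG'S, codingMap_leftShift hcontr hopen hpos hx hσ, Set.indicator_apply,
            Set.indicator_apply]
          by_cases he : σ 1 = e
          · simp [he]
          · simp [he]
      _ = _ := by
          have := hΛ.setLIntegral_pastProj e (hG.mul hWe)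
          simp only [Pi.mul_apply, codingMap_pastProj] at this
          rw [this]
          refine lintegral_congr fun σ => ?_
          rw [wordProb_cons, ENNReal.ofReal_mul (𝓜.p_nonneg _ _)]
          ring

theorem NextLetterLaw.isGeneralizedMarkovMeasure (hΛ : 𝓜.NextLetterLaw x Λ)
    (h : IsInvariantProb leftShift Λ) (hcontr : 𝓜.IsContractive) (hopen : ∀ v, IsOpen (𝓜.cell v))
    (hpos : ∀ e, ∃ δ : ℝ, 0 < δ ∧ ∀ y ∈ 𝓜.cell (𝓜.init e), δ ≤ 𝓜.p e y)
    (hx : ∀ v, x v ∈ 𝓜.cell v) (hY : ∀ᵐ σ ∂Λ, σ ∈ 𝓜.codingDomain x) :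
    𝓜.IsGeneralizedMarkovMeasure (Λ.map (𝓜.codingMap x)) Λ := by
  intro m l
  have := hΛ.setLIntegral_cylinderAt h hcontr hopen hpos hx hY l (G := fun _ => 1)
    measurable_const
  simp only [lintegral_one, Measure.restrict_apply_univ, one_mul] at this
  rw [h.measure_cylinderAt m 1, this,
    lintegral_map (𝓜.measurable_wordProb l).ennreal_ofReal (measurable_codingMap x)]

/-! ### The entropy of the generalized Markov measure -/

section Entropy

variable {K V E : Type*} [MeasurableSpace K] [Fintype E] {𝓜 : MarkovSystem K V E}

variable (𝓜) in
/-- The entropy of the distribution of the next edge. -/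
noncomputable def pointEntropy (y : K) : ℝ := ∑ e, Real.negMulLog (𝓜.p e y)

theorem integrable_negMulLog {X : Type*} [MeasurableSpace X] {ν : Measure X} [IsFiniteMeasure ν]
    {f : X → ℝ} (hf : Measurable f) (hf0 : ∀ y, 0 ≤ f y) (hf1 : ∀ y, f y ≤ 1) :
    Integrable (fun y => Real.negMulLog (f y)) ν := by
  refine integrable_of_measurable_of_abs_le (Real.continuous_negMulLog.measurable.comp hf)
    (C := 1) fun y => ?_
  rw [abs_of_nonneg (Real.negMulLog_nonneg (hf0 y) (hf1 y))]
  linarith [Real.negMulLog_le_one_sub_self (hf0 y), hf0 y]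

theorem measurable_pointEntropy : Measurable 𝓜.pointEntropy :=
  Finset.measurable_sum _ fun e _ =>
    Real.continuous_negMulLog.measurable.comp (𝓜.p_measurable e)

theorem pointEntropy_nonneg (y : K) : 0 ≤ 𝓜.pointEntropy y :=
  Finset.sum_nonneg fun e _ => Real.negMulLog_nonneg (𝓜.p_nonneg e y) (𝓜.p_le_one e y)

/-- Chain rule: for a fixed starting point, one more letter adds the mean entropy of the next edge
at the endpoint. -/
theorem sum_negMulLog_wordProb_succ (n : ℕ) (y : K) :
    ∑ g : Fin (n + 1) → E, Real.negMulLog (𝓜.wordProb (List.ofFn g) y) =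
      ∑ g : Fin n → E, Real.negMulLog (𝓜.wordProb (List.ofFn g) y) +
        𝓜.wordOp n 𝓜.pointEntropy y := by
  rw [sum_ofFn_succ_last n fun l => Real.negMulLog (𝓜.wordProb l y), wordOp,
    ← Finset.sum_add_distrib]
  refine Finset.sum_congr rfl fun g _ => ?_
  simp only [wordProb_append, wordProb_cons, wordProb_nil, mul_one, Real.negMulLog_mul]
  rw [Finset.sum_add_distrib, ← Finset.sum_mul, 𝓜.p_sum, one_mul, ← Finset.mul_sum]
  rfl

theorem integral_sum_negMulLog_wordProb {μ : Measure K} [IsProbabilityMeasure μ]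
    (hμ : 𝓜.push μ = μ) (n : ℕ) :
    ∫ y, ∑ g : Fin n → E, Real.negMulLog (𝓜.wordProb (List.ofFn g) y) ∂μ =
      n * ∫ y, 𝓜.pointEntropy y ∂μ := by
  have hInt : ∀ n : ℕ, Integrable
      (fun y => ∑ g : Fin n → E, Real.negMulLog (𝓜.wordProb (List.ofFn g) y)) μ := fun n =>
    integrable_finsetSum _ fun g _ => integrable_negMulLog (𝓜.measurable_wordProb _)
      (𝓜.wordProb_nonneg _) (𝓜.wordProb_le_one _)
  induction n with
  | zero => simp
  | succ n ih =>
    have hop : Integrable (𝓜.wordOp n 𝓜.pointEntropy) μ := by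
      refine ((hInt (n + 1)).sub (hInt n)).congr (ae_of_all _ fun y => ?_)
      simp only [Pi.sub_apply, sum_negMulLog_wordProb_succ, add_sub_cancel_left]
    simp only [sum_negMulLog_wordProb_succ]
    rw [integral_add (hInt n) hop, ih,
      integral_wordOp_of_push_eq hμ n measurable_pointEntropy pointEntropy_nonneg]
    push_cast
    ring

/-- Word probabilities under M are μ-means over the starting point; by Jensen's inequality the
entropy of the mean law is at least the mean of the entropies, which grows linearly by the chain
rule and invariance. -/
theorem IsGeneralizedMarkovMeasure.mul_le_blockEntropy [MeasurableSpace E]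
    {μ : Measure K} [IsProbabilityMeasure μ] {M : Measure (ℤ → E)} (hμ : 𝓜.push μ = μ)
    (hM : 𝓜.IsGeneralizedMarkovMeasure μ M) (n : ℕ) :
    n * ∫ y, 𝓜.pointEntropy y ∂μ ≤ blockEntropy M n := by
  have hInt : ∀ l, Integrable (fun y => Real.negMulLog (𝓜.wordProb l y)) μ := fun l =>
    integrable_negMulLog (𝓜.measurable_wordProb l) (𝓜.wordProb_nonneg l) (𝓜.wordProb_le_one l)
  rw [← integral_sum_negMulLog_wordProb hμ, integral_finsetSum _ fun g _ => hInt _, blockEntropy]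
  refine Finset.sum_le_sum fun g _ => ?_
  rw [hM.measureReal_cylinderAt]
  exact Real.concaveOn_negMulLog.le_map_integral Real.continuous_negMulLog.continuousOn
    isClosed_Ici (ae_of_all _ fun y => 𝓜.wordProb_nonneg _ y) (integrable_wordProb μ _) (hInt _)

theorem integral_pointEntropy (μ : Measure K) [IsProbabilityMeasure μ] :
    ∫ y, 𝓜.pointEntropy y ∂μ =
      -∑ e, ∫ y in 𝓜.cell (𝓜.init e), 𝓜.p e y * Real.log (𝓜.p e y) ∂μ := by
  simp only [pointEntropy]
  rw [integral_finsetSum _ fun e _ =>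
    integrable_negMulLog (𝓜.p_measurable e) (𝓜.p_nonneg e) (𝓜.p_le_one e),
    ← Finset.sum_neg_distrib]
  refine Finset.sum_congr rfl fun e _ => ?_
  rw [setIntegral_eq_integral_of_forall_compl_eq_zero fun y hy => by
    rw [𝓜.p_eq_zero e y hy, zero_mul], ← integral_neg]
  simp only [Real.negMulLog, neg_mul]

end Entropy

variable [Fintype V] {μ : Measure K} {M : Measure (ℤ → E)}

/-- The pair (σ 1, F(σ)) has density p_e with respect to μ, so averaging -log p over the letter
gives the entropy of the next edge. -/
theorem IsGeneralizedMarkovMeasure.integral_rate [IsProbabilityMeasure μ]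
    (hcontr : 𝓜.IsContractive) (hopen : ∀ v, IsOpen (𝓜.cell v)) (hx : ∀ v, x v ∈ 𝓜.cell v)
    (hμ : 𝓜.push μ = μ) (hH : ∫⁻ z, ENNReal.ofReal (𝓜.height x z) ∂μ ≠ ⊤)
    (hM : 𝓜.IsGeneralizedMarkovMeasure μ M) :
    ∫ σ, 𝓜.rate x σ ∂M = ∫ y, 𝓜.pointEntropy y ∂μ := by
  rw [integral_eq_lintegral_of_nonneg_ae (f := 𝓜.rate x)
    (ae_of_all _ fun σ => 𝓜.neg_log_p_nonneg _ _) (measurable_rate x).aestronglyMeasurable,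
    integral_eq_lintegral_of_nonneg_ae (ae_of_all _ pointEntropy_nonneg)
    measurable_pointEntropy.aestronglyMeasurable]
  congr 1
  have hm : ∀ e, Measurable fun y => ENNReal.ofReal (-Real.log (𝓜.p e y)) := fun e =>
    (𝓜.measurable_log_p e).neg.ennreal_ofReal
  have hpm : ∀ e, Measurable fun y => ENNReal.ofReal (𝓜.p e y) *
      ENNReal.ofReal (-Real.log (𝓜.p e y)) := fun e => (𝓜.measurable_ofReal_p e).mul (hm e)
  have := hM.lintegral_letter_codingMap hcontr hopen hx hμ hH
    (f := fun e y => ENNReal.ofReal (-Real.log (𝓜.p e y))) hm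
  simp only [rate]
  rw [this, ← lintegral_finsetSum _ fun e _ => hpm e]
  refine lintegral_congr fun y => ?_
  rw [pointEntropy, ENNReal.ofReal_sum_of_nonneg fun e _ =>
    Real.negMulLog_nonneg (𝓜.p_nonneg e y) (𝓜.p_le_one e y)]
  refine Finset.sum_congr rfl fun e _ => ?_
  rw [← ENNReal.ofReal_mul (𝓜.p_nonneg e y), Real.negMulLog, mul_neg, neg_mul]

end MarkovSystem

/-! ### Pressure and equilibrium states -/

namespace MarkovSystem

variable {K V E : Type*} [MeasurableSpace K] [Fintype E] {𝓜 : MarkovSystem K V E}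
  [MetricSpace K] [Nonempty K] {x : V → K} [MeasurableSpace E] [DiscreteMeasurableSpace E]
  {Λ : Measure (ℤ → E)}

theorem ksEntropy_le_of_ae_mem_codingDomain (h : IsInvariantProb leftShift Λ)
    (hopen : ∀ v, IsOpen (𝓜.cell v))
    (hdini : ∀ e, DiniContinuousOn (𝓜.p e) (𝓜.cell (𝓜.init e)))
    (hpos : ∀ e, ∃ δ : ℝ, 0 < δ ∧ ∀ y ∈ 𝓜.cell (𝓜.init e), δ ≤ 𝓜.p e y)
    (hx : ∀ v, x v ∈ 𝓜.cell v) (hY : ∀ᵐ σ ∂Λ, σ ∈ 𝓜.codingDomain x) :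
    ksEntropy leftShift Λ ≤ ((∫ σ, 𝓜.rate x σ ∂Λ : ℝ) : EReal) := by
  have := h.1
  have hle := ksEntropy_le_integral_rate h hopen hdini hpos hx hY (ε := 0)
    (Eventually.of_forall fun k => (Finset.sum_nonneg fun r _ => sq_nonneg _).trans
      (sum_sq_le_meanRate_sub h hpos hx hY k))
  rwa [sub_zero] at hle

variable [ProperSpace K] [BorelSpace K]

theorem ksEntropy_add_energyIntegral_le_zero (h : IsInvariantProb leftShift Λ)
    (hopen : ∀ v, IsOpen (𝓜.cell v))
    (hdini : ∀ e, DiniContinuousOn (𝓜.p e) (𝓜.cell (𝓜.init e)))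
    (hpos : ∀ e, ∃ δ : ℝ, 0 < δ ∧ ∀ y ∈ 𝓜.cell (𝓜.init e), δ ≤ 𝓜.p e y)
    (hx : ∀ v, x v ∈ 𝓜.cell v) :
    ksEntropy leftShift Λ + energyIntegral Λ (𝓜.energy x) ≤ 0 := by
  have := h.1
  by_cases hY : ∀ᵐ σ ∂Λ, σ ∈ 𝓜.codingDomain x
  · rw [energyIntegral_energy hY (integrable_rate hopen hpos hx hY)]
    refine (add_le_add_left
      (ksEntropy_le_of_ae_mem_codingDomain h hopen hdini hpos hx hY) _).trans ?_
    rw [← EReal.coe_add, add_neg_cancel, EReal.coe_zero]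
  · rw [energyIntegral_energy_eq_bot hY, EReal.add_bot]
    exact bot_le

theorem nextLetterLaw_of_ksEntropy_add_energyIntegral_eq_zero (h : IsInvariantProb leftShift Λ)
    (hopen : ∀ v, IsOpen (𝓜.cell v))
    (hdini : ∀ e, DiniContinuousOn (𝓜.p e) (𝓜.cell (𝓜.init e)))
    (hpos : ∀ e, ∃ δ : ℝ, 0 < δ ∧ ∀ y ∈ 𝓜.cell (𝓜.init e), δ ≤ 𝓜.p e y)
    (hx : ∀ v, x v ∈ 𝓜.cell v)
    (h0 : ksEntropy leftShift Λ + energyIntegral Λ (𝓜.energy x) = 0) :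
    (∀ᵐ σ ∂Λ, σ ∈ 𝓜.codingDomain x) ∧ 𝓜.NextLetterLaw x Λ := by
  have := h.1
  have hY : ∀ᵐ σ ∂Λ, σ ∈ 𝓜.codingDomain x := by
    by_contra hY
    rw [energyIntegral_energy_eq_bot hY, EReal.add_bot] at h0
    exact EReal.bot_ne_zero h0
  refine ⟨hY, fun n g e => measureReal_inter_eq_of_le_ksEntropy h hopen hdini hpos hx hY ?_ n g e⟩
  rw [energyIntegral_energy hY (integrable_rate hopen hpos hx hY), EReal.coe_neg,
    ← sub_eq_add_neg] at h0
  by_contra hlt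
  refine (ne_of_lt ?_) h0
  rw [EReal.sub_lt_iff (Or.inl (EReal.coe_ne_bot _)) (Or.inl (EReal.coe_ne_top _)), zero_add]
  exact not_le.1 hlt

variable [Fintype V] {μ : Measure K} {M : Measure (ℤ → E)}

theorem IsGeneralizedMarkovMeasure.ksEntropy_eq [IsProbabilityMeasure μ]
    (hcontr : 𝓜.IsContractive) (hopen : ∀ v, IsOpen (𝓜.cell v))
    (hdini : ∀ e, DiniContinuousOn (𝓜.p e) (𝓜.cell (𝓜.init e)))
    (hpos : ∀ e, ∃ δ : ℝ, 0 < δ ∧ ∀ y ∈ 𝓜.cell (𝓜.init e), δ ≤ 𝓜.p e y)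
    (hx : ∀ v, x v ∈ 𝓜.cell v)
    (hμ : 𝓜.push μ = μ) (hH : ∫⁻ z, ENNReal.ofReal (𝓜.height x z) ∂μ ≠ ⊤)
    (hM : 𝓜.IsGeneralizedMarkovMeasure μ M) :
    ksEntropy leftShift M = ((∫ y, 𝓜.pointEntropy y ∂μ : ℝ) : EReal) := by
  refine le_antisymm ?_ (hM.isInvariantProb.le_ksEntropy (hM.mul_le_blockEntropy hμ))
  rw [← hM.integral_rate hcontr hopen hx hμ hH]
  exact ksEntropy_le_of_ae_mem_codingDomain hM.isInvariantProb hopen hdini hpos hx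
    (hM.ae_mem_codingDomain hcontr hopen hx hμ hH)

theorem IsGeneralizedMarkovMeasure.ksEntropy_add_energyIntegral [IsProbabilityMeasure μ]
    (hcontr : 𝓜.IsContractive) (hopen : ∀ v, IsOpen (𝓜.cell v))
    (hdini : ∀ e, DiniContinuousOn (𝓜.p e) (𝓜.cell (𝓜.init e)))
    (hpos : ∀ e, ∃ δ : ℝ, 0 < δ ∧ ∀ y ∈ 𝓜.cell (𝓜.init e), δ ≤ 𝓜.p e y)
    (hx : ∀ v, x v ∈ 𝓜.cell v)
    (hμ : 𝓜.push μ = μ) (hH : ∫⁻ z, ENNReal.ofReal (𝓜.height x z) ∂μ ≠ ⊤)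
    (hM : 𝓜.IsGeneralizedMarkovMeasure μ M) :
    ksEntropy leftShift M + energyIntegral M (𝓜.energy x) = 0 := by
  have := hM.isProbabilityMeasure
  have hY := hM.ae_mem_codingDomain hcontr hopen hx hμ hH
  rw [energyIntegral_energy hY (integrable_rate hopen hpos hx hY),
    hM.ksEntropy_eq hcontr hopen hdini hpos hx hμ hH, hM.integral_rate hcontr hopen hx hμ hH,
    ← EReal.coe_add, add_neg_cancel, EReal.coe_zero]

end MarkovSystem


theorem corollary1 {K V E : Type*} [MetricSpace K] [ProperSpace K] [Nonempty K]
    [MeasurableSpace K] [BorelSpace K] [Fintype V] [Fintype E]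
    [MeasurableSpace E] [DiscreteMeasurableSpace E]
    (𝓜 : MarkovSystem K V E)
    (hopen : ∀ v, IsOpen (𝓜.cell v))
    (hcontr : 𝓜.IsContractive)
    (hirr : 𝓜.IsIrreducible)
    (hdini : ∀ e, DiniContinuousOn (𝓜.p e) (𝓜.cell (𝓜.init e)))
    (hpos : ∀ e, ∃ δ : ℝ, 0 < δ ∧ ∀ y ∈ 𝓜.cell (𝓜.init e), δ ≤ 𝓜.p e y)
    (x : V → K) (hx : ∀ v, x v ∈ 𝓜.cell v) :
    IsEnergyFunction (𝓜.energy x) ∧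
    (∃! μ : Measure K, 𝓜.IsInvariantMeasure μ) ∧
    ∀ μ : Measure K, 𝓜.IsInvariantMeasure μ →
      (∃! M : Measure (ℤ → E), 𝓜.IsGeneralizedMarkovMeasure μ M) ∧
      ∀ M : Measure (ℤ → E), 𝓜.IsGeneralizedMarkovMeasure μ M →
        (IsEquilibriumState leftShift (𝓜.energy x) M ∧
          ∀ Λ : Measure (ℤ → E), IsEquilibriumState leftShift (𝓜.energy x) Λ → Λ = M) ∧
        pressure (leftShift : (ℤ → E) → (ℤ → E)) (𝓜.energy x) = 0 ∧
        ((∀ᵐ σ ∂M, σ ∈ 𝓜.codingDomain x) ∧ M.map (𝓜.codingMap x) = μ) ∧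
        ksEntropy leftShift M =
          ((-∑ e, ∫ y in 𝓜.cell (𝓜.init e), 𝓜.p e y * Real.log (𝓜.p e y) ∂μ : ℝ) : EReal) := by
  obtain ⟨μ₀, hμ₀, hinv₀, hH₀⟩ := 𝓜.exists_push_eq hcontr hopen hdini hpos hx
  have huniq : ∀ μ, 𝓜.IsInvariantMeasure μ → μ = μ₀ := fun μ hμ => by
    obtain ⟨hprob, hinv⟩ := (𝓜.isInvariantMeasure_iff μ).1 hμ
    exact MarkovSystem.push_eq_unique hcontr hirr hdini hpos hinv hinv₀
  refine ⟨MarkovSystem.isEnergyFunction_energy x,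
    ⟨μ₀, (𝓜.isInvariantMeasure_iff μ₀).2 ⟨hμ₀, hinv₀⟩, huniq⟩, fun μ hμ => ?_⟩
  obtain rfl := huniq μ hμ
  refine ⟨?_, fun M hM => ?_⟩
  · obtain ⟨M, -, hM⟩ := MarkovSystem.exists_isGeneralizedMarkovMeasure (E := E) hinv₀
    exact ⟨M, hM, fun M' hM' => hM'.eq hM⟩
  have hM0 := hM.ksEntropy_add_energyIntegral hcontr hopen hdini hpos hx hinv₀ hH₀
  have hP : pressure (leftShift : (ℤ → E) → (ℤ → E)) (𝓜.energy x) = 0 := by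
    refine le_antisymm (iSup₂_le fun Θ hΘ =>
      MarkovSystem.ksEntropy_add_energyIntegral_le_zero hΘ hopen hdini hpos hx) ?_
    rw [← hM0]
    exact le_iSup₂_of_le M hM.isInvariantProb le_rfl
  refine ⟨⟨⟨hM.isInvariantProb, hM0.trans hP.symm⟩, fun Λ hΛ => ?_⟩, hP,
    ⟨hM.ae_mem_codingDomain hcontr hopen hx hinv₀ hH₀,
      hM.map_codingMap hcontr hopen hx hinv₀ hH₀⟩, ?_⟩
  · obtain ⟨hΛinv, hΛ0⟩ := hΛ
    have hprob := hΛinv.1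
    obtain ⟨hY, hlaw⟩ := MarkovSystem.nextLetterLaw_of_ksEntropy_add_energyIntegral_eq_zero
      hΛinv hopen hdini hpos hx (hΛ0.trans hP)
    -- An equilibrium state is the generalized Markov measure of its own image under F; that image
    -- is invariant, hence equal to μ.
    have hΛM := hlaw.isGeneralizedMarkovMeasure hΛinv hcontr hopen hpos hx hY
    have := Measure.isProbabilityMeasure_map (μ := Λ)
      (MarkovSystem.measurable_codingMap (𝓜 := 𝓜) x).aemeasurable
    rw [MarkovSystem.push_eq_unique hcontr hirr hdini hpos
      (hlaw.push_map_codingMap hΛinv hcontr hopen hpos hx hY) hinv₀] at hΛM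
    exact hΛM.eq hM
  · rw [hM.ksEntropy_eq hcontr hopen hdini hpos hx hinv₀ hH₀,
      MarkovSystem.integral_pointEntropy]
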